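/- Let $\phi=\frac{1+\sqrt5}{2}$ and $\sigma=\sqrt{1+1/\phi^2}$; identify $(\mathbb R^3)^*$ with $\mathbb R^3$ by the standard inner product. Let $V_1=(\phi-1,1,0)$, $V_2=(0,\phi-1,1)$, $V_3=(1,0,\phi-1)$, $V_4=(1-\phi,1,0)$, $V_5=(0,1-\phi,1)$, $V_6=(1,0,1-\phi)$ (with their opposites, the vertices of an icosahedron), and let $Q\subset\mathbb R^3$ be the icosahedral quasilattice, the $\mathbb Z$-span of $U_1=\frac12(1,\phi-1,\phi)$, $U_2=\frac12(\phi,1,\phi-1)$, $U_3=\frac12(\phi-1,\phi,1)$, $U_4=\frac12(-1,\phi-1,\phi)$, $U_5=\frac12(\phi,-1,\phi-1)$, $U_6=\frac12(\phi-1,\phi,-1)$. A golden rhombohedron is a rhombohedron whose facets are rhombuses with diagonals in the ratio $\phi$; it is oblate (prolate) if the three facet angles at some vertex are all obtuse (all acute). Let $\mathcal T$ be an Ammann tiling with edge length $\sigma$, that is, a nonperiodic face-to-face (locally finite) tiling of $\mathbb R^3$ by oblate and prolate golden rhombohedra with edge length $\sigma$. Choose coordinates so that the segment from $0$ to $V_1$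 is an edge of $\mathcal T$ and some facet of $\mathcal T$ containing this edge has its other sides parallel to some $V_k$, $k\neq1$. For a tile $\Delta$ of $\mathcal T$ let $X_1,\dots,X_6$ be the inward-pointing unit normal vectors of its facets, numbered in any way, and write $\Delta=\bigcap_j\{\mu:\langle\mu,X_j\rangle\ge\lambda_j\}$. Let $\pi:\mathbb R^6\to\mathbb R^3$, $e_j\mapsto X_j$, let $N=\{\exp x\in T^6: x\in\mathbb R^6,\ \pi(x)\in Q\}$ where $\exp x=(e^{2\pi i x_1},\dots,e^{2\pi i x_6})$, let $J(z)=\sum_j(|z_j|^2+\lambda_j)e_j^*$ on $\mathbb C^6$ with the symplectic form $\frac1{2\pi i}\sum_j dz_j\wedge d\bar z_j$, and let $\Psi(z)$ be the restriction of $J(z)$ to $\ker\pi=\mathrm{Lie}(N)$. The generalized Delzant construction assigns to $\Delta$ the reduced space $M_\Delta=\Psi^{-1}(0)/N$. For $b>0$ let $S^2_b\subset\mathbb R^3$ be the sphere of radius $b$ centred at $0$, with the symplectic form $-\frac1{4\pi}$ times its area form (the form obtained by reducing the $3$-sphere of radius $b$ in $(\mathbb C^2,\frac1{2\pi i}\sum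 dz_j\wedge d\bar z_j)$ by the diagonal circle action). Let the discrete group $\Gamma=\{(e^{2\pi i\phi h},e^{2\pi i\phi k},e^{2\pi i\phi l}): h,k,l\in\mathbb Z\}$ act on $S^2_b\times S^2_b\times S^2_b$ by rotations of the three factors about the third axis. Let $$M_b=(S^2_b\times S^2_b\times S^2_b)/\Gamma\ \text{ with } b=1/\sqrt\phi,\qquad M_r=(S^2_1\times S^2_1\times S^2_1)/\Gamma .$$ Then $M_b$ and $M_r$, with the structures induced from the products of spheres, are compact connected symplectic quasifolds of dimension $6$. Each carries an effective Hamiltonian action of the quasitorus $\mathbb R^3/Q$; the image of the moment mapping is, respectively, the oblate rhombohedron with vertex $0$ and edges $V_4,V_5,V_6$, and the prolate rhombohedron with vertex $0$ and edges $V_1,V_2,V_3$. For every tile $\Delta$ of any such tiling, the vectors $X_1,\dots,X_6$ lie in $Q$, and $M_\Delta$ is a compact connected symplectic quasifold, with the structure induced from $\Psi^{-1}(0)$ by reduction, on which the action of $T^6$ induces an effective Hamiltonian action of $\mathbb R^3/Q$ whose moment mapping $\Phi$, given by $\langle\Phi([z]),X_j\rangle=|z_j|^2+\lambda_j$, has image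 $\Delta$. If $\Delta$ is oblate, $M_\Delta$ is symplectomorphic to $M_b$; if $\Delta$ is prolate, $M_\Delta$ is symplectomorphic to $M_r$. Here $M_b$ and $M_r$ do not depend on the tile or on the tiling. -/

import Mathlib

open Set Topology
open scoped ContDiff goldenRatio

/-! ### Symplectic quasifolds -/

section Quasifold

variable {E : Type*} [NormedAddCommGroup E] [NormedSpace ℝ E]
variable {M : Type*} [TopologicalSpace M]

/-- A quasifold chart on `M`: a nonempty connected open set `dom` of the vector space `E`, a countable
(discrete) group `Γ` acting smoothly on `dom`, freely on a connected dense subset, and a continuous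
open map `proj : dom → M` whose fibres are exactly the `Γ`-orbits; in other words, a homeomorphism
from `dom / Γ` onto the open subset `proj '' dom` of `M`. -/
structure QuasifoldChart (E : Type*) [NormedAddCommGroup E] [NormedSpace ℝ E]
    (M : Type*) [TopologicalSpace M] where
  dom : Set E
  isOpen_dom : IsOpen dom
  isConnected_dom : IsConnected dom
  Γ : Type
  [group : Group Γ]
  [countable : Countable Γ]
  act : Γ → E → E
  act_mapsTo : ∀ g, MapsTo (act g) dom dom
  act_one : ∀ x ∈ dom, act 1 x = x
  act_mul : ∀ g h, ∀ x ∈ dom, act (g * h) x = act g (act h x)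
  act_smooth : ∀ g, ContDiffOn ℝ ∞ (act g) dom
  isConnected_free : IsConnected {x ∈ dom | ∀ g, act g x = x → g = 1}
  dense_free : dom ⊆ closure {x ∈ dom | ∀ g, act g x = x → g = 1}
  proj : E → M
  continuousOn_proj : ContinuousOn proj dom
  isOpen_image : ∀ V ⊆ dom, IsOpen V → IsOpen (proj '' V)
  proj_eq_iff : ∀ x ∈ dom, ∀ y ∈ dom, proj x = proj y ↔ ∃ g, act g x = y

/-- `e` is a diffeomorphism from an open neighbourhood of `x` in the domain of the chart `a` onto an
open neighbourhood of `y = e x` in the domain of the chart `b`; it is a lift of the map `f` between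
the underlying spaces, and pulls the 2-form `β` back to the 2-form `α`. -/
structure IsSymplecticLift {M' : Type*} [TopologicalSpace M'] (f : M → M')
    (a : QuasifoldChart E M) (α : E → E [⋀^Fin 2]→L[ℝ] ℝ)
    (b : QuasifoldChart E M') (β : E → E [⋀^Fin 2]→L[ℝ] ℝ)
    (x y : E) (e : OpenPartialHomeomorph E E) : Prop where
  mem_source : x ∈ e.source
  apply_eq : e x = y
  source_subset : e.source ⊆ a.dom
  target_subset : e.target ⊆ b.dom
  smooth : ContDiffOn ℝ ∞ e e.source
  smooth_symm : ContDiffOn ℝ ∞ e.symm e.target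
  lifts : ∀ z ∈ e.source, b.proj (e z) = f (a.proj z)
  pullback : ∀ z ∈ e.source, ∀ u v : E,
    α z ![u, v] = β (e z) ![fderiv ℝ e z u, fderiv ℝ e z v]

/-- A symplectic quasifold structure on the space `M`, modelled on `E` (so of dimension
`finrank ℝ E`): an atlas of quasifold charts, each with a symplectic form (smooth, closed,
nondegenerate) that is invariant under the group of the chart. The charts are compatible: whenever
`x` and `y` lie over the same point of `M`, the identity of `M` lifts to a diffeomorphism near `x`
with `x ↦ y`, which matches the forms. (Two such lifts differ, locally on a dense open set, by elements
of the group; the forms being invariant, it does not matter which one is taken.) -/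
structure SymplecticQuasifold (E : Type*) [NormedAddCommGroup E] [NormedSpace ℝ E]
    (M : Type*) [TopologicalSpace M] where
  ι : Type
  chart : ι → QuasifoldChart E M
  form : ι → E → E [⋀^Fin 2]→L[ℝ] ℝ
  cover : ∀ m : M, ∃ i, ∃ x ∈ (chart i).dom, (chart i).proj x = m
  form_smooth : ∀ i, ContDiffOn ℝ ∞ (form i) (chart i).dom
  form_closed : ∀ i, ∀ x ∈ (chart i).dom, extDeriv (form i) x = 0
  form_nondegenerate : ∀ i, ∀ x ∈ (chart i).dom, ∀ u : E, u ≠ 0 → ∃ v, form i x ![u, v] ≠ 0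
  form_invariant : ∀ i g, ∀ x ∈ (chart i).dom, ∀ u v : E,
    form i x ![u, v] = form i ((chart i).act g x)
      ![fderiv ℝ ((chart i).act g) x u, fderiv ℝ ((chart i).act g) x v]
  compatible : ∀ i j, ∀ x ∈ (chart i).dom, ∀ y ∈ (chart j).dom,
    (chart i).proj x = (chart j).proj y →
      ∃ e, IsSymplecticLift id (chart i) (form i) (chart j) (form j) x y e

/-- Symplectomorphism of symplectic quasifolds: a homeomorphism that lifts locally to
symplectic diffeomorphisms between charts. -/
def Symplectomorphic {M' : Type*} [TopologicalSpace M']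
    (S : SymplecticQuasifold E M) (S' : SymplecticQuasifold E M') : Prop :=
  ∃ f : M ≃ₜ M', ∀ i j, ∀ x ∈ (S.chart i).dom, ∀ y ∈ (S'.chart j).dom,
    f ((S.chart i).proj x) = (S'.chart j).proj y →
      ∃ e, IsSymplecticLift f (S.chart i) (S.form i) (S'.chart j) (S'.form j) x y e

/-- Let `Z` be a subset of a normed space `F`, let `r` be the orbit relation of a group acting
on `Z`, and `α` a 2-form on `F`. The symplectic quasifold structure `S` on the quotient of `Z` by `r`
is the one induced by `α`: the chart maps lift locally, through any chosen point of the fibre, to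
smooth maps `s` into `Z`, and the pull-back `s^* α` is the form of the chart. (For a level set of a
moment mapping this characterizes the reduced symplectic structure, and for a discrete group acting
on a symplectic manifold `Z` the global quotient structure.) -/
def SymplecticQuasifold.IsInduced {F : Type*} [NormedAddCommGroup F] [NormedSpace ℝ F]
    {Z : Set F} {r : Setoid Z} (S : SymplecticQuasifold E (Quotient r)) (α : F → F → F → ℝ) : Prop :=
  ∀ i, ∀ x ∈ (S.chart i).dom, ∀ z : Z, (S.chart i).proj x = Quotient.mk r z →
    ∃ (W : Set E) (s : E → F), IsOpen W ∧ x ∈ W ∧ W ⊆ (S.chart i).dom ∧ ContDiffOn ℝ ∞ s W ∧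
      s x = z ∧
      ∀ y ∈ W, (∃ hy : s y ∈ Z, (S.chart i).proj y = Quotient.mk r ⟨s y, hy⟩) ∧
        ∀ u v : E, S.form i y ![u, v] = α (s y) (fderiv ℝ s y u) (fderiv ℝ s y v)

variable {V : Type*} [NormedAddCommGroup V] [InnerProductSpace ℝ V]

/-- A Hamiltonian action of the quasitorus `V / Q` on a symplectic quasifold. The dual of `V` is
identified with `V` by the inner product. The action is smooth as a map `V / Q × M → M`, that is, it
lifts locally to smooth maps `V × E → E`; it preserves the symplectic form; the moment mapping is
smooth and invariant, and `d⟨moment, ξ⟩` is the contraction of the form with the fundamental vector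
field of `ξ`, which is computed with a local lift that is the identity at `0 ∈ V`. -/
structure HamiltonianAction (Q : AddSubgroup V) (S : SymplecticQuasifold E M) where
  act : V ⧸ Q → M → M
  act_zero : ∀ m, act 0 m = m
  act_add : ∀ d d' m, act (d + d') m = act d (act d' m)
  act_smooth : ∀ i j, ∀ x ∈ (S.chart i).dom, ∀ y ∈ (S.chart j).dom, ∀ ξ₀ : V,
    act (QuotientAddGroup.mk ξ₀) ((S.chart i).proj x) = (S.chart j).proj y →
      ∃ (W : Set (V × E)) (G : V × E → E), IsOpen W ∧ (ξ₀, x) ∈ W ∧ ContDiffOn ℝ ∞ G W ∧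
        G (ξ₀, x) = y ∧
        ∀ ξ z, (ξ, z) ∈ W → z ∈ (S.chart i).dom ∧ G (ξ, z) ∈ (S.chart j).dom ∧
          (S.chart j).proj (G (ξ, z)) = act (QuotientAddGroup.mk ξ) ((S.chart i).proj z) ∧
          ∀ u v : E, S.form i z ![u, v] = S.form j (G (ξ, z))
            ![fderiv ℝ (fun z' => G (ξ, z')) z u, fderiv ℝ (fun z' => G (ξ, z')) z v]
  moment : M → V
  moment_invariant : ∀ d m, moment (act d m) = moment m
  moment_smooth : ∀ i, ContDiffOn ℝ ∞ (fun x => moment ((S.chart i).proj x)) (S.chart i).dom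
  moment_spec : ∀ i, ∀ x ∈ (S.chart i).dom,
    ∃ (W : Set (V × E)) (G : V × E → E), IsOpen W ∧ ((0 : V), x) ∈ W ∧ ContDiffOn ℝ ∞ G W ∧
      (∀ ξ z, (ξ, z) ∈ W → z ∈ (S.chart i).dom ∧ G (ξ, z) ∈ (S.chart i).dom ∧
        (S.chart i).proj (G (ξ, z)) = act (QuotientAddGroup.mk ξ) ((S.chart i).proj z)) ∧
      (∀ z, ((0 : V), z) ∈ W → G (0, z) = z) ∧
      ∀ (ξ : V) (v : E),
        fderiv ℝ (fun z => inner ℝ (moment ((S.chart i).proj z)) ξ) x v =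
          S.form i x ![fderiv ℝ (fun η => G (η, x)) 0 ξ, v]

/-- The action is effective. -/
def HamiltonianAction.Effective {Q : AddSubgroup V} {S : SymplecticQuasifold E M}
    (H : HamiltonianAction Q S) : Prop :=
  ∀ d, (∀ m, H.act d m = m) → d = 0

end Quasifold

/-! ### The generalized Delzant construction -/

section Delzant

variable {ι : Type*} [Fintype ι] {V : Type*} [AddCommGroup V] [Module ℝ V]

/-- The linear map `π : ℝ^d → V`, `e_j ↦ X_j`. -/
noncomputable def delzantMap (X : ι → V) : (ι → ℝ) →ₗ[ℝ] V := Fintype.linearCombination ℝ X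

/-- `exp : ℝ^d → T^d`, `x ↦ (e^{2πi x_1}, …, e^{2πi x_d})`. -/
noncomputable def torusExp {ι : Type*} (x : ι → ℝ) : ι → Circle :=
  fun j => Circle.exp (2 * Real.pi * x j)

lemma torusExp_add {ι : Type*} (x y : ι → ℝ) : torusExp (x + y) = torusExp x * torusExp y := by
  funext j
  simp [torusExp, mul_add, Circle.exp_add]

lemma torusExp_zero {ι : Type*} : torusExp (0 : ι → ℝ) = 1 := by
  funext j
  simp [torusExp]

lemma torusExp_neg {ι : Type*} (x : ι → ℝ) : torusExp (-x) = (torusExp x)⁻¹ := by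
  rw [eq_inv_iff_mul_eq_one, ← torusExp_add, neg_add_cancel, torusExp_zero]

/-- The group `N = {exp x | π x ∈ Q}`, the kernel of `T^d → V / Q`. -/
noncomputable def delzantGroup (Q : AddSubgroup V) (X : ι → V) : Subgroup (ι → Circle) where
  carrier := {t | ∃ x, delzantMap X x ∈ Q ∧ torusExp x = t}
  one_mem' := ⟨0, by simp [Q.zero_mem], torusExp_zero⟩
  mul_mem' := by
    rintro _ _ ⟨x, hx, rfl⟩ ⟨y, hy, rfl⟩
    exact ⟨x + y, by rw [map_add]; exact Q.add_mem hx hy, torusExp_add x y⟩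
  inv_mem' := by
    rintro _ ⟨x, hx, rfl⟩
    exact ⟨-x, by rw [map_neg]; exact Q.neg_mem hx, torusExp_neg x⟩

/-- The standard action of the torus `T^d` on `ℂ^d`. -/
def torusAct {ι : Type*} (t : ι → Circle) (z : ι → ℂ) : ι → ℂ := fun j => (t j : ℂ) * z j

/-- The zero level set of the moment mapping `Ψ = i^* ∘ J` of the action of `N` on `ℂ^d`, where
`J z = ∑ (|z_j|² + λ_j) e_j^*` and `i : Lie N = ker π → ℝ^d` is the inclusion. -/
def delzantLevel (X : ι → V) (c : ι → ℝ) : Set (ι → ℂ) :=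
  {z | ∀ x, delzantMap X x = 0 → ∑ j, (‖z j‖ ^ 2 + c j) * x j = 0}

/-- The orbit relation of `N` on the level set. -/
def delzantSetoid (Q : AddSubgroup V) (X : ι → V) (c : ι → ℝ) : Setoid (delzantLevel X c) where
  r z w := ∃ t ∈ delzantGroup Q X, (w : ι → ℂ) = torusAct t z
  iseqv :=
    { refl := fun z => ⟨1, Subgroup.one_mem _, by funext j; simp [torusAct]⟩
      symm := by
        rintro z w ⟨t, ht, h⟩
        refine ⟨t⁻¹, Subgroup.inv_mem _ ht, ?_⟩
        funext j
        rw [h]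
        simp [torusAct]
      trans := by
        rintro z w v ⟨t, ht, h⟩ ⟨s, hs, h'⟩
        refine ⟨s * t, Subgroup.mul_mem _ hs ht, ?_⟩
        funext j
        rw [h', h]
        simp [torusAct, mul_assoc] }

/-- The reduced space `Ψ⁻¹(0) / N`, with the quotient topology. -/
abbrev DelzantSpace (Q : AddSubgroup V) (X : ι → V) (c : ι → ℝ) : Type _ :=
  Quotient (delzantSetoid Q X c)

/-- The standard symplectic form `(1 / 2πi) ∑ dz_j ∧ dz̄_j` of `ℂ^d`, evaluated at a pair of
tangent vectors `u`, `v`: it is `(1 / 2πi) ∑ (u_j v̄_j - ū_j v_j) = (1 / π) ∑ Im (u_j v̄_j)`. -/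
noncomputable def standardForm (_z u v : ι → ℂ) : ℝ :=
  ∑ j, (1 / Real.pi) * (u j * (starRingEnd ℂ) (v j)).im

end Delzant

/-! ### Golden rhombohedra, Ammann tilings and the two quasilattices -/

/-- Euclidean three-space, identified with its dual by the inner product. -/
abbrev E3 : Type := EuclideanSpace ℝ (Fin 3)

/-- The edge length. -/
noncomputable def edgeLength : ℝ := √(1 + 1 / φ ^ 2)

/-- Six of the twelve vertices of an icosahedron, one from each antipodal pair. -/
noncomputable def vecV : Fin 6 → E3 :=
  ![!₂[φ - 1, 1, 0], !₂[0, φ - 1, 1], !₂[1, 0, φ - 1],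
    !₂[1 - φ, 1, 0], !₂[0, 1 - φ, 1], !₂[1, 0, 1 - φ]]

/-- Six of the thirty vertices of an icosidodecahedron. -/
noncomputable def vecU : Fin 6 → E3 :=
  ![!₂[1 / 2, (φ - 1) / 2, φ / 2], !₂[φ / 2, 1 / 2, (φ - 1) / 2], !₂[(φ - 1) / 2, φ / 2, 1 / 2],
    !₂[-1 / 2, (φ - 1) / 2, φ / 2], !₂[φ / 2, -1 / 2, (φ - 1) / 2],
    !₂[(φ - 1) / 2, φ / 2, -1 / 2]]

/-- The icosahedral quasilattice `Q`. -/
noncomputable def quasilatticeQ : AddSubgroup E3 := AddSubgroup.closure (range vecU)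

/-- The rhombohedron with a vertex at `p` and edge vectors `e 0`, `e 1`, `e 2` there. -/
def rhombohedron (p : E3) (e : Fin 3 → E3) : Set E3 := (fun x => p + x) '' parallelepiped e

/-- Oblate golden rhombohedra with edge length `σ`: the facets are golden rhombuses (the ratio of
the diagonals is `φ`), and there is a vertex at which the three facets have obtuse angles. -/
def IsOblate (σ : ℝ) (Δ : Set E3) : Prop :=
  ∃ (p : E3) (e : Fin 3 → E3), Δ = rhombohedron p e ∧ (∀ i, ‖e i‖ = σ) ∧
    ∀ i j, i ≠ j → ‖e i - e j‖ = φ * ‖e i + e j‖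

/-- Prolate golden rhombohedra with edge length `σ`: the facets are golden rhombuses, and there is
a vertex at which the three facets have acute angles. -/
def IsProlate (σ : ℝ) (Δ : Set E3) : Prop :=
  ∃ (p : E3) (e : Fin 3 → E3), Δ = rhombohedron p e ∧ (∀ i, ‖e i‖ = σ) ∧
    ∀ i j, i ≠ j → ‖e i + e j‖ = φ * ‖e i - e j‖

/-- Ammann tilings with edge length `σ`: nonperiodic face-to-face tilings of space by oblate and
prolate golden rhombohedra with edge length `σ`. -/
structure IsAmmannTiling (σ : ℝ) (T : Set (Set E3)) : Prop where
  tiles : ∀ Δ ∈ T, IsOblate σ Δ ∨ IsProlate σ Δ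
  cover : ⋃₀ T = univ
  faceToFace : ∀ Δ ∈ T, ∀ Δ' ∈ T, Δ ≠ Δ' →
    IsExposed ℝ Δ (Δ ∩ Δ') ∧ IsExposed ℝ Δ' (Δ ∩ Δ')
  locallyFinite : ∀ r : ℝ, {Δ ∈ T | (Δ ∩ Metric.closedBall 0 r).Nonempty}.Finite
  nonperiodic : ∀ v : E3, v ≠ 0 → (fun Δ => (fun x => v + x) '' Δ) '' T ≠ T

/-- The choice of coordinates: the segment from the origin to `V_1` is an edge of the tiling, and
some facet of the tiling that contains this edge has its other sides parallel to some `V_k`,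
`k ≠ 1`. -/
def IsAligned (T : Set (Set E3)) : Prop :=
  ∃ (k : Fin 6) (ε : ℝ) (w : E3), k ≠ 0 ∧ (ε = 1 ∨ ε = -1) ∧
    rhombohedron 0 ![vecV 0, ε • vecV k, w] ∈ T

/-- `X` enumerates the inward-pointing unit normal vectors of the six facets of the rhombohedron
`Δ`, and `c` the corresponding coefficients. -/
def IsUnitPresentation (Δ : Set E3) (X : Fin 6 → E3) (c : Fin 6 → ℝ) : Prop :=
  (∀ j, ‖X j‖ = 1) ∧ Δ = {μ | ∀ j, c j ≤ inner ℝ μ (X j)}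

/-! ### The quotients `(S²_b × S²_b × S²_b) / Γ` -/

/-- The discrete group `Γ = {exp (φ h, φ k, φ l) | h, k, l ∈ ℤ}`. -/
noncomputable def groupΓ : Subgroup (Fin 3 → Circle) where
  carrier := {t | ∃ h : Fin 3 → ℤ, t = torusExp (fun i => φ * h i)}
  one_mem' := ⟨0, by
    rw [← torusExp_zero]; congr 1; funext i; simp⟩
  mul_mem' := by
    rintro _ _ ⟨h, rfl⟩ ⟨k, rfl⟩
    refine ⟨h + k, ?_⟩
    rw [← torusExp_add]; congr 1; funext i; simp [mul_add]
  inv_mem' := by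
    rintro _ ⟨h, rfl⟩
    refine ⟨-h, ?_⟩
    rw [← torusExp_neg]; congr 1; funext i; simp

/-- Rotation of three-space about the third axis, through the argument of `t`. -/
noncomputable def rotate (t : Circle) (p : E3) : E3 :=
  !₂[(t : ℂ).re * p 0 - (t : ℂ).im * p 1, (t : ℂ).im * p 0 + (t : ℂ).re * p 1, p 2]

lemma rotate_one (p : E3) : rotate 1 p = p := by
  ext i; fin_cases i <;> simp [rotate]

lemma rotate_mul (s t : Circle) (p : E3) : rotate (s * t) p = rotate s (rotate t p) := by
  ext i; fin_cases i <;> simp [rotate] <;> ring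

/-- The product of three copies of the sphere of radius `b` in three-space. -/
def sphereCube (b : ℝ) : Set (Fin 3 → E3) := {p | ∀ i, ‖p i‖ = b}

/-- The orbit relation of `Γ`, which acts on the three spheres by rotations. -/
def sphereSetoid (b : ℝ) : Setoid (sphereCube b) where
  r p q := ∃ t ∈ groupΓ, ∀ i, q.1 i = rotate (t i) (p.1 i)
  iseqv :=
    { refl := fun p => ⟨1, Subgroup.one_mem _, fun i => (rotate_one _).symm⟩
      symm := by
        rintro p q ⟨t, ht, h⟩
        refine ⟨t⁻¹, Subgroup.inv_mem _ ht, fun i => ?_⟩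
        rw [h, ← rotate_mul, Pi.inv_apply, inv_mul_cancel, rotate_one]
      trans := by
        rintro p q r ⟨t, ht, h⟩ ⟨s, hs, h'⟩
        refine ⟨s * t, Subgroup.mul_mem _ hs ht, fun i => ?_⟩
        rw [h', h, ← rotate_mul, Pi.mul_apply] }

/-- The space `(S²_b × S²_b × S²_b) / Γ`, with the quotient topology. -/
abbrev SphereQuotient (b : ℝ) : Type := Quotient (sphereSetoid b)

/-- The product of the symplectic forms `-(1 / 4π) · (area form)` of the three spheres of radius `b`.
Up to the sign, which is the one of the form `(1 / 2πi) dz ∧ dz̄` of `ℂ`, this gives each sphere the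
area `b²`, as for the sphere obtained from the 3-sphere of radius `b` in `ℂ²` by reduction. -/
noncomputable def sphereForm (b : ℝ) (p u v : Fin 3 → E3) : ℝ :=
  ∑ i, -(1 / (4 * Real.pi * b)) * Matrix.det (Matrix.of ![(p i).ofLp, (u i).ofLp, (v i).ofLp])

/-! ### The quasifold of a tile -/

/-- The generalized Delzant construction, applied to the rhombohedron `Δ` with respect to the
quasilattice `Q` and the inward-pointing unit normal vectors of its facets, is possible and gives the
symplectic quasifold `S₀`: there are unit normal vectors, and, however these are numbered, they lie
in `Q`, the reduced space is a compact connected symplectic quasifold that is symplectomorphic to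
`S₀`, and the action of `T^6` on `ℂ^6` induces on it an effective Hamiltonian action of the quasitorus
`ℝ³ / Q`, with the moment mapping induced by `J`, whose image is `Δ`. -/
def DelzantGives (Δ : Set E3) {M₀ : Type} [TopologicalSpace M₀]
    (S₀ : SymplecticQuasifold (Fin 3 → ℂ) M₀) : Prop :=
  (∃ X c, IsUnitPresentation Δ X c) ∧
  ∀ X c, IsUnitPresentation Δ X c →
    (∀ j, X j ∈ quasilatticeQ) ∧
    CompactSpace (DelzantSpace quasilatticeQ X c) ∧
    ConnectedSpace (DelzantSpace quasilatticeQ X c) ∧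
    ∃ S : SymplecticQuasifold (Fin 3 → ℂ) (DelzantSpace quasilatticeQ X c),
      S.IsInduced standardForm ∧
      Symplectomorphic S S₀ ∧
      ∃ H : HamiltonianAction quasilatticeQ S,
        (∀ (x : Fin 6 → ℝ) (z w : delzantLevel X c),
          (w : Fin 6 → ℂ) = torusAct (torusExp x) z →
            H.act (QuotientAddGroup.mk (delzantMap X x)) (Quotient.mk _ z) = Quotient.mk _ w) ∧
        (∀ (z : delzantLevel X c) (j : Fin 6),
          inner ℝ (H.moment (Quotient.mk _ z)) (X j) = ‖(z : Fin 6 → ℂ) j‖ ^ 2 + c j) ∧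
        H.Effective ∧
        range H.moment = Δ

/-!
All spaces in the theorem are presented as quotients of one space: the product `sphereLevel b` of
three 3-spheres of radius `b` in `(ℂ²)³`, divided by the three diagonal circles and the discrete
group of the rotations `(e^{2πiφh}, 1)` of the three copies of `ℂ²`. Such a presentation of a space
is a `SphereModel b`. The sections of the Hopf map over a sphere minus a pole give eight charts onto
quotients of polydiscs by `ℤ³`, and the transition maps are products of rotations and of the maps
`|z|² ↦ b² - |z|²`, `arg z ↦ const - arg z`, which preserve the standard form. So every space with a
sphere model is a compact connected symplectic quasifold (`SphereModel.quasifold`), and two spaces with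
sphere models of the same radius are symplectomorphic (`SphereModel.symplectomorphic`), because the
identity of `sphereLevel b` descends. The Hopf map gives a sphere model of the quotient of the product
of three 2-spheres (`sphereQuotientModel`).

Let a rhombohedron have edge vectors `e i` and facet normals `± n i`, with `⟪e i, n j⟫ = b² δ_ij`, so
that opposite facets are at distance `b²`. Then the level set `Ψ⁻¹(0)` of the Delzant construction is
the product of 3-spheres of radius `b`. The group `N` acts on it by the three diagonal circles
and by `e^{2πi⟪e i, ξ⟫/b²}` for `ξ ∈ Q`, which is the golden group exactly if `Q` consists of the `ξ`
with all `⟪e i, ξ⟫ / b²` in `ℤ[φ]`. This is the notion of a `GoldenBox`; for such rhombohedra the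
reduced space has a sphere model (`delzantModel`) and the conclusion follows
(`GoldenBox.delzantGives`), every presentation by unit normals being the obvious one up to numbering.

Since `Q` is the dual over `ℤ[φ]` of the module generated by the `V_k` (`mem_quasilatticeQ_iff`), a
golden rhombohedron with edges among the `± V_k` is a golden box. A computation with Gram matrices
gives the heights: `b² = 1` for prolate and `b² = 1/φ` for oblate ones (`exists_goldenBox_prolate`,
`exists_goldenBox_oblate`).

It remains to see that all edges of an aligned Ammann tiling are among the `± V_k`. The six lines
spanned by the `V_k` are equiangular, and a vector of length `σ` that makes the golden angles with two
of them is again one of the `± V_k` (`isIcosahedral_of_inner_vecV`). So two edge directions of a tile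
determine whether it is icosahedral, and this holds for the tile with the given edge and facet. The
width of a face in every direction determines its edges (`eq_or_eq_neg_of_sum_abs_eq`), whence two
tiles that share a facet are both icosahedral or both not. Finally, a generic segment misses all edges
of the locally finite tiling, so by connectedness it cannot lead from an icosahedral tile to one that
is not (`IsAmmannTiling.isIcosahedralTile`).
-/

/-! ### Discs: rotations and the change of pole -/

/-- The phase `e^{2πiφk}`. -/
noncomputable def goldenPhase (k : ℤ) : Circle := Circle.exp (2 * Real.pi * (φ * k))

lemma goldenPhase_zero : goldenPhase 0 = 1 := by simp [goldenPhase]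

lemma goldenPhase_add (k l : ℤ) : goldenPhase (k + l) = goldenPhase k * goldenPhase l := by
  simp [goldenPhase, mul_add, Circle.exp_add]

lemma goldenPhase_neg (k : ℤ) : goldenPhase (-k) = (goldenPhase k)⁻¹ := by
  rw [eq_inv_iff_mul_eq_one, ← goldenPhase_add, neg_add_cancel, goldenPhase_zero]

/-- The golden ratio being irrational, the rotations `e^{2πiφk}` are pairwise distinct. -/
lemma goldenPhase_eq_one {k : ℤ} (h : goldenPhase k = 1) : k = 0 := by
  rw [goldenPhase, Circle.exp_eq_one] at h
  obtain ⟨m, hm⟩ := h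
  have hpi := Real.pi_pos
  have h1 : φ * k = m := by
    have : (2 * Real.pi) * (φ * k) = (2 * Real.pi) * m := by rw [hm]; ring
    exact mul_left_cancel₀ (by positivity) this
  by_contra hk
  exact (Real.goldenRatio_irrational.mul_intCast hk).ne_int m h1

/-- The constant symplectic form `(1/2πi) dz ∧ dz̄` of `ℂ`. -/
noncomputable def planeForm (u v : ℂ) : ℝ := (1 / Real.pi) * (u * (starRingEnd ℂ) v).im

/-- A diffeomorphism between open subsets of the disc of radius `b` that preserves
`(1/2πi) dz ∧ dz̄`. -/
structure IsDiscSymplecto (b : ℝ) (e : OpenPartialHomeomorph ℂ ℂ) : Prop where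
  source_subset : ∀ z ∈ e.source, ‖z‖ < b
  target_subset : ∀ z ∈ e.target, ‖z‖ < b
  smooth : ContDiffOn ℝ ∞ e e.source
  smooth_symm : ContDiffOn ℝ ∞ e.symm e.target
  pullback : ∀ z ∈ e.source, ∀ u v : ℂ,
    planeForm u v = planeForm (fderiv ℝ e z u) (fderiv ℝ e z v)

lemma planeForm_mul_circle (c : Circle) (u v : ℂ) : planeForm (c * u) (c * v) = planeForm u v := by
  have h : (c : ℂ) * (starRingEnd ℂ) (c : ℂ) = 1 := by
    rw [Complex.mul_conj, Circle.normSq_coe, Complex.ofReal_one]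
  have : (c : ℂ) * u * (starRingEnd ℂ) (c * v) = u * (starRingEnd ℂ) v := by
    rw [map_mul]; linear_combination u * (starRingEnd ℂ) v * h
  rw [planeForm, planeForm, this]

/-- The rotation of the disc of radius `b` by the phase `c`. -/
noncomputable def discRotation (b : ℝ) (c : Circle) : OpenPartialHomeomorph ℂ ℂ where
  toFun z := c * z
  invFun z := (c⁻¹ : Circle) * z
  source := {z | ‖z‖ < b}
  target := {z | ‖z‖ < b}
  map_source' z hz := by
    simpa only [mem_ofPred_eq, norm_mul, Circle.norm_coe, one_mul] using hz
  map_target' z hz := by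
    simpa only [mem_ofPred_eq, norm_mul, Circle.norm_coe, one_mul] using hz
  left_inv' z _ := by rw [← mul_assoc, ← Circle.coe_mul]; simp
  right_inv' z _ := by rw [← mul_assoc, ← Circle.coe_mul]; simp
  open_source := isOpen_lt continuous_norm continuous_const
  open_target := isOpen_lt continuous_norm continuous_const
  continuousOn_toFun := by fun_prop
  continuousOn_invFun := by fun_prop

lemma contDiff_const_mul (c : ℂ) : ContDiff ℝ ∞ (fun z : ℂ => c * z) :=
  contDiff_const.mul contDiff_id

lemma fderiv_const_mul_id (c z u : ℂ) : fderiv ℝ (fun z : ℂ => c * z) z u = c * u := by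
  have h : HasFDerivAt (𝕜 := ℝ) (fun z : ℂ => c * z) (c • ContinuousLinearMap.id ℝ ℂ) z :=
    (hasFDerivAt_id z).const_mul c
  rw [h.fderiv]; simp

lemma isDiscSymplecto_rotation (b : ℝ) (c : Circle) : IsDiscSymplecto b (discRotation b c) where
  source_subset _ hz := hz
  target_subset _ hz := hz
  smooth := (contDiff_const_mul _).contDiffOn
  smooth_symm := (contDiff_const_mul _).contDiffOn
  pullback z _ u v := by
    have h : ∀ w, fderiv ℝ (discRotation b c) z w = c * w := fun w => fderiv_const_mul_id _ z w
    rw [h, h, planeForm_mul_circle]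

/-- The coordinate change between the two polar charts of the sphere: in action-angle terms it is
`|z|² ↦ b² - |z|²`, `arg z ↦ arg c - arg z`. -/
noncomputable def polarFlip (b : ℝ) (c : Circle) (z : ℂ) : ℂ :=
  c * (√(b ^ 2 / ‖z‖ ^ 2 - 1) : ℝ) * (starRingEnd ℂ) z

section Flip

variable {b : ℝ} {c : Circle} {z : ℂ}

lemma ratio_sub_one_pos (h0 : z ≠ 0) (hz : ‖z‖ < b) : 0 < b ^ 2 / ‖z‖ ^ 2 - 1 := by
  have h1 : 0 < ‖z‖ := norm_pos_iff.2 h0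
  rw [sub_pos, one_lt_div (by positivity)]
  exact pow_lt_pow_left₀ hz h1.le two_ne_zero

lemma norm_sq_polarFlip (h0 : z ≠ 0) (hz : ‖z‖ < b) :
    ‖polarFlip b c z‖ ^ 2 = b ^ 2 - ‖z‖ ^ 2 := by
  have h1 : 0 < ‖z‖ := norm_pos_iff.2 h0
  have h2 := ratio_sub_one_pos h0 hz
  rw [polarFlip, norm_mul, norm_mul, Circle.norm_coe, one_mul, Complex.norm_real, RCLike.norm_conj,
    Real.norm_of_nonneg (Real.sqrt_nonneg _), mul_pow, Real.sq_sqrt h2.le]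
  field_simp

lemma norm_polarFlip_lt (h0 : z ≠ 0) (hz : ‖z‖ < b) : ‖polarFlip b c z‖ < b := by
  have h1 : 0 < ‖z‖ := norm_pos_iff.2 h0
  have := norm_sq_polarFlip (c := c) h0 hz
  exact lt_of_pow_lt_pow_left₀ 2 (h1.trans hz).le (by nlinarith)

lemma polarFlip_ne_zero (h0 : z ≠ 0) (hz : ‖z‖ < b) : polarFlip b c z ≠ 0 := by
  intro h
  have h1 : 0 < ‖z‖ := norm_pos_iff.2 h0
  have := norm_sq_polarFlip (c := c) h0 hz
  rw [h, norm_zero] at this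
  nlinarith

lemma polarFlip_polarFlip (h0 : z ≠ 0) (hz : ‖z‖ < b) : polarFlip b c (polarFlip b c z) = z := by
  have h1 : 0 < ‖z‖ := norm_pos_iff.2 h0
  have h2 := ratio_sub_one_pos h0 hz
  have h3 : b ^ 2 - ‖z‖ ^ 2 ≠ 0 := by nlinarith
  have hc : (c : ℂ) * (starRingEnd ℂ) (c : ℂ) = 1 := by
    rw [Complex.mul_conj, Circle.normSq_coe, Complex.ofReal_one]
  have hr : √(b ^ 2 / ‖polarFlip b c z‖ ^ 2 - 1) * √(b ^ 2 / ‖z‖ ^ 2 - 1) = 1 := by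
    rw [norm_sq_polarFlip h0 hz, ← Real.sqrt_mul', Real.sqrt_eq_one]
    · field_simp; ring
    · exact h2.le
  have hr' : ((√(b ^ 2 / ‖polarFlip b c z‖ ^ 2 - 1) : ℝ) : ℂ) * (√(b ^ 2 / ‖z‖ ^ 2 - 1) : ℝ) = 1 := by
    exact_mod_cast hr
  rw [polarFlip]
  nth_rewrite 2 [polarFlip]
  rw [map_mul, map_mul, Complex.conj_conj, Complex.conj_ofReal]
  linear_combination z * hc + (c * (starRingEnd ℂ) (c : ℂ) * z) * hr'

lemma contDiffOn_polarFlip (b : ℝ) (c : Circle) :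
    ContDiffOn ℝ ∞ (polarFlip b c) {z | z ≠ 0 ∧ ‖z‖ < b} := by
  have h1 : ContDiffOn ℝ ∞ (fun z : ℂ => √(b ^ 2 / ‖z‖ ^ 2 - 1)) {z | z ≠ 0 ∧ ‖z‖ < b} := by
    refine ContDiffOn.sqrt ?_ fun z hz => (ratio_sub_one_pos hz.1 hz.2).ne'
    refine (contDiffOn_const.div (contDiff_norm_sq ℝ).contDiffOn fun z hz => ?_).sub contDiffOn_const
    exact pow_ne_zero _ (norm_ne_zero_iff.2 hz.1)
  exact (contDiffOn_const.mul (Complex.ofRealCLM.contDiff.comp_contDiffOn h1)).mul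
    Complex.conjCLE.contDiff.contDiffOn

lemma fderiv_polarFlip (h0 : z ≠ 0) (hz : ‖z‖ < b) :
    ∃ d : ℝ, 2 * √(b ^ 2 / ‖z‖ ^ 2 - 1) * d = -b ^ 2 / ‖z‖ ^ 4 ∧ ∀ u,
      fderiv ℝ (polarFlip b c) z u = c * (((d * (2 * ((starRingEnd ℂ) z * u).re) : ℝ) : ℂ)
        * (starRingEnd ℂ) z + (√(b ^ 2 / ‖z‖ ^ 2 - 1) : ℝ) * (starRingEnd ℂ) u) := by
  have h1 : 0 < ‖z‖ := norm_pos_iff.2 h0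
  have h2 := ratio_sub_one_pos h0 hz
  have hn : HasFDerivAt (fun w : ℂ => ‖w‖ ^ 2) (2 • innerSL ℝ z) z := by
    simpa using (hasFDerivAt_id (𝕜 := ℝ) z).norm_sq
  have hq : HasDerivAt (fun s : ℝ => √(b ^ 2 / s - 1))
      (1 / (2 * √(b ^ 2 / ‖z‖ ^ 2 - 1)) * (-b ^ 2 / (‖z‖ ^ 2) ^ 2)) (‖z‖ ^ 2) := by
    have := ((hasDerivAt_const (‖z‖ ^ 2) (b ^ 2)).div (hasDerivAt_id (‖z‖ ^ 2))
      (by simpa using h0)).sub_const 1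
    have := this.sqrt h2.ne'
    refine HasDerivAt.congr_deriv (f := fun s : ℝ => √(b ^ 2 / s - 1)) this ?_
    change (0 * ‖z‖ ^ 2 - b ^ 2 * 1) / (‖z‖ ^ 2) ^ 2 / (2 * √(b ^ 2 / ‖z‖ ^ 2 - 1)) = _
    ring
  have hs := hq.comp_hasFDerivAt z hn
  have hF := ((Complex.ofRealCLM.hasFDerivAt.comp z hs).const_mul (c : ℂ)).mul
    (Complex.conjCLE.hasFDerivAt (x := z))
  refine ⟨1 / (2 * √(b ^ 2 / ‖z‖ ^ 2 - 1)) * (-b ^ 2 / (‖z‖ ^ 2) ^ 2), ?_, fun u => ?_⟩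
  · have := Real.sqrt_pos.2 h2
    generalize √(b ^ 2 / ‖z‖ ^ 2 - 1) = f at this ⊢
    field_simp
  · have : fderiv ℝ (polarFlip b c) z = _ := hF.fderiv
    rw [this]
    have hi : inner ℝ z u = ((starRingEnd ℂ) z * u).re := by
      simp [Complex.inner]; ring
    simp [hi]
    ring

lemma planeForm_fderiv_polarFlip (h0 : z ≠ 0) (hz : ‖z‖ < b) (u v : ℂ) :
    planeForm u v = planeForm (fderiv ℝ (polarFlip b c) z u) (fderiv ℝ (polarFlip b c) z v) := by
  obtain ⟨d, hd, hf⟩ := fderiv_polarFlip (c := c) h0 hz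
  rw [hf, hf, planeForm_mul_circle, planeForm, planeForm]
  congr 1
  have h1 : 0 < ‖z‖ := norm_pos_iff.2 h0
  have h2 := ratio_sub_one_pos h0 hz
  have hs := Real.sq_sqrt h2.le
  set f := √(b ^ 2 / ‖z‖ ^ 2 - 1)
  -- with `s = |z|²` and `f² = b²/s - 1`, this is `d(s f²)/ds = -1`
  have key : 2 * f * d * ‖z‖ ^ 2 + f ^ 2 = -1 := by
    rw [hd, hs]; field_simp; ring
  have hN : ‖z‖ ^ 2 = z.re ^ 2 + z.im ^ 2 := by
    rw [← Complex.normSq_eq_norm_sq, Complex.normSq_apply]; ring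
  rw [hN] at key
  simp
  linear_combination (-(u.re * v.im - u.im * v.re)) * key

/-- The change of pole as a partial homeomorphism of the disc, its own inverse. -/
noncomputable def discFlip (b : ℝ) (c : Circle) : OpenPartialHomeomorph ℂ ℂ where
  toFun := polarFlip b c
  invFun := polarFlip b c
  source := {z | z ≠ 0 ∧ ‖z‖ < b}
  target := {z | z ≠ 0 ∧ ‖z‖ < b}
  map_source' _ hz := ⟨polarFlip_ne_zero hz.1 hz.2, norm_polarFlip_lt hz.1 hz.2⟩
  map_target' _ hz := ⟨polarFlip_ne_zero hz.1 hz.2, norm_polarFlip_lt hz.1 hz.2⟩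
  left_inv' _ hz := polarFlip_polarFlip hz.1 hz.2
  right_inv' _ hz := polarFlip_polarFlip hz.1 hz.2
  open_source := isOpen_ne.inter (isOpen_lt continuous_norm continuous_const)
  open_target := isOpen_ne.inter (isOpen_lt continuous_norm continuous_const)
  continuousOn_toFun := (contDiffOn_polarFlip b c).continuousOn
  continuousOn_invFun := (contDiffOn_polarFlip b c).continuousOn

lemma isDiscSymplecto_flip (b : ℝ) (c : Circle) : IsDiscSymplecto b (discFlip b c) where
  source_subset _ hz := hz.2
  target_subset _ hz := hz.2
  smooth := contDiffOn_polarFlip b c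
  smooth_symm := contDiffOn_polarFlip b c
  pullback _ hz := planeForm_fderiv_polarFlip hz.1 hz.2

end Flip

/-! ### Polar sections of the three-sphere -/

lemma exists_circle_mul_norm (z : ℂ) : ∃ u : Circle, z = u * ‖z‖ :=
  ⟨Circle.exp z.arg, by rw [Circle.coe_exp, mul_comm, Complex.norm_mul_exp_arg_mul_I]⟩

lemma Circle.mul_conj_self (c : Circle) : (c : ℂ) * (starRingEnd ℂ) (c : ℂ) = 1 := by
  rw [Complex.mul_conj, Circle.normSq_coe, Complex.ofReal_one]

/-- The section of the Hopf map over the sphere of radius `b` in `ℂ²` minus a pole: the coordinate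
with index `β` is the chart coordinate `z`, the other coordinate is real and positive. -/
noncomputable def discSection (b : ℝ) (β : Bool) (z : ℂ) : Bool → ℂ :=
  fun γ => if γ = β then z else (√(b ^ 2 - ‖z‖ ^ 2) : ℝ)

/-- The weights `(e^{2πiφh}, 1)` of the action of the discrete group on `ℂ²`. -/
noncomputable def goldenWeight (h : ℤ) (γ : Bool) : Circle := if γ then goldenPhase h else 1

/-- The phase by which the discrete group acts in the chart with coordinate `β`. -/
noncomputable def chartPhase (β : Bool) (h : ℤ) : Circle := goldenPhase (if β then h else -h)

/-- The chart coordinate of a point of `ℂ²`: the coordinate `u β` after the diagonal rotation that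
makes the other coordinate positive. -/
noncomputable def discCoord (β : Bool) (u : Bool → ℂ) : ℂ :=
  u β * (starRingEnd ℂ) (u (!β)) / ‖u (!β)‖

section Disc

variable {b : ℝ} {β β' : Bool} {z w : ℂ}

@[simp] lemma discSection_self : discSection b β z β = z := by simp [discSection]

@[simp] lemma discSection_not : discSection b β z (!β) = (√(b ^ 2 - ‖z‖ ^ 2) : ℝ) := by
  simp [discSection]

lemma sq_sub_sq_pos (hz : ‖z‖ < b) : 0 < b ^ 2 - ‖z‖ ^ 2 :=
  sub_pos.2 (pow_lt_pow_left₀ hz (norm_nonneg z) two_ne_zero)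

lemma discSection_norm_sq (hz : ‖z‖ < b) :
    ‖discSection b β z true‖ ^ 2 + ‖discSection b β z false‖ ^ 2 = b ^ 2 := by
  have h := Real.sq_sqrt (sq_sub_sq_pos hz).le
  cases β <;> simp [discSection, h]

lemma chartPhase_add (β : Bool) (h k : ℤ) :
    chartPhase β (h + k) = chartPhase β h * chartPhase β k := by
  cases β <;> simp [chartPhase, goldenPhase_add, goldenPhase_neg, mul_comm]

lemma chartPhase_zero (β : Bool) : chartPhase β 0 = 1 := by
  cases β <;> simp [chartPhase, goldenPhase_zero]

lemma chartPhase_eq_one {h : ℤ} (hh : chartPhase β h = 1) : h = 0 := by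
  cases β
  · simpa using goldenPhase_eq_one (k := -h) (by simpa [chartPhase] using hh)
  · exact goldenPhase_eq_one (by simpa [chartPhase] using hh)

lemma goldenWeight_eq (β : Bool) (h : ℤ) :
    goldenWeight h β = chartPhase β h * goldenWeight h (!β) := by
  cases β <;> simp [goldenWeight, chartPhase, goldenPhase_neg]

lemma goldenWeight_neg (h : ℤ) (γ : Bool) : goldenWeight (-h) γ = (goldenWeight h γ)⁻¹ := by
  cases γ <;> simp [goldenWeight, goldenPhase_neg]

/-- A point of the sphere lies on the orbit of the point with chart coordinate `z` if and only if
its chart coordinate differs from `z` by a phase of the discrete group. -/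
lemma exists_eq_mul_discSection_iff (hz : ‖z‖ < b) {u : Bool → ℂ} (h : ℤ)
    (hu : ‖u true‖ ^ 2 + ‖u false‖ ^ 2 = b ^ 2) :
    (∃ s : Circle, ∀ γ, u γ = s * goldenWeight h γ * discSection b β z γ) ↔
      u (!β) ≠ 0 ∧ discCoord β u = chartPhase β h * z := by
  have hr : 0 < √(b ^ 2 - ‖z‖ ^ 2) := Real.sqrt_pos.2 (sq_sub_sq_pos hz)
  have hu' : ‖u β‖ ^ 2 + ‖u (!β)‖ ^ 2 = b ^ 2 := by
    cases β
    · rw [add_comm]; exact hu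
    · exact hu
  have hw : (goldenWeight h β : ℂ) = chartPhase β h * goldenWeight h (!β) := by
    rw [goldenWeight_eq β h, Circle.coe_mul]
  constructor
  · rintro ⟨s, hs⟩
    have h1 := hs β
    have h2 := hs (!β)
    rw [discSection_self, hw] at h1
    rw [discSection_not] at h2
    have h3 : ‖u (!β)‖ = √(b ^ 2 - ‖z‖ ^ 2) := by
      rw [h2, norm_mul, norm_mul, Circle.norm_coe, Circle.norm_coe, one_mul, one_mul,
        Complex.norm_real, Real.norm_of_nonneg hr.le]
    have hr' : ((√(b ^ 2 - ‖z‖ ^ 2) : ℝ) : ℂ) ≠ 0 := by exact_mod_cast hr.ne'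
    refine ⟨by rw [← norm_ne_zero_iff, h3]; exact hr.ne', ?_⟩
    rw [discCoord, h3, h1, h2, div_eq_iff hr', map_mul, map_mul, Complex.conj_ofReal]
    linear_combination (s * (starRingEnd ℂ) (s : ℂ) * chartPhase β h * z *
      (√(b ^ 2 - ‖z‖ ^ 2) : ℝ)) * (goldenWeight h (!β)).mul_conj_self +
      (chartPhase β h * z * (√(b ^ 2 - ‖z‖ ^ 2) : ℝ)) * s.mul_conj_self
  · rintro ⟨h0, hc⟩
    obtain ⟨t, ht⟩ := exists_circle_mul_norm (u (!β))
    have hn : ((‖u (!β)‖ : ℝ) : ℂ) ≠ 0 := by exact_mod_cast norm_ne_zero_iff.2 h0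
    have huβ : u β = t * (chartPhase β h * z) := by
      have ht' := congrArg (starRingEnd ℂ) ht
      rw [map_mul, Complex.conj_ofReal] at ht'
      rw [← hc, discCoord, ht']
      field_simp
      linear_combination (-u β) * t.mul_conj_self
    have hz2 : ‖u β‖ = ‖z‖ := by
      rw [huβ, norm_mul, norm_mul, Circle.norm_coe, Circle.norm_coe, one_mul, one_mul]
    have hn2 : ‖u (!β)‖ = √(b ^ 2 - ‖z‖ ^ 2) := by
      rw [← hz2, ← hu', add_sub_cancel_left, Real.sqrt_sq (norm_nonneg _)]
    refine ⟨t * (goldenWeight h (!β))⁻¹, fun γ => ?_⟩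
    rw [← Circle.coe_mul]
    by_cases hγ : γ = β
    · subst hγ
      rw [discSection_self, huβ, goldenWeight_eq γ h, mul_comm (chartPhase γ h), ← mul_assoc,
        ← mul_assoc, inv_mul_cancel_right, Circle.coe_mul]
    · obtain rfl : γ = !β := Bool.eq_not_iff.2 hγ
      rw [discSection_not, inv_mul_cancel_right, ← hn2, ← ht]

lemma discCoord_discSection (hz : ‖z‖ < b) : discCoord β (discSection b β z) = z := by
  have hr : 0 < √(b ^ 2 - ‖z‖ ^ 2) := Real.sqrt_pos.2 (sq_sub_sq_pos hz)
  have hr' : ((√(b ^ 2 - ‖z‖ ^ 2) : ℝ) : ℂ) ≠ 0 := by exact_mod_cast hr.ne'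
  rw [discCoord, discSection_self, discSection_not, Complex.conj_ofReal, Complex.norm_real,
    Real.norm_of_nonneg hr.le, mul_div_cancel_right₀ _ hr']

lemma discCoord_not_discSection (h0 : z ≠ 0) :
    discCoord (!β) (discSection b β z) = polarFlip b 1 z := by
  have hn : 0 < ‖z‖ := norm_pos_iff.2 h0
  have h1 : √(b ^ 2 - ‖z‖ ^ 2) = √(b ^ 2 / ‖z‖ ^ 2 - 1) * ‖z‖ := by
    nth_rewrite 3 [← Real.sqrt_sq hn.le]
    rw [← Real.sqrt_mul' _ (by positivity)]
    congr 1
    field_simp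
  have hn' : ((‖z‖ : ℝ) : ℂ) ≠ 0 := by exact_mod_cast hn.ne'
  rw [discCoord, Bool.not_not, discSection_self, discSection_not, h1, polarFlip]
  push_cast
  field_simp

/-- Two polar charts of the sphere, composed with an element of the discrete group, are related by
a symplectic diffeomorphism of parts of the disc. -/
lemma exists_isDiscSymplecto (hz : ‖z‖ < b) (hw : ‖w‖ < b) (s : Circle) (h : ℤ)
    (hs : ∀ γ, discSection b β' w γ = s * goldenWeight h γ * discSection b β z γ) :
    ∃ e, IsDiscSymplecto b e ∧ z ∈ e.source ∧ e z = w ∧ ∀ x ∈ e.source, ∃ s' : Circle,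
      ∀ γ, discSection b β' (e x) γ = s' * goldenWeight h γ * discSection b β x γ := by
  -- the relation between `z` and `w`, solved for `w`
  have key : ∀ {x y : ℂ}, ‖x‖ < b → ‖y‖ < b →
      ((∃ s : Circle, ∀ γ, discSection b β' y γ = s * goldenWeight h γ * discSection b β x γ) ↔
        discSection b β x (!β') ≠ 0 ∧ y = chartPhase β' h * discCoord β' (discSection b β x)) := by
    intro x y hx hy
    have h1 : (∃ s : Circle, ∀ γ, discSection b β' y γ =
        s * goldenWeight h γ * discSection b β x γ) ↔
        ∃ s : Circle, ∀ γ, discSection b β x γ = s * goldenWeight (-h) γ * discSection b β' y γ := by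
      constructor
      · rintro ⟨s, hs⟩
        refine ⟨s⁻¹, fun γ => ?_⟩
        rw [hs, goldenWeight_neg, Circle.coe_inv, Circle.coe_inv]
        field_simp [Circle.coe_ne_zero]
      · rintro ⟨s, hs⟩
        refine ⟨s⁻¹, fun γ => ?_⟩
        rw [hs, goldenWeight_neg, Circle.coe_inv, Circle.coe_inv]
        field_simp [Circle.coe_ne_zero]
    rw [h1, exists_eq_mul_discSection_iff hy (-h) (discSection_norm_sq hx)]
    refine and_congr_right fun _ => ?_
    have h2 : chartPhase β' h * chartPhase β' (-h) = 1 := by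
      rw [← chartPhase_add, add_neg_cancel, chartPhase_zero]
    have h3 : (chartPhase β' h : ℂ) * chartPhase β' (-h) = 1 := by
      rw [← Circle.coe_mul, h2, Circle.coe_one]
    constructor
    · intro h4; rw [h4, ← mul_assoc, h3, one_mul]
    · intro h4; rw [h4, ← mul_assoc, mul_comm (chartPhase β' (-h) : ℂ), h3, one_mul]
  obtain ⟨hz0, hzw⟩ := (key hz hw).1 ⟨s, hs⟩
  by_cases hβ : β' = β
  · subst hβ
    refine ⟨discRotation b (chartPhase β' h), isDiscSymplecto_rotation _ _, hz, ?_, fun x hx => ?_⟩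
    · rw [hzw, discCoord_discSection hz]; rfl
    · have hx' := (isDiscSymplecto_rotation b (chartPhase β' h)).target_subset _
        ((discRotation b (chartPhase β' h)).map_source hx)
      refine (key hx hx').2 ⟨?_, ?_⟩
      · rw [discSection_not]
        exact_mod_cast (Real.sqrt_pos.2 (sq_sub_sq_pos hx)).ne'
      · rw [discCoord_discSection hx]; rfl
  · obtain rfl : β' = !β := Bool.eq_not_iff.2 hβ
    have hflip : ∀ {x : ℂ}, x ≠ 0 → polarFlip b (chartPhase (!β) h) x =
        chartPhase (!β) h * discCoord (!β) (discSection b β x) := by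
      intro x hx
      rw [discCoord_not_discSection hx, polarFlip, polarFlip, Circle.coe_one]
      ring
    rw [Bool.not_not, discSection_self] at hz0
    refine ⟨discFlip b (chartPhase (!β) h), isDiscSymplecto_flip _ _, ⟨hz0, hz⟩, ?_, fun x hx => ?_⟩
    · rw [hzw, ← hflip hz0]; rfl
    · have hx' := (isDiscSymplecto_flip b (chartPhase (!β) h)).target_subset _
        ((discFlip b (chartPhase (!β) h)).map_source hx)
      refine (key hx.2 hx').2 ⟨?_, hflip hx.1⟩
      rw [Bool.not_not, discSection_self]
      exact hx.1

end Disc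

/-! ### The product of three 3-spheres and its polar charts -/

/-- The product of three 3-spheres of radius `b`; the `i`-th one lies in the copy of `ℂ²` with
coordinates `(i, true)` and `(i, false)`. -/
def sphereLevel (b : ℝ) : Set (Fin 3 × Bool → ℂ) :=
  {y | ∀ i, ‖y (i, true)‖ ^ 2 + ‖y (i, false)‖ ^ 2 = b ^ 2}

/-- `y` and `y'` lie on one orbit of the group generated by the three diagonal circles and the
discrete group of rotations `(e^{2πiφh}, 1)` of each copy of `ℂ²`. -/
def GoldenOrbit (y y' : Fin 3 × Bool → ℂ) : Prop :=
  ∃ (s : Fin 3 → Circle) (h : Fin 3 → ℤ), ∀ i γ, y' (i, γ) = s i * goldenWeight (h i) γ * y (i, γ)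

/-- The open polydisc of radius `b`. -/
def polyDisc (b : ℝ) : Set (Fin 3 → ℂ) := {z | ∀ i, ‖z i‖ < b}

/-- The product of three polar sections, with the poles chosen by `ε`. -/
noncomputable def polarSection (b : ℝ) (ε : Fin 3 → Bool) (z : Fin 3 → ℂ) : Fin 3 × Bool → ℂ :=
  fun p => discSection b (ε p.1) (z p.1) p.2

lemma isOpen_polyDisc (b : ℝ) : IsOpen (polyDisc b) := by
  have : polyDisc b = ⋂ i, {z | ‖z i‖ < b} := by ext; simp [polyDisc]
  rw [this]
  exact isOpen_iInter_of_finite fun i => isOpen_lt (by fun_prop) continuous_const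

lemma convex_polyDisc (b : ℝ) : Convex ℝ (polyDisc b) := by
  have : polyDisc b = univ.pi fun _ => Metric.ball (0 : ℂ) b := by ext; simp [polyDisc]
  rw [this]
  exact convex_pi fun i _ => convex_ball _ _

section PolyDisc

variable {b : ℝ} {ε : Fin 3 → Bool} {z : Fin 3 → ℂ}

lemma isConnected_polyDisc (hb : 0 < b) : IsConnected (polyDisc b) :=
  ⟨⟨0, fun i => by simpa using hb⟩, (convex_polyDisc b).isPreconnected⟩

lemma polarSection_mem (hz : z ∈ polyDisc b) : polarSection b ε z ∈ sphereLevel b :=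
  fun i => discSection_norm_sq (hz i)

lemma contDiffOn_polarSection (b : ℝ) (ε : Fin 3 → Bool) :
    ContDiffOn ℝ ∞ (polarSection b ε) (polyDisc b) := by
  rw [contDiffOn_pi]
  rintro ⟨i, γ⟩
  by_cases h : γ = ε i
  · simp only [polarSection, discSection, h, if_true]
    fun_prop
  · simp only [polarSection, discSection, h, if_false]
    refine Complex.ofRealCLM.contDiff.comp_contDiffOn (ContDiffOn.sqrt ?_ fun z hz => ?_)
    · exact contDiffOn_const.sub
        ((contDiff_norm_sq ℝ).comp (contDiff_apply ℝ ℂ i)).contDiffOn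
    · exact (sq_sub_sq_pos (hz i)).ne'

/-- The points of the polydisc with trivial stabilizer are those without vanishing coordinates. -/
lemma free_iff (ε : Fin 3 → Bool) (z : Fin 3 → ℂ) :
    (∀ g : Multiplicative (Fin 3 → ℤ),
      (fun i => (chartPhase (ε i) (g.toAdd i) : ℂ) * z i) = z → g = 1) ↔ ∀ i, z i ≠ 0 := by
  constructor
  · intro H i hi
    have := H (.ofAdd (Pi.single i 1)) <| by
      funext j
      by_cases hj : j = i
      · subst hj; simp [hi]
      · simp [hj, chartPhase_zero]
    have := congrFun (congrArg Multiplicative.toAdd this) i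
    simp at this
  · intro H g hg
    apply Multiplicative.toAdd.injective
    funext i
    refine chartPhase_eq_one (β := ε i) ?_
    have := congrFun hg i
    exact Circle.ext (mul_right_cancel₀ (H i) (by simpa using this))

lemma isConnected_polyDisc_ne_zero (hb : 0 < b) :
    IsConnected (polyDisc b ∩ {z | ∀ i, z i ≠ 0}) := by
  -- polar coordinates parametrize this set by a convex set
  have h1 : IsConnected ((univ.pi fun _ : Fin 3 => Ioo 0 b) ×ˢ (univ : Set (Fin 3 → ℝ))) :=
    ⟨⟨(fun _ => b / 2, 0), by simp [hb]⟩,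
      ((convex_pi fun i _ => convex_Ioo _ _).prod convex_univ).isPreconnected⟩
  have h2 := h1.image (fun q i => (q.1 i : ℂ) * Circle.exp (q.2 i)) (by fun_prop)
  convert h2 using 1
  ext z
  constructor
  · rintro ⟨hz, h0⟩
    refine ⟨(fun i => ‖z i‖, fun i => (z i).arg), ⟨fun i _ => ⟨norm_pos_iff.2 (h0 i), hz i⟩, trivial⟩, ?_⟩
    funext i
    simp [Circle.coe_exp]
  · rintro ⟨q, ⟨hq, -⟩, rfl⟩
    refine ⟨fun i => ?_, fun i => ?_⟩
    · have := hq i trivial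
      simpa [abs_of_pos this.1, Circle.norm_coe] using this.2
    · have := hq i trivial
      simpa [Circle.coe_ne_zero] using this.1.ne'

lemma polyDisc_subset_closure (b : ℝ) :
    polyDisc b ⊆ closure (polyDisc b ∩ {z | ∀ i, z i ≠ 0}) := by
  refine Dense.open_subset_closure_inter ?_ (isOpen_polyDisc b)
  have := dense_pi (univ : Set (Fin 3)) (s := fun _ => ({0}ᶜ : Set ℂ))
    fun i _ => dense_compl_singleton 0
  convert this using 1
  ext; simp

/-- The chart coordinates of a point of the product of spheres. -/
noncomputable def chartCoord (ε : Fin 3 → Bool) (y : Fin 3 × Bool → ℂ) : Fin 3 → ℂ :=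
  fun i => discCoord (ε i) fun γ => y (i, γ)

lemma goldenOrbit_polarSection_iff (hz : z ∈ polyDisc b) {y : Fin 3 × Bool → ℂ}
    (hy : y ∈ sphereLevel b) :
    GoldenOrbit (polarSection b ε z) y ↔ (∀ i, y (i, !ε i) ≠ 0) ∧
      ∃ h : Fin 3 → ℤ, ∀ i, chartCoord ε y i = chartPhase (ε i) (h i) * z i := by
  constructor
  · rintro ⟨s, h, hs⟩
    have key := fun i => (exists_eq_mul_discSection_iff (β := ε i) (hz i) (h i)
      (u := fun γ => y (i, γ)) (hy i)).1 ⟨s i, hs i⟩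
    exact ⟨fun i => (key i).1, h, fun i => (key i).2⟩
  · rintro ⟨h0, h, hh⟩
    have key := fun i => (exists_eq_mul_discSection_iff (β := ε i) (hz i) (h i)
      (u := fun γ => y (i, γ)) (hy i)).2 ⟨h0 i, hh i⟩
    choose s hs using key
    exact ⟨s, h, hs⟩

lemma polarSection_not_ne_zero (hz : z ∈ polyDisc b) (i : Fin 3) :
    polarSection b ε z (i, !ε i) ≠ 0 := by
  simp only [polarSection, discSection_not]
  exact_mod_cast (Real.sqrt_pos.2 (sq_sub_sq_pos (hz i))).ne'

lemma chartCoord_polarSection (hz : z ∈ polyDisc b) : chartCoord ε (polarSection b ε z) = z :=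
  funext fun i => discCoord_discSection (hz i)

lemma continuousOn_chartCoord (ε : Fin 3 → Bool) :
    ContinuousOn (chartCoord ε) {y | ∀ i, y (i, !ε i) ≠ 0} := by
  refine continuousOn_pi.2 fun i => ?_
  simp only [chartCoord, discCoord]
  refine ContinuousOn.div (by fun_prop) (by fun_prop) fun y hy => ?_
  exact_mod_cast norm_ne_zero_iff.2 (hy i)

lemma norm_chartCoord {y : Fin 3 × Bool → ℂ} {i : Fin 3} (hy : y (i, !ε i) ≠ 0) :
    ‖chartCoord ε y i‖ = ‖y (i, ε i)‖ := by
  have : ‖y (i, !ε i)‖ ≠ 0 := norm_ne_zero_iff.2 hy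
  simp only [chartCoord, discCoord, norm_div, norm_mul, RCLike.norm_conj, Complex.norm_real,
    norm_norm]
  field_simp

end PolyDisc

/-- The symplectic form `(1/2πi) ∑ dz_j ∧ dz̄_j` of `ℂ³` as a constant 2-form. -/
noncomputable def polyForm : (Fin 3 → ℂ) [⋀^Fin 2]→L[ℝ] ℝ where
  toFun m := ∑ i, planeForm (m 0 i) (m 1 i)
  map_update_add' m k x y := by
    rw [← Finset.sum_add_distrib]
    refine Finset.sum_congr rfl fun i _ => ?_
    fin_cases k <;> simp [planeForm] <;> ring
  map_update_smul' m k c x := by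
    rw [smul_eq_mul, Finset.mul_sum]
    refine Finset.sum_congr rfl fun i _ => ?_
    fin_cases k <;> simp [planeForm] <;> ring
  map_eq_zero_of_eq' m j k h hjk := by
    have h01 : m 0 = m 1 := by
      fin_cases j <;> fin_cases k <;> simp_all
    refine Finset.sum_eq_zero fun i _ => ?_
    rw [h01, planeForm, Complex.mul_conj, Complex.ofReal_im, mul_zero]
  cont := by
    unfold planeForm
    fun_prop

lemma polyForm_apply (u v : Fin 3 → ℂ) : polyForm ![u, v] = ∑ i, planeForm (u i) (v i) := rfl

lemma polyForm_nondegenerate {u : Fin 3 → ℂ} (hu : u ≠ 0) : ∃ v, polyForm ![u, v] ≠ 0 := by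
  obtain ⟨i, hi⟩ := Function.ne_iff.1 hu
  refine ⟨Pi.single i (-Complex.I * u i), ?_⟩
  rw [polyForm_apply, Finset.sum_eq_single i]
  · have h1 : 0 < Complex.normSq (u i) := Complex.normSq_pos.2 hi
    rw [Pi.single_eq_same, planeForm]
    have : u i * (starRingEnd ℂ) (-Complex.I * u i) = Complex.I * Complex.normSq (u i) := by
      rw [map_mul, ← Complex.mul_conj]; simp; ring
    rw [this]
    simpa using hi
  · intro j _ hj
    simp [hj, planeForm]
  · simp

/-! ### The quasifold of a sphere model -/

lemma isCompact_sphereLevel (b : ℝ) (hb : 0 ≤ b) : IsCompact (sphereLevel b) := by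
  refine Metric.isCompact_of_isClosed_isBounded ?_ ?_
  · have : sphereLevel b = ⋂ i, {y | ‖y (i, true)‖ ^ 2 + ‖y (i, false)‖ ^ 2 = b ^ 2} := by
      ext; simp [sphereLevel]
    rw [this]
    exact isClosed_iInter fun i => isClosed_eq (by fun_prop) continuous_const
  · refine (Metric.isBounded_closedBall (x := 0) (r := b)).subset fun y hy => ?_
    rw [mem_closedBall_zero_iff, pi_norm_le_iff_of_nonneg hb]
    rintro ⟨i, γ⟩
    refine (pow_le_pow_iff_left₀ (norm_nonneg _) hb two_ne_zero).1 ?_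
    have := hy i
    cases γ <;> nlinarith [sq_nonneg ‖y (i, true)‖, sq_nonneg ‖y (i, false)‖]

/-- A presentation of the space `M` as the quotient of a product of three 3-spheres of radius `b`
by the three diagonal circles and the discrete golden group. -/
structure SphereModel (b : ℝ) (M : Type*) [TopologicalSpace M] where
  pos : 0 < b
  toFun : sphereLevel b → M
  isQuotientMap : IsQuotientMap toFun
  eq_iff : ∀ y y', toFun y = toFun y' ↔ GoldenOrbit y y'

namespace SphereModel

variable {b : ℝ} {M : Type*} [TopologicalSpace M] (ρ : SphereModel b M)
variable {ε : Fin 3 → Bool} {y y' : Fin 3 × Bool → ℂ} {z w : Fin 3 → ℂ}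

/-- The quotient map, extended to the ambient space by a junk value. -/
noncomputable def ext : (Fin 3 × Bool → ℂ) → M :=
  Function.extend Subtype.val ρ.toFun
    fun _ => ρ.toFun ⟨fun p => if p.2 then b else 0, fun i => by simp⟩

lemma ext_apply (hy : y ∈ sphereLevel b) : ρ.ext y = ρ.toFun ⟨y, hy⟩ :=
  Subtype.val_injective.extend_apply ρ.toFun _ ⟨y, hy⟩

lemma ext_eq_iff (hy : y ∈ sphereLevel b) (hy' : y' ∈ sphereLevel b) :
    ρ.ext y = ρ.ext y' ↔ GoldenOrbit y y' := by
  rw [ρ.ext_apply hy, ρ.ext_apply hy', ρ.eq_iff]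

lemma exists_ext_eq (m : M) : ∃ y ∈ sphereLevel b, ρ.ext y = m := by
  obtain ⟨y, hy⟩ := ρ.isQuotientMap.surjective m
  exact ⟨y, y.2, by rw [ρ.ext_apply y.2]; exact hy⟩

lemma continuousOn_ext : ContinuousOn ρ.ext (sphereLevel b) := by
  rw [continuousOn_iff_continuous_domRestrict]
  convert ρ.isQuotientMap.continuous using 1
  ext y
  exact ρ.ext_apply y.2

lemma ext_polarSection_eq_iff (hz : z ∈ polyDisc b) (hy : y ∈ sphereLevel b) :
    ρ.ext (polarSection b ε z) = ρ.ext y ↔ (∀ i, y (i, !ε i) ≠ 0) ∧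
      ∃ h : Fin 3 → ℤ, ∀ i, chartCoord ε y i = chartPhase (ε i) (h i) * z i := by
  rw [ρ.ext_eq_iff (polarSection_mem hz) hy, goldenOrbit_polarSection_iff hz hy]

lemma isOpen_image {V : Set (Fin 3 → ℂ)} (hV : V ⊆ polyDisc b) (hVo : IsOpen V) :
    IsOpen ((fun z => ρ.ext (polarSection b ε z)) '' V) := by
  rw [← ρ.isQuotientMap.isOpen_preimage]
  have hU : IsOpen {y : Fin 3 × Bool → ℂ | ∀ i, y (i, !ε i) ≠ 0} := by
    have : {y : Fin 3 × Bool → ℂ | ∀ i, y (i, !ε i) ≠ 0} = ⋂ i, {y | y (i, !ε i) ≠ 0} := by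
      ext; simp
    rw [this]
    exact isOpen_iInter_of_finite fun i => isOpen_ne_fun (by fun_prop) continuous_const
  -- the preimage is the union of the rotated copies of `V`, read in the chart coordinates
  have key : ρ.toFun ⁻¹' ((fun z => ρ.ext (polarSection b ε z)) '' V) =
      Subtype.val ⁻¹' ⋃ h : Fin 3 → ℤ, ({y | ∀ i, y (i, !ε i) ≠ 0} ∩
        chartCoord ε ⁻¹' ((fun z i => ((chartPhase (ε i) (h i))⁻¹ : Circle) * z i) ⁻¹' V)) := by
    ext ⟨y, hy⟩
    simp only [mem_preimage, mem_image, mem_iUnion, mem_inter_iff, mem_ofPred_eq]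
    rw [← ρ.ext_apply hy]
    constructor
    · rintro ⟨z, hz, hzy⟩
      obtain ⟨h0, h, hh⟩ := (ρ.ext_polarSection_eq_iff (hV hz) hy).1 hzy
      refine ⟨h, h0, ?_⟩
      have : (fun i => (((chartPhase (ε i) (h i))⁻¹ : Circle) : ℂ) * chartCoord ε y i) = z := by
        funext i
        rw [hh, ← mul_assoc, ← Circle.coe_mul, inv_mul_cancel, Circle.coe_one, one_mul]
      rwa [this]
    · rintro ⟨h, h0, hh⟩
      refine ⟨_, hh, (ρ.ext_polarSection_eq_iff (hV hh) hy).2 ⟨h0, h, fun i => ?_⟩⟩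
      rw [← mul_assoc, ← Circle.coe_mul, mul_inv_cancel, Circle.coe_one, one_mul]
  rw [key]
  refine (isOpen_iUnion fun h => ?_).preimage continuous_subtype_val
  exact (continuousOn_chartCoord ε).isOpen_inter_preimage hU (hVo.preimage (by fun_prop))

/-- The chart of `M` given by the polar section with poles `ε`. -/
noncomputable def chart (ε : Fin 3 → Bool) : QuasifoldChart (Fin 3 → ℂ) M where
  dom := polyDisc b
  isOpen_dom := isOpen_polyDisc b
  isConnected_dom := isConnected_polyDisc ρ.pos
  Γ := Multiplicative (Fin 3 → ℤ)
  countable := inferInstanceAs (Countable (Fin 3 → ℤ))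
  act g z i := chartPhase (ε i) (g.toAdd i) * z i
  act_mapsTo g z hz i := by
    simpa only [norm_mul, Circle.norm_coe, one_mul] using hz i
  act_one z _ := by
    funext i
    simp [chartPhase_zero]
  act_mul g h z _ := by
    funext i
    simp [chartPhase_add, mul_assoc]
  act_smooth g := by
    refine contDiffOn_pi.2 fun i => ?_
    fun_prop
  isConnected_free := by
    simp only [free_iff]
    exact isConnected_polyDisc_ne_zero ρ.pos
  dense_free := by
    simp only [free_iff]
    exact polyDisc_subset_closure b
  proj z := ρ.ext (polarSection b ε z)
  continuousOn_proj := ρ.continuousOn_ext.comp (contDiffOn_polarSection b ε).continuousOn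
    fun z hz => polarSection_mem hz
  isOpen_image V hV hVo := ρ.isOpen_image hV hVo
  proj_eq_iff x hx y hy := by
    rw [ρ.ext_polarSection_eq_iff hx (polarSection_mem hy), chartCoord_polarSection hy]
    constructor
    · rintro ⟨-, h, hh⟩
      exact ⟨.ofAdd h, funext fun i => (hh i).symm⟩
    · rintro ⟨g, rfl⟩
      exact ⟨fun i => polarSection_not_ne_zero hy i, g.toAdd, fun i => rfl⟩

lemma chart_proj (z : Fin 3 → ℂ) : (ρ.chart ε).proj z = ρ.ext (polarSection b ε z) := rfl

/-- Every point of a sphere product lies over the domain of one of the polar charts. -/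
lemma exists_chart_proj_eq (hy : y ∈ sphereLevel b) :
    ∃ ε, ∃ z ∈ polyDisc b, (ρ.chart ε).proj z = ρ.ext y := by
  have hpos := ρ.pos
  refine ⟨fun i => if y (i, false) = 0 then false else true, ?_⟩
  set ε : Fin 3 → Bool := fun i => if y (i, false) = 0 then false else true with hε
  have h0 : ∀ i, y (i, !ε i) ≠ 0 := by
    intro i
    by_cases h : y (i, false) = 0
    · have hi := hy i
      have h1 : y (i, true) ≠ 0 := by
        intro h'
        rw [h, h', norm_zero] at hi
        nlinarith
      simpa [hε, h] using h1
    · simp [hε, h]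
  have hz : chartCoord ε y ∈ polyDisc b := by
    intro i
    have h1 : 0 < ‖y (i, !ε i)‖ := norm_pos_iff.2 (h0 i)
    rw [norm_chartCoord (h0 i)]
    refine lt_of_pow_lt_pow_left₀ 2 hpos.le ?_
    have hi := hy i
    cases h : ε i <;> rw [h] at h1 <;> simp only [Bool.not_true, Bool.not_false] at h1 <;> nlinarith
  exact ⟨_, hz, (ρ.ext_polarSection_eq_iff hz hy).2
    ⟨h0, 0, fun i => by simp [chartPhase_zero]⟩⟩

end SphereModel

/-- Symplectic diffeomorphisms of parts of discs act on the coordinates of `ℂ³` by symplectic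
diffeomorphisms. -/
lemma polyForm_fderiv_pi {b : ℝ} {e : Fin 3 → OpenPartialHomeomorph ℂ ℂ}
    (he : ∀ i, IsDiscSymplecto b (e i)) {z : Fin 3 → ℂ} (hz : ∀ i, z i ∈ (e i).source)
    (u v : Fin 3 → ℂ) :
    polyForm ![u, v] = polyForm ![fderiv ℝ (OpenPartialHomeomorph.pi e) z u,
      fderiv ℝ (OpenPartialHomeomorph.pi e) z v] := by
  have hd : ∀ i, HasFDerivAt (fun w : Fin 3 → ℂ => e i (w i))
      ((fderiv ℝ (e i) (z i)).comp (ContinuousLinearMap.proj i)) z := by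
    intro i
    have h1 : DifferentiableAt ℝ (e i) (z i) :=
      ((he i).smooth.differentiableOn (by simp)).differentiableAt
        ((e i).open_source.mem_nhds (hz i))
    exact h1.hasFDerivAt.comp z (hasFDerivAt_apply i z)
  have h : fderiv ℝ (OpenPartialHomeomorph.pi e) z = ContinuousLinearMap.pi fun i =>
      (fderiv ℝ (e i) (z i)).comp (ContinuousLinearMap.proj i) :=
    (hasFDerivAt_pi.2 hd).fderiv
  rw [h, polyForm_apply, polyForm_apply]
  exact Finset.sum_congr rfl fun i _ => (he i).pullback _ (hz i) _ _

/-- Points of two polar charts that lie over corresponding points of two sphere models are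
related by a local lift of any map that corresponds to the identity of the product of spheres. -/
lemma SphereModel.exists_lift {b : ℝ} {M M' : Type*} [TopologicalSpace M] [TopologicalSpace M']
    (ρ : SphereModel b M) (ρ' : SphereModel b M') {f : M → M'}
    (hf : ∀ y ∈ sphereLevel b, f (ρ.ext y) = ρ'.ext y) {ε ε' : Fin 3 → Bool}
    {x y : Fin 3 → ℂ} (hx : x ∈ polyDisc b) (hy : y ∈ polyDisc b)
    (hxy : f ((ρ.chart ε).proj x) = (ρ'.chart ε').proj y) :
    ∃ e, IsSymplecticLift f (ρ.chart ε) (fun _ => polyForm) (ρ'.chart ε') (fun _ => polyForm)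
      x y e := by
  rw [ρ.chart_proj, ρ'.chart_proj, hf _ (polarSection_mem hx),
    ρ'.ext_eq_iff (polarSection_mem hx) (polarSection_mem hy)] at hxy
  obtain ⟨s, h, hs⟩ := hxy
  have key := fun i => exists_isDiscSymplecto (β := ε i) (β' := ε' i) (hx i) (hy i) (s i) (h i) (hs i)
  choose e he hxe hey hes using key
  have hsrc : ∀ z ∈ (OpenPartialHomeomorph.pi e).source, ∀ i, z i ∈ (e i).source :=
    fun z hz i => hz i trivial
  have htgt : ∀ z ∈ (OpenPartialHomeomorph.pi e).target, ∀ i, z i ∈ (e i).target :=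
    fun z hz i => hz i trivial
  refine ⟨OpenPartialHomeomorph.pi e, ⟨fun i _ => hxe i, funext hey,
    fun z hz i => (he i).source_subset _ (hsrc z hz i),
    fun z hz i => (he i).target_subset _ (htgt z hz i),
    contDiffOn_pi.2 fun i => ?_, contDiffOn_pi.2 fun i => ?_, fun z hz => ?_,
    fun z hz u v => polyForm_fderiv_pi he (hsrc z hz) u v⟩⟩
  · exact (he i).smooth.comp (contDiff_apply ℝ ℂ i).contDiffOn fun z hz => hsrc z hz i
  · exact (he i).smooth_symm.comp (contDiff_apply ℝ ℂ i).contDiffOn fun z hz => htgt z hz i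
  · have hz1 : z ∈ polyDisc b := fun i => (he i).source_subset _ (hsrc z hz i)
    have hz2 : OpenPartialHomeomorph.pi e z ∈ polyDisc b :=
      fun i => (he i).target_subset _ ((e i).map_source (hsrc z hz i))
    rw [ρ.chart_proj, ρ'.chart_proj, hf _ (polarSection_mem hz1), eq_comm,
      ρ'.ext_eq_iff (polarSection_mem hz1) (polarSection_mem hz2)]
    choose s' hs' using fun i => hes i (z i) (hsrc z hz i)
    exact ⟨s', h, hs'⟩

namespace SphereModel

variable {b : ℝ} {M : Type*} [TopologicalSpace M] (ρ : SphereModel b M)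

/-- The symplectic quasifold given by a sphere model: eight polar charts, each with the constant
form `(1/2πi) ∑ dz_j ∧ dz̄_j`. -/
noncomputable def quasifold : SymplecticQuasifold (Fin 3 → ℂ) M where
  ι := Fin 3 → Bool
  chart := ρ.chart
  form _ _ := polyForm
  cover m := by
    obtain ⟨y, hy, rfl⟩ := ρ.exists_ext_eq m
    exact ρ.exists_chart_proj_eq hy
  form_smooth _ := contDiffOn_const
  form_closed _ x _ := by
    rw [extDeriv, fderiv_fun_const]
    exact map_zero (ContinuousAlternatingMap.alternatizeUncurryFinCLM ℝ (Fin 3 → ℂ) ℝ)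
  form_nondegenerate _ _ _ _ hu := polyForm_nondegenerate hu
  form_invariant ε g x _ u v := by
    have h : ∀ w, fderiv ℝ ((ρ.chart ε).act g) x w = (ρ.chart ε).act g w := by
      intro w
      have h1 : HasFDerivAt (𝕜 := ℝ) ((ρ.chart ε).act g) (ContinuousLinearMap.pi fun i =>
          (chartPhase (ε i) (Multiplicative.toAdd g i) : ℂ) • ContinuousLinearMap.proj (R := ℝ) i) x :=
        hasFDerivAt_pi.2 fun i => (hasFDerivAt_apply i x).const_mul _
      rw [h1.fderiv]
      rfl
    rw [h, h, polyForm_apply, polyForm_apply]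
    exact Finset.sum_congr rfl fun i _ => (planeForm_mul_circle _ _ _).symm
  compatible ε ε' x hx y hy hxy :=
    ρ.exists_lift ρ (fun _ _ => rfl) hx hy hxy

theorem symplectomorphic {M' : Type*} [TopologicalSpace M'] (ρ' : SphereModel b M') :
    Symplectomorphic ρ.quasifold ρ'.quasifold := by
  let F : C(sphereLevel b, M) := ⟨ρ.toFun, ρ.isQuotientMap.continuous⟩
  let F' : C(sphereLevel b, M') := ⟨ρ'.toFun, ρ'.isQuotientMap.continuous⟩
  have hF : IsQuotientMap F := ρ.isQuotientMap
  have hF' : IsQuotientMap F' := ρ'.isQuotientMap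
  have h1 : Function.FactorsThrough F' F :=
    fun y y' h => (ρ'.eq_iff y y').2 ((ρ.eq_iff y y').1 h)
  have h2 : Function.FactorsThrough F F' :=
    fun y y' h => (ρ.eq_iff y y').2 ((ρ'.eq_iff y y').1 h)
  let f : C(M, M') := hF.lift F' h1
  let g : C(M', M) := hF'.lift F h2
  have hf : ∀ y, f (ρ.toFun y) = ρ'.toFun y := DFunLike.congr_fun (hF.lift_comp F' h1)
  have hg : ∀ y, g (ρ'.toFun y) = ρ.toFun y := DFunLike.congr_fun (hF'.lift_comp F h2)
  refine ⟨⟨⟨f, g, fun m => ?_, fun m => ?_⟩, f.continuous, g.continuous⟩, fun ε ε' x hx y hy hxy => ?_⟩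
  · obtain ⟨y, rfl⟩ := ρ.isQuotientMap.surjective m
    rw [hf, hg]
  · obtain ⟨y, rfl⟩ := ρ'.isQuotientMap.surjective m
    rw [hg, hf]
  · refine ρ.exists_lift ρ' (fun y hy => ?_) hx hy hxy
    rw [ρ.ext_apply hy, ρ'.ext_apply hy]
    exact hf ⟨y, hy⟩

theorem compactSpace {b : ℝ} {M : Type*} [TopologicalSpace M] (ρ : SphereModel b M) :
    CompactSpace M := by
  have : CompactSpace (sphereLevel b) :=
    isCompact_iff_compactSpace.1 (isCompact_sphereLevel b ρ.pos.le)
  refine ⟨?_⟩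
  rw [← ρ.isQuotientMap.surjective.range_eq]
  exact isCompact_range ρ.isQuotientMap.continuous

/-- The images of the eight charts are connected and share the point all of whose coordinates
are `b / √2`. -/
theorem connectedSpace {b : ℝ} {M : Type*} [TopologicalSpace M] (ρ : SphereModel b M) :
    ConnectedSpace M := by
  have hb := ρ.pos
  have hdom : (fun _ : Fin 3 => ((b / √2 : ℝ) : ℂ)) ∈ polyDisc b := fun i => by
    rw [Complex.norm_real, Real.norm_of_nonneg (by positivity), div_lt_iff₀ (by positivity)]
    have : 1 < √2 := by rw [Real.lt_sqrt zero_le_one]; norm_num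
    nlinarith
  have hcommon : ∀ ε, polarSection b ε (fun _ => ((b / √2 : ℝ) : ℂ)) =
      fun _ => ((b / √2 : ℝ) : ℂ) := by
    intro ε
    funext ⟨i, γ⟩
    have h1 : ‖((b / √2 : ℝ) : ℂ)‖ ^ 2 = b ^ 2 / 2 := by
      rw [Complex.norm_real, Real.norm_of_nonneg (by positivity), div_pow, Real.sq_sqrt (by norm_num)]
    have h2 : √(b ^ 2 - ‖((b / √2 : ℝ) : ℂ)‖ ^ 2) = b / √2 := by
      rw [h1, Real.sqrt_eq_iff_mul_self_eq_of_pos (by positivity), ← sq, div_pow,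
        Real.sq_sqrt (by norm_num)]
      ring
    simp only [polarSection, discSection, h2, ite_self]
  have hU : (⋃ ε, (ρ.chart ε).proj '' polyDisc b) = univ := by
    refine eq_univ_of_forall fun m => ?_
    obtain ⟨ε, z, hz, hm⟩ := ρ.quasifold.cover m
    exact mem_iUnion.2 ⟨ε, z, hz, hm⟩
  have hpre : IsPreconnected (univ : Set M) := by
    rw [← hU]
    refine isPreconnected_iUnion ⟨ρ.ext fun _ => ((b / √2 : ℝ) : ℂ), mem_iInter.2 fun ε =>
      ⟨_, hdom, by rw [chart_proj, hcommon]⟩⟩ fun ε => ?_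
    exact (isConnected_polyDisc hb).isPreconnected.image _ (ρ.chart ε).continuousOn_proj
  exact { isPreconnected_univ := hpre, toNonempty := ⟨ρ.ext fun _ => ((b / √2 : ℝ) : ℂ)⟩ }

end SphereModel

/-! ### The action of the quasitorus and its moment mapping -/

/-- Edge vectors `e` and inward unit normal vectors `n` of a rhombohedron of height `b²` such that
`Q` consists of the vectors all of whose coordinates in the basis `n` lie in `ℤ[φ]`; these
coordinates are `⟪ξ, e i⟫ / b²`. -/
structure GoldenBox (b : ℝ) (e n : Fin 3 → E3) : Prop where
  norm_normal : ∀ i, ‖n i‖ = 1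
  inner_eq : ∀ i j, inner ℝ (e i) (n j) = if i = j then b ^ 2 else 0
  mem_iff : ∀ ξ : E3, ξ ∈ quasilatticeQ ↔
    ∀ i, ∃ k l : ℤ, inner ℝ (e i) ξ = b ^ 2 * (k + φ * l)

/-- Rotation of the coordinates with index `(i, true)` by the phases `c i`. -/
noncomputable def turn (c : Fin 3 → Circle) (y : Fin 3 × Bool → ℂ) : Fin 3 × Bool → ℂ :=
  fun p => if p.2 then c p.1 * y p else y p

/-- The phase `e^{2πi x}` for the `i`-th coordinate `x` of `ξ`. -/
noncomputable def boxPhase (b : ℝ) (e : Fin 3 → E3) (ξ : E3) (i : Fin 3) : Circle :=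
  Circle.exp (2 * Real.pi * (inner ℝ (e i) ξ / b ^ 2))

/-- The moment mapping on the product of spheres, for the rhombohedron with vertex `p` and
edges `e`. -/
noncomputable def boxMoment (b : ℝ) (p : E3) (e : Fin 3 → E3) (y : Fin 3 × Bool → ℂ) : E3 :=
  p + ∑ i, (‖y (i, true)‖ ^ 2 / b ^ 2) • e i

/-- The sign with which the rotation of the coordinate `(i, true)` acts in the polar charts. -/
def poleSign (β : Bool) : ℝ := if β then 1 else -1

/-- The action of the vector `ξ` in the polar chart with poles `ε`. -/
noncomputable def chartTurn (b : ℝ) (e : Fin 3 → E3) (ε : Fin 3 → Bool) (ξ : E3)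
    (z : Fin 3 → ℂ) : Fin 3 → ℂ :=
  fun i => Circle.exp (2 * Real.pi * (poleSign (ε i) * (inner ℝ (e i) ξ / b ^ 2))) * z i

section Turn

variable {b : ℝ} {p : E3} {e n : Fin 3 → E3} {ε : Fin 3 → Bool}

lemma turn_mem {c : Fin 3 → Circle} {y : Fin 3 × Bool → ℂ} (hy : y ∈ sphereLevel b) :
    turn c y ∈ sphereLevel b := by
  intro i
  simpa [turn, Circle.norm_coe] using hy i

lemma GoldenOrbit.turn {y y' : Fin 3 × Bool → ℂ} (h : GoldenOrbit y y') (c : Fin 3 → Circle) :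
    GoldenOrbit (turn c y) (turn c y') := by
  obtain ⟨s, k, hs⟩ := h
  refine ⟨s, k, fun i γ => ?_⟩
  cases γ
  · simpa [_root_.turn] using hs i false
  · simp only [_root_.turn, if_true, hs i true]; ring

lemma boxPhase_add (ξ η : E3) (i : Fin 3) :
    boxPhase b e (ξ + η) i = boxPhase b e ξ i * boxPhase b e η i := by
  rw [boxPhase, boxPhase, boxPhase, ← Circle.exp_add, inner_add_right]
  congr 1
  ring

lemma turn_boxPhase_add (ξ η : E3) (y : Fin 3 × Bool → ℂ) :
    turn (boxPhase b e (ξ + η)) y = turn (boxPhase b e ξ) (turn (boxPhase b e η) y) := by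
  funext ⟨i, γ⟩
  cases γ
  · simp [turn]
  · simp [turn, boxPhase_add, mul_assoc]

lemma exp_two_pi_int (k : ℤ) (x : ℝ) :
    Circle.exp (2 * Real.pi * (k + x)) = Circle.exp (2 * Real.pi * x) :=
  Circle.exp_eq_exp.2 ⟨k, by ring⟩

/-- Vectors of the quasilattice move points within their orbits. -/
lemma GoldenBox.goldenOrbit_turn (hbox : GoldenBox b e n) (hb : 0 < b) {ξ : E3}
    (hξ : ξ ∈ quasilatticeQ) (y : Fin 3 × Bool → ℂ) :
    GoldenOrbit y (turn (boxPhase b e ξ) y) := by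
  choose k l hkl using (hbox.mem_iff ξ).1 hξ
  refine ⟨1, l, fun i γ => ?_⟩
  cases γ
  · simp [turn, goldenWeight]
  · have : boxPhase b e ξ i = goldenPhase (l i) := by
      rw [boxPhase, hkl, mul_div_cancel_left₀ _ (by positivity), exp_two_pi_int, goldenPhase]
    simp [turn, goldenWeight, this]

lemma norm_chartTurn (ξ : E3) (z : Fin 3 → ℂ) (i : Fin 3) : ‖chartTurn b e ε ξ z i‖ = ‖z i‖ := by
  rw [chartTurn, norm_mul, Circle.norm_coe, one_mul]

lemma chartTurn_mem {ξ : E3} {z : Fin 3 → ℂ} :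
    chartTurn b e ε ξ z ∈ polyDisc b ↔ z ∈ polyDisc b := by
  simp only [polyDisc, mem_ofPred_eq, norm_chartTurn]

lemma chartTurn_zero (z : Fin 3 → ℂ) : chartTurn b e ε 0 z = z := by
  funext i
  simp [chartTurn]

lemma goldenOrbit_chartTurn (ξ : E3) (z : Fin 3 → ℂ) :
    GoldenOrbit (polarSection b ε (chartTurn b e ε ξ z))
      (turn (boxPhase b e ξ) (polarSection b ε z)) := by
  refine ⟨fun i => if ε i then 1 else boxPhase b e ξ i, 0, fun i γ => ?_⟩
  have h := norm_chartTurn (b := b) (e := e) (ε := ε) ξ z i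
  cases hε : ε i <;> cases γ
  · simp [turn, polarSection, discSection, hε, goldenWeight, chartTurn, poleSign, boxPhase]
  · simp [turn, polarSection, discSection, hε, goldenWeight, goldenPhase_zero, h]
  · simp [turn, polarSection, discSection, hε, goldenWeight, h]
  · simp [turn, polarSection, discSection, hε, goldenWeight, goldenPhase_zero, chartTurn, poleSign,
      boxPhase]

lemma contDiff_circleExp {V : Type*} [NormedAddCommGroup V] [NormedSpace ℝ V] {f : V → ℝ}
    (hf : ContDiff ℝ ∞ f) : ContDiff ℝ ∞ fun ξ => (Circle.exp (f ξ) : ℂ) := by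
  simp only [Circle.coe_exp]
  exact ((Complex.ofRealCLM.contDiff.comp hf).mul contDiff_const).cexp

lemma contDiff_chartTurn (b : ℝ) (e : Fin 3 → E3) (ε : Fin 3 → Bool) :
    ContDiff ℝ ∞ fun q : E3 × (Fin 3 → ℂ) => chartTurn b e ε q.1 q.2 := by
  refine contDiff_pi.2 fun i => ?_
  refine (contDiff_circleExp ?_).mul ?_
  · exact contDiff_const.mul (contDiff_const.mul
      (((contDiff_const (c := e i)).inner ℝ contDiff_fst).div_const _))
  · exact (contDiff_apply ℝ ℂ i).comp contDiff_snd

lemma hasFDerivAt_chartTurn_right (ξ : E3) (z : Fin 3 → ℂ) :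
    HasFDerivAt (chartTurn b e ε ξ) (ContinuousLinearMap.pi fun i =>
      (Circle.exp (2 * Real.pi * (poleSign (ε i) * (inner ℝ (e i) ξ / b ^ 2))) : ℂ) •
        (ContinuousLinearMap.proj i : (Fin 3 → ℂ) →L[ℝ] ℂ)) z :=
  hasFDerivAt_pi.2 fun i => (hasFDerivAt_apply (𝕜 := ℝ) i z).const_mul _

/-- The fundamental vector fields of the action, in a polar chart. -/
lemma fderiv_chartTurn_left (z : Fin 3 → ℂ) (ξ : E3) :
    fderiv ℝ (fun η => chartTurn b e ε η z) 0 ξ = fun i =>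
      (2 * Real.pi * (poleSign (ε i) * (inner ℝ (e i) ξ / b ^ 2)) : ℝ) * Complex.I * z i := by
  have hi : ∀ i, HasFDerivAt (fun η : E3 => chartTurn b e ε η z i)
      ((ContinuousLinearMap.smulRight (1 : ℂ →L[ℝ] ℂ) (z i)).comp
        ((ContinuousLinearMap.smulRight Complex.ofRealCLM Complex.I).comp
          ((2 * Real.pi * (poleSign (ε i) / b ^ 2)) • innerSL ℝ (e i)))) 0 := by
    intro i
    have h1 : HasFDerivAt (fun η : E3 => 2 * Real.pi * (poleSign (ε i) * (inner ℝ (e i) η / b ^ 2)))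
        ((2 * Real.pi * (poleSign (ε i) / b ^ 2)) • innerSL ℝ (e i)) 0 := by
      have h := ((innerSL ℝ (e i)).hasFDerivAt (x := (0 : E3))).const_mul
        (2 * Real.pi * (poleSign (ε i) / b ^ 2))
      refine h.congr_of_eventuallyEq (Filter.Eventually.of_forall fun η => ?_)
      simp only [innerSL_apply_apply]
      ring
    have h2 := ((ContinuousLinearMap.smulRight Complex.ofRealCLM Complex.I).hasFDerivAt.comp
      (0 : E3) h1).cexp.mul_const (z i)
    refine (h2.congr_of_eventuallyEq (Filter.Eventually.of_forall fun η => ?_)).congr_fderiv ?_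
    · simp [chartTurn, Circle.coe_exp]
    · ext η
      simp
      ring
  have h := (hasFDerivAt_pi.2 hi).fderiv
  have h' : fderiv ℝ (fun η => chartTurn b e ε η z) 0 = _ := h
  rw [h']
  funext i
  simp
  ring

/-- The moment mapping in the polar chart with poles `ε`. -/
noncomputable def chartMoment (b : ℝ) (p : E3) (e : Fin 3 → E3) (ε : Fin 3 → Bool)
    (z : Fin 3 → ℂ) : E3 :=
  p + ∑ i, ((if ε i then ‖z i‖ ^ 2 else b ^ 2 - ‖z i‖ ^ 2) / b ^ 2) • e i

lemma boxMoment_polarSection {z : Fin 3 → ℂ} (hz : z ∈ polyDisc b) :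
    boxMoment b p e (polarSection b ε z) = chartMoment b p e ε z := by
  rw [boxMoment, chartMoment]
  congr 1
  refine Finset.sum_congr rfl fun i _ => ?_
  have h := Real.sq_sqrt (sq_sub_sq_pos (hz i)).le
  cases hε : ε i <;> simp [polarSection, discSection, hε, h]

lemma contDiff_chartMoment : ContDiff ℝ ∞ (chartMoment b p e ε) := by
  refine contDiff_const.add (ContDiff.sum fun i _ => ContDiff.fun_smul (ContDiff.div_const ?_ _)
    contDiff_const)
  have h : ContDiff ℝ ∞ fun z : Fin 3 → ℂ => ‖z i‖ ^ 2 :=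
    (contDiff_norm_sq ℝ).comp (contDiff_apply ℝ ℂ i)
  cases ε i
  · simpa using contDiff_const.sub h
  · simpa using h

lemma fderiv_inner_chartMoment (x v : Fin 3 → ℂ) (ξ : E3) :
    fderiv ℝ (fun z => inner ℝ (chartMoment b p e ε z) ξ) x v =
      ∑ i, poleSign (ε i) * (2 * ((starRingEnd ℂ) (x i) * v i).re) / b ^ 2 * inner ℝ (e i) ξ := by
  have hi : ∀ i, HasFDerivAt (fun z : Fin 3 → ℂ =>
      (if ε i then ‖z i‖ ^ 2 else b ^ 2 - ‖z i‖ ^ 2) / b ^ 2 * inner ℝ (e i) ξ)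
      ((poleSign (ε i) / b ^ 2 * inner ℝ (e i) ξ) •
        (2 • (innerSL ℝ (x i)).comp (ContinuousLinearMap.proj i))) x := by
    intro i
    have h := (hasFDerivAt_apply (𝕜 := ℝ) i x).norm_sq
    cases hε : ε i
    · have h2 := ((h.const_sub (b ^ 2)).const_mul ((1 / b ^ 2) * inner ℝ (e i) ξ))
      refine (h2.congr_of_eventuallyEq (Filter.Eventually.of_forall fun z => ?_)).congr_fderiv ?_
      · simp; ring
      · ext w; simp [poleSign]; ring
    · have h2 := (h.const_mul ((1 / b ^ 2) * inner ℝ (e i) ξ))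
      refine (h2.congr_of_eventuallyEq (Filter.Eventually.of_forall fun z => ?_)).congr_fderiv ?_
      · simp; ring
      · ext w; simp [poleSign]
  have hs := (HasFDerivAt.sum (u := Finset.univ) fun i _ => hi i).const_add (inner ℝ p ξ)
  have hs' : HasFDerivAt (fun z => inner ℝ (chartMoment b p e ε z) ξ) _ x :=
    hs.congr_of_eventuallyEq (Filter.Eventually.of_forall fun z => by
      simp [chartMoment, inner_add_left, sum_inner, real_inner_smul_left])
  rw [hs'.fderiv]
  simp only [_root_.sum_apply]
  refine Finset.sum_congr rfl fun i _ => ?_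
  have h3 : inner ℝ (x i) (v i) = ((starRingEnd ℂ) (x i) * v i).re := by
    simp [Complex.inner]; ring
  simp [h3]
  ring

lemma range_boxMoment (hb : 0 < b) :
    boxMoment b p e '' sphereLevel b = rhombohedron p e := by
  have hb2 : 0 < b ^ 2 := by positivity
  rw [rhombohedron]
  ext μ
  simp only [mem_image, parallelepiped]
  constructor
  · rintro ⟨y, hy, rfl⟩
    refine ⟨_, ⟨fun i => ‖y (i, true)‖ ^ 2 / b ^ 2, ⟨fun i => ?_, fun i => ?_⟩, rfl⟩, rfl⟩
    · simp only [Pi.zero_apply]; positivity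
    · simp only [Pi.one_apply]
      rw [div_le_one hb2]
      nlinarith [hy i, sq_nonneg ‖y (i, false)‖]
  · rintro ⟨_, ⟨t, ⟨h0, h1⟩, rfl⟩, rfl⟩
    have h1' : ∀ i, 0 ≤ 1 - t i := fun i => sub_nonneg.2 (h1 i)
    refine ⟨fun q => if q.2 then (b * √(t q.1) : ℝ) else (b * √(1 - t q.1) : ℝ), fun i => ?_, ?_⟩
    · simp only [if_true, Complex.norm_real, Real.norm_eq_abs, sq_abs, mul_pow, Real.sq_sqrt (h0 i),
        Bool.false_eq_true, if_false, Real.sq_sqrt (h1' i)]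
      ring
    · rw [boxMoment]
      congr 1
      refine Finset.sum_congr rfl fun i _ => ?_
      simp only [if_true, Complex.norm_real, Real.norm_eq_abs, sq_abs, mul_pow, Real.sq_sqrt (h0 i)]
      rw [mul_div_cancel_left₀ _ hb2.ne']

end Turn

namespace SphereModel

variable {b : ℝ} {M : Type*} [TopologicalSpace M] (ρ : SphereModel b M)
variable {p : E3} {e n : Fin 3 → E3} {ε : Fin 3 → Bool} {y : Fin 3 × Bool → ℂ}

/-- The action of `ℝ³ / Q` on `M`: a vector acts by the corresponding rotations of the coordinates
`(i, true)` of any representative. -/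
noncomputable def boxAct (e : Fin 3 → E3) (d : E3 ⧸ quasilatticeQ) (m : M) : M :=
  ρ.ext (turn (boxPhase b e d.out) (ρ.isQuotientMap.surjective.hasRightInverse.choose m).1)

/-- The moment mapping of the action of `ℝ³ / Q` on `M`. -/
noncomputable def boxMomentMap (p : E3) (e : Fin 3 → E3) (m : M) : E3 :=
  boxMoment b p e (ρ.isQuotientMap.surjective.hasRightInverse.choose m).1

/-- The chosen representative of the class of `y` lies on the orbit of `y`. -/
lemma goldenOrbit_choose (hy : y ∈ sphereLevel b) :
    GoldenOrbit (ρ.isQuotientMap.surjective.hasRightInverse.choose (ρ.ext y)).1 y := by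
  rw [← ρ.ext_eq_iff (Subtype.property _) hy, ρ.ext_apply (Subtype.property _)]
  exact ρ.isQuotientMap.surjective.hasRightInverse.choose_spec _

lemma ext_turn_eq_of_sub_mem (hbox : GoldenBox b e n) {ξ η : E3} (h : -ξ + η ∈ quasilatticeQ)
    (hy : y ∈ sphereLevel b) :
    ρ.ext (turn (boxPhase b e ξ) y) = ρ.ext (turn (boxPhase b e η) y) := by
  have h1 : η = (-ξ + η) + ξ := by abel
  rw [ρ.ext_eq_iff (turn_mem hy) (turn_mem hy)]
  rw [h1, turn_boxPhase_add]
  exact hbox.goldenOrbit_turn ρ.pos h _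

lemma boxAct_mk (hbox : GoldenBox b e n) (ξ : E3) (hy : y ∈ sphereLevel b) :
    ρ.boxAct e (QuotientAddGroup.mk ξ) (ρ.ext y) = ρ.ext (turn (boxPhase b e ξ) y) := by
  have h1 := ρ.goldenOrbit_choose hy
  have h2 : ∀ c, ρ.ext (turn c (ρ.isQuotientMap.surjective.hasRightInverse.choose (ρ.ext y)).1) =
      ρ.ext (turn c y) := fun c =>
    (ρ.ext_eq_iff (turn_mem (Subtype.property _)) (turn_mem hy)).2 (h1.turn c)
  rw [boxAct, h2]
  refine ρ.ext_turn_eq_of_sub_mem hbox ?_ hy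
  rw [← QuotientAddGroup.eq]
  exact Quotient.out_eq' _

lemma boxMomentMap_ext (hy : y ∈ sphereLevel b) :
    ρ.boxMomentMap p e (ρ.ext y) = boxMoment b p e y := by
  obtain ⟨s, h, hs⟩ := ρ.goldenOrbit_choose hy
  rw [boxMomentMap, boxMoment, boxMoment]
  congr 1
  refine Finset.sum_congr rfl fun i _ => ?_
  rw [hs i true, norm_mul, norm_mul, Circle.norm_coe, Circle.norm_coe, one_mul, one_mul]

lemma boxAct_chart_proj (hbox : GoldenBox b e n) (ξ : E3) {z : Fin 3 → ℂ} (hz : z ∈ polyDisc b) :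
    ρ.boxAct e (QuotientAddGroup.mk ξ) ((ρ.chart ε).proj z) =
      (ρ.chart ε).proj (chartTurn b e ε ξ z) := by
  rw [chart_proj, chart_proj, ρ.boxAct_mk hbox _ (polarSection_mem hz), eq_comm,
    ρ.ext_eq_iff (polarSection_mem (chartTurn_mem.2 hz)) (turn_mem (polarSection_mem hz))]
  exact goldenOrbit_chartTurn ξ z

lemma boxMomentMap_chart_proj {z : Fin 3 → ℂ} (hz : z ∈ polyDisc b) :
    ρ.boxMomentMap p e ((ρ.chart ε).proj z) = chartMoment b p e ε z := by
  rw [chart_proj, boxMomentMap_ext _ (polarSection_mem hz), boxMoment_polarSection hz]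

/-- The action lifts to the polar charts as a transition map composed with the action in one of
the charts. -/
lemma exists_boxAct_lift (hbox : GoldenBox b e n) {ε' : Fin 3 → Bool} {x y : Fin 3 → ℂ}
    (hx : x ∈ polyDisc b) (hy : y ∈ polyDisc b) {ξ₀ : E3}
    (hact : ρ.boxAct e (QuotientAddGroup.mk ξ₀) ((ρ.chart ε).proj x) = (ρ.chart ε').proj y) :
    ∃ (W : Set (E3 × (Fin 3 → ℂ))) (G : E3 × (Fin 3 → ℂ) → Fin 3 → ℂ), IsOpen W ∧ (ξ₀, x) ∈ W ∧
      ContDiffOn ℝ ∞ G W ∧ G (ξ₀, x) = y ∧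
      ∀ ξ z, (ξ, z) ∈ W → z ∈ polyDisc b ∧ G (ξ, z) ∈ polyDisc b ∧
        (ρ.chart ε').proj (G (ξ, z)) =
          ρ.boxAct e (QuotientAddGroup.mk ξ) ((ρ.chart ε).proj z) ∧
        ∀ u v : Fin 3 → ℂ, polyForm ![u, v] = polyForm
          ![fderiv ℝ (fun z' => G (ξ, z')) z u, fderiv ℝ (fun z' => G (ξ, z')) z v] := by
  rw [ρ.boxAct_chart_proj hbox ξ₀ hx] at hact
  obtain ⟨e', he'⟩ := ρ.exists_lift ρ (f := id) (fun _ _ => rfl) (chartTurn_mem.2 hx) hy hact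
  have hsm := contDiff_chartTurn b e ε
  refine ⟨(fun q => chartTurn b e ε q.1 q.2) ⁻¹' e'.source,
    fun q => e' (chartTurn b e ε q.1 q.2), e'.open_source.preimage hsm.continuous,
    he'.mem_source, he'.smooth.comp hsm.contDiffOn fun q hq => hq, he'.apply_eq, ?_⟩
  intro ξ z hz
  have hz1 : chartTurn b e ε ξ z ∈ e'.source := hz
  have hz2 : z ∈ polyDisc b := chartTurn_mem.1 (he'.source_subset hz1)
  refine ⟨hz2, he'.target_subset (e'.map_source hz1), ?_, fun u v => ?_⟩
  · exact (he'.lifts _ hz1).trans (ρ.boxAct_chart_proj hbox ξ hz2).symm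
  · have hd : DifferentiableAt ℝ e' (chartTurn b e ε ξ z) :=
      (he'.smooth.differentiableOn (by simp)).differentiableAt (e'.open_source.mem_nhds hz1)
    have ht := hasFDerivAt_chartTurn_right (b := b) (e := e) (ε := ε) ξ z
    have hf : fderiv ℝ (fun z' => e' (chartTurn b e ε ξ z')) z = _ :=
      (hd.hasFDerivAt.comp z ht).fderiv
    change polyForm ![u, v] = polyForm ![fderiv ℝ (fun z' => e' (chartTurn b e ε ξ z')) z u,
      fderiv ℝ (fun z' => e' (chartTurn b e ε ξ z')) z v]
    rw [hf]
    refine Eq.trans ?_ (he'.pullback _ hz1 _ _)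
    rw [polyForm_apply, polyForm_apply]
    exact Finset.sum_congr rfl fun i _ => (planeForm_mul_circle _ _ _).symm

/-- Hamilton's equation in a polar chart. -/
lemma fderiv_inner_boxMomentMap {x : Fin 3 → ℂ} (hx : x ∈ polyDisc b) (ξ : E3) (v : Fin 3 → ℂ) :
    fderiv ℝ (fun z => inner ℝ (ρ.boxMomentMap p e ((ρ.chart ε).proj z)) ξ) x v =
      polyForm ![fderiv ℝ (fun η => chartTurn b e ε η x) 0 ξ, v] := by
  have h1 : (fun z => inner ℝ (ρ.boxMomentMap p e ((ρ.chart ε).proj z)) ξ) =ᶠ[𝓝 x]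
      fun z => inner ℝ (chartMoment b p e ε z) ξ := by
    filter_upwards [(isOpen_polyDisc b).mem_nhds hx] with z hz
    rw [ρ.boxMomentMap_chart_proj hz]
  rw [h1.fderiv_eq, fderiv_inner_chartMoment, fderiv_chartTurn_left, polyForm_apply]
  refine Finset.sum_congr rfl fun i _ => ?_
  have hpi := Real.pi_ne_zero
  have h2 : ∀ r : ℝ, poleSign (ε i) * (2 * r) / b ^ 2 * inner ℝ (e i) ξ =
      (1 / Real.pi) * (2 * Real.pi * (poleSign (ε i) * (inner ℝ (e i) ξ / b ^ 2)) * r) := by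
    intro r
    field_simp
  rw [h2, planeForm]
  generalize 2 * Real.pi * (poleSign (ε i) * (inner ℝ (e i) ξ / b ^ 2)) = c
  simp
  ring

/-- The Hamiltonian action of the quasitorus `ℝ³ / Q` on the quasifold of a sphere model. -/
noncomputable def hamiltonianAction (p : E3) (hbox : GoldenBox b e n) :
    HamiltonianAction quasilatticeQ ρ.quasifold where
  act := ρ.boxAct e
  act_zero m := by
    obtain ⟨y, hy, rfl⟩ := ρ.exists_ext_eq m
    have h : turn (boxPhase b e 0) y = y := by
      funext ⟨i, γ⟩
      cases γ <;> simp [turn, boxPhase]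
    rw [← QuotientAddGroup.mk_zero, ρ.boxAct_mk hbox _ hy, h]
  act_add d d' m := by
    obtain ⟨ξ, rfl⟩ := QuotientAddGroup.mk_surjective d
    obtain ⟨η, rfl⟩ := QuotientAddGroup.mk_surjective d'
    obtain ⟨y, hy, rfl⟩ := ρ.exists_ext_eq m
    rw [← QuotientAddGroup.mk_add, ρ.boxAct_mk hbox _ hy, ρ.boxAct_mk hbox _ hy,
      ρ.boxAct_mk hbox _ (turn_mem hy), turn_boxPhase_add]
  act_smooth _ _ _ hx _ hy _ hact := ρ.exists_boxAct_lift hbox hx hy hact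
  moment := ρ.boxMomentMap p e
  moment_invariant d m := by
    obtain ⟨ξ, rfl⟩ := QuotientAddGroup.mk_surjective d
    obtain ⟨y, hy, rfl⟩ := ρ.exists_ext_eq m
    rw [ρ.boxAct_mk hbox _ hy, ρ.boxMomentMap_ext hy, ρ.boxMomentMap_ext (turn_mem hy), boxMoment,
      boxMoment]
    simp [turn, Circle.norm_coe]
  moment_smooth ε := (contDiff_chartMoment (ε := ε)).contDiffOn.congr fun z hz =>
    ρ.boxMomentMap_chart_proj hz
  moment_spec ε x hx :=
    ⟨univ ×ˢ polyDisc b, fun q => chartTurn b e ε q.1 q.2,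
      isOpen_univ.prod (isOpen_polyDisc b), ⟨trivial, hx⟩, (contDiff_chartTurn b e ε).contDiffOn,
      fun ξ _ hz => ⟨hz.2, chartTurn_mem.2 hz.2, (ρ.boxAct_chart_proj hbox ξ hz.2).symm⟩,
      fun z _ => chartTurn_zero z, ρ.fderiv_inner_boxMomentMap hx⟩

lemma hamiltonianAction_act (p : E3) (hbox : GoldenBox b e n) (ξ : E3) (hy : y ∈ sphereLevel b) :
    (ρ.hamiltonianAction p hbox).act (QuotientAddGroup.mk ξ) (ρ.ext y) =
      ρ.ext (turn (boxPhase b e ξ) y) := ρ.boxAct_mk hbox ξ hy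

lemma hamiltonianAction_moment (p : E3) (hbox : GoldenBox b e n) (hy : y ∈ sphereLevel b) :
    (ρ.hamiltonianAction p hbox).moment (ρ.ext y) = boxMoment b p e y := ρ.boxMomentMap_ext hy

/-- A vector that fixes a point with nonvanishing coordinates lies in the quasilattice. -/
theorem effective (p : E3) (hbox : GoldenBox b e n) :
    (ρ.hamiltonianAction p hbox).Effective := by
  intro d hd
  obtain ⟨ξ, rfl⟩ := QuotientAddGroup.mk_surjective d
  have hb := ρ.pos
  have hz : (fun _ => ((b / 2 : ℝ) : ℂ)) ∈ polyDisc b := fun i => by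
    rw [Complex.norm_real, Real.norm_of_nonneg (by positivity)]
    linarith
  have h1 : (ρ.chart fun _ => true).proj _ = (ρ.chart fun _ => true).proj _ :=
    (ρ.boxAct_chart_proj (ε := fun _ => true) hbox ξ hz).symm.trans (hd _)
  obtain ⟨g, hg⟩ := ((ρ.chart fun _ => true).proj_eq_iff _ (chartTurn_mem.2 hz) _ hz).1 h1
  rw [QuotientAddGroup.eq_zero_iff, hbox.mem_iff]
  intro i
  have hgi : (chartPhase true (Multiplicative.toAdd g i) : ℂ) *
      (Circle.exp (2 * Real.pi * (poleSign true * (inner ℝ (e i) ξ / b ^ 2))) *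
        ((b / 2 : ℝ) : ℂ)) = ((b / 2 : ℝ) : ℂ) := congrFun hg i
  have hb' : ((b / 2 : ℝ) : ℂ) ≠ 0 := by exact_mod_cast (by positivity : b / 2 ≠ 0)
  have h2 : chartPhase true (Multiplicative.toAdd g i) *
      Circle.exp (2 * Real.pi * (poleSign true * (inner ℝ (e i) ξ / b ^ 2))) = 1 := by
    refine Circle.ext (mul_right_cancel₀ hb' ?_)
    rw [Circle.coe_mul, mul_assoc, hgi, Circle.coe_one, one_mul]
  rw [chartPhase, goldenPhase, ← Circle.exp_add, Circle.exp_eq_one] at h2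
  obtain ⟨k, hk⟩ := h2
  refine ⟨k, -(Multiplicative.toAdd g i), ?_⟩
  have hpi := Real.pi_pos
  simp only [poleSign, if_true, one_mul] at hk
  have h3 : φ * (Multiplicative.toAdd g i : ℤ) + inner ℝ (e i) ξ / b ^ 2 = k := by
    have : (2 * Real.pi) * (φ * (Multiplicative.toAdd g i : ℤ) + inner ℝ (e i) ξ / b ^ 2) =
        (2 * Real.pi) * k := by linarith
    exact mul_left_cancel₀ (by positivity) this
  rw [← h3]
  push_cast
  field_simp
  ring

theorem range_moment (p : E3) (hbox : GoldenBox b e n) :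
    range (ρ.hamiltonianAction p hbox).moment = rhombohedron p e := by
  rw [← range_boxMoment ρ.pos]
  ext μ
  constructor
  · rintro ⟨m, rfl⟩
    obtain ⟨y, hy, rfl⟩ := ρ.exists_ext_eq m
    exact ⟨y, hy, (ρ.hamiltonianAction_moment p hbox hy).symm⟩
  · rintro ⟨y, hy, rfl⟩
    exact ⟨ρ.ext y, ρ.hamiltonianAction_moment p hbox hy⟩

end SphereModel

/-! ### Induced structures -/

/-- `u` is tangent at `y` to the product of three 3-spheres through `y`. -/
def SphereTangent (y u : Fin 3 × Bool → ℂ) : Prop :=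
  ∀ i, ((starRingEnd ℂ) (y (i, true)) * u (i, true)).re +
    ((starRingEnd ℂ) (y (i, false)) * u (i, false)).re = 0

/-- Rotated polar sections are tangent to the product of spheres, and pull the standard form back
to the standard form of `ℂ³`: the second coordinate contributes nothing, being real up to a
constant phase. -/
lemma exists_hasFDerivAt_polarSection {b : ℝ} {ε : Fin 3 → Bool} {w : Fin 3 → ℂ}
    (hw : w ∈ polyDisc b) (t : Fin 3 × Bool → Circle) :
    ∃ D : (Fin 3 → ℂ) →L[ℝ] (Fin 3 × Bool → ℂ),
      HasFDerivAt (fun w' p => (t p : ℂ) * polarSection b ε w' p) D w ∧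
      (∀ u, SphereTangent (fun p => (t p : ℂ) * polarSection b ε w p) (D u)) ∧
      ∀ u v, ∑ p, planeForm (D u p) (D v p) = polyForm ![u, v] := by
  have hcomp : ∀ p : Fin 3 × Bool, ∃ d : (Fin 3 → ℂ) →L[ℝ] ℂ,
      HasFDerivAt (fun w' => polarSection b ε w' p) d w ∧
      (p.2 = ε p.1 → ∀ u, d u = u p.1) ∧
      (p.2 ≠ ε p.1 → ∀ u, d u = ((-((starRingEnd ℂ) (w p.1) * u p.1).re /
        √(b ^ 2 - ‖w p.1‖ ^ 2) : ℝ) : ℂ)) := by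
    rintro ⟨i, γ⟩
    by_cases h : γ = ε i
    · refine ⟨ContinuousLinearMap.proj i, ?_, fun _ _ => rfl, fun h' => absurd h h'⟩
      simp only [polarSection, discSection, h, if_true]
      exact hasFDerivAt_apply i w
    · have hpos := sq_sub_sq_pos (hw i)
      have h1 := (((hasFDerivAt_apply (𝕜 := ℝ) i w).norm_sq).const_sub (b ^ 2)).sqrt hpos.ne'
      have h2 := Complex.ofRealCLM.hasFDerivAt.comp w h1
      simp only [polarSection, discSection, h, if_false]
      refine ⟨_, h2, fun h' => h'.elim, fun _ u => ?_⟩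
      have hi : inner ℝ (w i) (u i) = ((starRingEnd ℂ) (w i) * u i).re := by
        simp [Complex.inner]; ring
      simp only [ContinuousLinearMap.comp_apply, Complex.ofRealCLM_apply]
      congr 1
      simp [hi]
      ring
  choose d hd hd1 hd2 using hcomp
  have hstar : ∀ p : Fin 3 × Bool, ∀ a c : ℂ,
      (starRingEnd ℂ) (t p * a) * (t p * c) = (starRingEnd ℂ) a * c := by
    intro p a c
    rw [map_mul]
    linear_combination ((starRingEnd ℂ) a * c) * (t p).mul_conj_self
  refine ⟨ContinuousLinearMap.pi fun p => (t p : ℂ) • d p,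
    hasFDerivAt_pi.2 fun p => (hd p).const_mul _, fun u i => ?_, fun u v => ?_⟩
  · have hpos := Real.sqrt_pos.2 (sq_sub_sq_pos (hw i))
    change ((starRingEnd ℂ) (t (i, true) * _) * (t (i, true) * d (i, true) u)).re +
      ((starRingEnd ℂ) (t (i, false) * _) * (t (i, false) * d (i, false) u)).re = 0
    rw [hstar, hstar]
    cases hε : ε i
    · rw [hd1 (i, false) hε.symm, hd2 (i, true) (by simp [hε])]
      simp only [polarSection, discSection, hε, if_true, Bool.true_eq_false, if_false,
        Complex.conj_ofReal, ← Complex.ofReal_mul, Complex.ofReal_re]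
      field_simp
      ring
    · rw [hd1 (i, true) hε.symm, hd2 (i, false) (by simp [hε])]
      simp only [polarSection, discSection, hε, if_true, Bool.false_eq_true, if_false,
        Complex.conj_ofReal, ← Complex.ofReal_mul, Complex.ofReal_re]
      field_simp
      ring
  · have hreal : ∀ r s : ℝ, planeForm r s = 0 := by
      intro r s
      rw [planeForm, Complex.conj_ofReal, ← Complex.ofReal_mul, Complex.ofReal_im, mul_zero]
    rw [polyForm_apply, Fintype.sum_prod_type]
    refine Finset.sum_congr rfl fun i _ => ?_
    change ∑ γ, planeForm (t (i, γ) * d (i, γ) u) (t (i, γ) * d (i, γ) v) = _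
    simp only [planeForm_mul_circle, Fintype.sum_bool]
    cases hε : ε i
    · rw [hd1 (i, false) hε.symm, hd1 (i, false) hε.symm, hd2 (i, true) (by simp [hε]),
        hd2 (i, true) (by simp [hε]), hreal, zero_add]
    · rw [hd1 (i, true) hε.symm, hd1 (i, true) hε.symm, hd2 (i, false) (by simp [hε]),
        hd2 (i, false) (by simp [hε]), hreal, add_zero]

/-- If the quotient map factors through a smooth map `P` of the product of spheres onto `Z` that
pulls `α` back to the standard form, then the quasifold structure is induced by `α`. -/
theorem SphereModel.isInduced {b : ℝ} {F : Type*} [NormedAddCommGroup F] [NormedSpace ℝ F]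
    {Z : Set F} {r : Setoid Z} (ρ : SphereModel b (Quotient r)) {α : F → F → F → ℝ}
    {P : (Fin 3 × Bool → ℂ) → F} (hP : ContDiff ℝ ∞ P)
    (hPZ : ∀ y ∈ sphereLevel b, ∃ hy : P y ∈ Z, ρ.ext y = Quotient.mk r ⟨P y, hy⟩)
    (hsurj : ∀ z ∈ Z, ∃ y ∈ sphereLevel b, P y = z)
    (hα : ∀ y ∈ sphereLevel b, ∀ u v, SphereTangent y u → SphereTangent y v →
      α (P y) (fderiv ℝ P y u) (fderiv ℝ P y v) = ∑ p, planeForm (u p) (v p)) :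
    ρ.quasifold.IsInduced α := by
  intro ε x hx z hz
  have hx' : x ∈ polyDisc b := hx
  obtain ⟨y, hy, hyz⟩ := hsurj z z.2
  have hzy : ρ.ext y = Quotient.mk r z := by
    obtain ⟨hy', h⟩ := hPZ y hy
    rw [h]
    congr 1
    exact Subtype.ext hyz
  have horb : GoldenOrbit (polarSection b ε x) y :=
    (ρ.ext_eq_iff (polarSection_mem hx') hy).1 (hz.trans hzy.symm)
  obtain ⟨s, h, hs⟩ := horb
  let t : Fin 3 × Bool → Circle := fun p => s p.1 * goldenWeight (h p.1) p.2
  let τ : (Fin 3 → ℂ) → Fin 3 × Bool → ℂ := fun w p => (t p : ℂ) * polarSection b ε w p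
  have hτorb : ∀ w, GoldenOrbit (polarSection b ε w) (τ w) := fun w =>
    ⟨s, h, fun i γ => by simp only [τ, t, Circle.coe_mul]⟩
  have hτmem : ∀ w ∈ polyDisc b, τ w ∈ sphereLevel b := by
    intro w hw i
    simpa only [τ, norm_mul, Circle.norm_coe, one_mul] using polarSection_mem (ε := ε) hw i
  have hτ : ContDiffOn ℝ ∞ τ (polyDisc b) :=
    contDiffOn_pi.2 fun p => contDiffOn_const.mul
      (contDiffOn_pi.1 (contDiffOn_polarSection b ε) p)
  have hτx : τ x = y := by
    funext ⟨i, γ⟩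
    simp only [τ, t, Circle.coe_mul, hs]
  refine ⟨polyDisc b, P ∘ τ, isOpen_polyDisc b, hx, Subset.rfl, hP.comp_contDiffOn hτ,
    by rw [Function.comp_apply, hτx, hyz], fun w hw => ⟨?_, fun u v => ?_⟩⟩
  · obtain ⟨hy', h'⟩ := hPZ (τ w) (hτmem w hw)
    exact ⟨hy', ((ρ.ext_eq_iff (polarSection_mem hw) (hτmem w hw)).2 (hτorb w)).trans h'⟩
  · obtain ⟨D, hD, hDt, hDf⟩ := exists_hasFDerivAt_polarSection (ε := ε) hw t
    have hPd : HasFDerivAt P (fderiv ℝ P (τ w)) (τ w) :=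
      (hP.differentiable (by simp) (τ w)).hasFDerivAt
    have hc : fderiv ℝ (P ∘ τ) w = (fderiv ℝ P (τ w)).comp D :=
      (HasFDerivAt.comp w hPd hD).fderiv
    rw [hc, Function.comp_apply, ContinuousLinearMap.comp_apply, ContinuousLinearMap.comp_apply,
      hα (τ w) (hτmem w hw) _ _ (hDt u) (hDt v), hDf]
    rfl

/-! ### The products of two-spheres: the Hopf map -/

/-- The product of the three Hopf maps from the 3-spheres of radius `b` to the 2-spheres of
radius `b`. -/
noncomputable def hopfMap (b : ℝ) (y : Fin 3 × Bool → ℂ) (i : Fin 3) : E3 :=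
  !₂[2 / b * (y (i, true) * (starRingEnd ℂ) (y (i, false))).re,
    2 / b * (y (i, true) * (starRingEnd ℂ) (y (i, false))).im,
    1 / b * (Complex.normSq (y (i, false)) - Complex.normSq (y (i, true)))]

/-- The derivative of the Hopf maps. -/
noncomputable def hopfDeriv (b : ℝ) (y u : Fin 3 × Bool → ℂ) (i : Fin 3) : E3 :=
  !₂[2 / b * (u (i, true) * (starRingEnd ℂ) (y (i, false)) +
      y (i, true) * (starRingEnd ℂ) (u (i, false))).re,
    2 / b * (u (i, true) * (starRingEnd ℂ) (y (i, false)) +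
      y (i, true) * (starRingEnd ℂ) (u (i, false))).im,
    2 / b * ((starRingEnd ℂ) (y (i, false)) * u (i, false) -
      (starRingEnd ℂ) (y (i, true)) * u (i, true)).re]

lemma contDiff_hopfMap (b : ℝ) : ContDiff ℝ ∞ (hopfMap b) := by
  refine contDiff_pi.2 fun i => (contDiff_euclidean (𝕜 := ℝ)).2 fun k => ?_
  have hre : ∀ p : Fin 3 × Bool, ContDiff ℝ ∞ fun y : Fin 3 × Bool → ℂ => (y p).re := fun p =>
    Complex.reCLM.contDiff.comp (contDiff_apply ℝ ℂ p)
  have him : ∀ p : Fin 3 × Bool, ContDiff ℝ ∞ fun y : Fin 3 × Bool → ℂ => (y p).im := fun p =>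
    Complex.imCLM.contDiff.comp (contDiff_apply ℝ ℂ p)
  have h1 := hre (i, true)
  have h2 := hre (i, false)
  have h3 := him (i, true)
  have h4 := him (i, false)
  fin_cases k <;> simp [hopfMap, Complex.normSq_apply] <;> fun_prop

lemma fderiv_hopfMap (b : ℝ) (y u : Fin 3 × Bool → ℂ) :
    fderiv ℝ (hopfMap b) y u = hopfDeriv b y u := by
  have hd : DifferentiableAt ℝ (hopfMap b) y := (contDiff_hopfMap b).differentiable (by simp) y
  -- the Hopf maps are quadratic
  have hq : ∀ t : ℝ, hopfMap b (y + t • u) =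
      hopfMap b y + t • hopfDeriv b y u + t ^ 2 • hopfMap b u := by
    intro t
    funext i
    ext k
    fin_cases k <;> simp [hopfMap, hopfDeriv, Complex.normSq_apply] <;> ring
  have h1 : HasDerivAt (fun t : ℝ => hopfMap b (y + t • u)) (hopfDeriv b y u) 0 := by
    simp only [hq]
    have h2 := (((hasDerivAt_id (0 : ℝ)).smul_const (hopfDeriv b y u)).const_add (hopfMap b y)).add
      (((hasDerivAt_id (0 : ℝ)).pow 2).smul_const (hopfMap b u))
    refine (h2.congr_of_eventuallyEq (Filter.Eventually.of_forall fun t => ?_)).congr_deriv ?_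
    · simp
    · simp
  rw [← hd.lineDeriv_eq_fderiv, lineDeriv]
  exact h1.deriv

/-- The Hopf maps pull the form of the 2-spheres back to the standard form. -/
lemma sphereForm_hopfMap {b : ℝ} (hb : 0 < b) {y u v : Fin 3 × Bool → ℂ} (hy : y ∈ sphereLevel b)
    (hu : SphereTangent y u) (hv : SphereTangent y v) :
    sphereForm b (hopfMap b y) (hopfDeriv b y u) (hopfDeriv b y v) =
      ∑ p, planeForm (u p) (v p) := by
  rw [sphereForm, Fintype.sum_prod_type]
  refine Finset.sum_congr rfl fun i _ => ?_
  have hpi := Real.pi_ne_zero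
  have hN := hy i
  have hU := hu i
  have hV := hv i
  rw [← Complex.normSq_eq_norm_sq, ← Complex.normSq_eq_norm_sq] at hN
  rw [Fintype.sum_bool, Matrix.det_fin_three]
  simp only [hopfMap, hopfDeriv, planeForm, Complex.normSq_apply, Complex.mul_re, Complex.mul_im,
    Complex.conj_re, Complex.conj_im, Complex.add_re, Complex.add_im, Complex.sub_re,
    Matrix.of_apply, Matrix.cons_val_zero, Matrix.cons_val_one, Matrix.cons_val] at hN hU hV ⊢
  generalize (y (i, true)).re = a, (y (i, true)).im = a', (y (i, false)).re = c,
    (y (i, false)).im = c', (u (i, true)).re = p, (u (i, true)).im = p', (u (i, false)).re = q,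
    (u (i, false)).im = q', (v (i, true)).re = r, (v (i, true)).im = r', (v (i, false)).re = s,
    (v (i, false)).im = s' at hN hU hV ⊢
  field_simp
  -- the components of `u` and `v` along the orbit and along the radius drop out, by tangency
  linear_combination
    (4 * ((a * a + a' * a' + (c * c + c' * c')) + b ^ 2) *
      (p' * r - p * r' + (q' * s - q * s'))) * hN
    - (4 * (a * a + a' * a' + (c * c + c' * c')) *
      (a' * r - a * r' + (c' * s - c * s'))) * hU
    - (4 * (a * a + a' * a' + (c * c + c' * c')) *
      (p' * a - p * a' + (q' * c - q * c'))) * hV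

lemma exists_circle_of_norm_eq {u v : ℂ} (h : ‖u‖ = ‖v‖) : ∃ s : Circle, v = s * u := by
  obtain ⟨s, hs⟩ := exists_circle_mul_norm u
  obtain ⟨t, ht⟩ := exists_circle_mul_norm v
  refine ⟨t * s⁻¹, ?_⟩
  rw [ht, hs, ← h, ← mul_assoc, ← Circle.coe_mul, inv_mul_cancel_right]

/-- The fibres of the Hopf maps are the orbits of the diagonal circles. -/
lemma hopfMap_eq_iff {b : ℝ} (hb : 0 < b) {y y' : Fin 3 × Bool → ℂ} (hy : y ∈ sphereLevel b)
    (hy' : y' ∈ sphereLevel b) (i : Fin 3) :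
    hopfMap b y i = hopfMap b y' i ↔ ∃ s : Circle, ∀ γ, y' (i, γ) = s * y (i, γ) := by
  constructor
  · intro h
    have h0 := congrArg (fun p : E3 => p 0) h
    have h1 := congrArg (fun p : E3 => p 1) h
    have h2 := congrArg (fun p : E3 => p 2) h
    simp only [hopfMap, PiLp.toLp_apply, Matrix.cons_val_zero, Matrix.cons_val_one,
      Matrix.cons_val] at h0 h1 h2
    have h0' := mul_left_cancel₀ (by positivity) h0
    have h1' := mul_left_cancel₀ (by positivity) h1
    have h2' := mul_left_cancel₀ (by positivity) h2
    have hN := hy i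
    have hN' := hy' i
    rw [Complex.normSq_eq_norm_sq, Complex.normSq_eq_norm_sq, Complex.normSq_eq_norm_sq,
      Complex.normSq_eq_norm_sq] at h2'
    have hq : y (i, true) * (starRingEnd ℂ) (y (i, false)) =
        y' (i, true) * (starRingEnd ℂ) (y' (i, false)) := Complex.ext h0' h1'
    have hf : ‖y (i, false)‖ = ‖y' (i, false)‖ :=
      (pow_left_inj₀ (norm_nonneg _) (norm_nonneg _) two_ne_zero).1 (by linarith)
    have ht : ‖y (i, true)‖ = ‖y' (i, true)‖ :=
      (pow_left_inj₀ (norm_nonneg _) (norm_nonneg _) two_ne_zero).1 (by linarith)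
    by_cases h00 : y (i, false) = 0
    · obtain ⟨s, hs⟩ := exists_circle_of_norm_eq ht
      have h00' : y' (i, false) = 0 := by rw [← norm_eq_zero, ← hf, h00, norm_zero]
      refine ⟨s, fun γ => ?_⟩
      cases γ
      · rw [h00, h00', mul_zero]
      · exact hs
    · obtain ⟨s, hs⟩ := exists_circle_of_norm_eq hf
      refine ⟨s, fun γ => ?_⟩
      cases γ
      · exact hs
      · have hne : (starRingEnd ℂ) (y (i, false)) ≠ 0 := by simpa using h00
        rw [hs, map_mul] at hq
        refine mul_right_cancel₀ hne ?_
        linear_combination (-(s : ℂ)) * hq -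
          (y' (i, true) * (starRingEnd ℂ) (y (i, false))) * s.mul_conj_self
  · rintro ⟨s, hs⟩
    have hq : y' (i, true) * (starRingEnd ℂ) (y' (i, false)) =
        y (i, true) * (starRingEnd ℂ) (y (i, false)) := by
      rw [hs, hs, map_mul]
      linear_combination (y (i, true) * (starRingEnd ℂ) (y (i, false))) * s.mul_conj_self
    have hn : ∀ γ, Complex.normSq (y' (i, γ)) = Complex.normSq (y (i, γ)) := fun γ => by
      rw [hs, map_mul, Circle.normSq_coe, one_mul]
    simp only [hopfMap, hq, hn]

/-- Rotating the first coordinate of `ℂ²` rotates the image under the Hopf map. -/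
lemma hopfMap_goldenWeight {b : ℝ} (h : Fin 3 → ℤ) (y : Fin 3 × Bool → ℂ) (i : Fin 3) :
    hopfMap b (fun p => goldenWeight (h p.1) p.2 * y p) i =
      rotate (goldenPhase (h i)) (hopfMap b y i) := by
  ext k
  fin_cases k <;> simp [hopfMap, rotate, goldenWeight] <;> ring

lemma norm_hopfMap {b : ℝ} (hb : 0 < b) {y : Fin 3 × Bool → ℂ} (hy : y ∈ sphereLevel b) :
    hopfMap b y ∈ sphereCube b := by
  intro i
  have hN := hy i
  rw [← Complex.normSq_eq_norm_sq, ← Complex.normSq_eq_norm_sq] at hN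
  rw [EuclideanSpace.norm_eq, Real.sqrt_eq_iff_mul_self_eq_of_pos hb, Fin.sum_univ_three]
  simp only [hopfMap, Complex.normSq_apply, Real.norm_eq_abs, sq_abs, PiLp.toLp_apply,
    Matrix.cons_val_zero, Matrix.cons_val_one, Matrix.cons_val, Complex.mul_re, Complex.mul_im,
    Complex.conj_re, Complex.conj_im] at hN ⊢
  field_simp
  generalize (y (i, true)).re = a, (y (i, true)).im = a', (y (i, false)).re = c,
    (y (i, false)).im = c' at hN ⊢
  have : b ^ 4 = (a * a + a' * a' + (c * c + c' * c')) ^ 2 := by rw [hN]; ring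
  linear_combination this

lemma exists_hopfMap_eq {b : ℝ} (hb : 0 < b) {q : Fin 3 → E3} (hq : q ∈ sphereCube b) :
    ∃ y ∈ sphereLevel b, hopfMap b y = q := by
  have key : ∀ i, ∃ u : Bool → ℂ, ‖u true‖ ^ 2 + ‖u false‖ ^ 2 = b ^ 2 ∧
      q i = !₂[2 / b * (u true * (starRingEnd ℂ) (u false)).re,
        2 / b * (u true * (starRingEnd ℂ) (u false)).im,
        1 / b * (Complex.normSq (u false) - Complex.normSq (u true))] := by
    intro i
    have hn := hq i
    rw [EuclideanSpace.norm_eq, Real.sqrt_eq_iff_mul_self_eq_of_pos hb, Fin.sum_univ_three] at hn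
    simp only [Real.norm_eq_abs, sq_abs] at hn
    by_cases h : q i 2 = -b
    · have h0 : q i 0 = 0 := by rw [h] at hn; nlinarith [sq_nonneg (q i 1), sq_nonneg (q i 0)]
      have h1 : q i 1 = 0 := by rw [h] at hn; nlinarith [sq_nonneg (q i 1), sq_nonneg (q i 0)]
      refine ⟨fun γ => if γ then b else 0, by simp, ?_⟩
      ext k
      fin_cases k <;> simp [h0, h1, h]
      field_simp
    · have hlt : 0 < b + q i 2 := by
        have : -b ≤ q i 2 := by nlinarith [sq_nonneg (q i 0), sq_nonneg (q i 1)]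
        have : -b ≠ q i 2 := fun h' => h h'.symm
        have := lt_of_le_of_ne ‹-b ≤ q i 2› this
        linarith
      have hr : 0 < b * (b + q i 2) / 2 := by positivity
      set r := √(b * (b + q i 2) / 2) with hr'
      have hr2 : r ^ 2 = b * (b + q i 2) / 2 := Real.sq_sqrt hr.le
      have hrpos : 0 < r := Real.sqrt_pos.2 hr
      have hns : Complex.normSq ⟨b * q i 0 / (2 * r), b * q i 1 / (2 * r)⟩ = b * (b - q i 2) / 2 := by
        rw [Complex.normSq_mk]
        field_simp
        rw [hr2]
        linear_combination (-b) * hn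
      refine ⟨fun γ => if γ then ⟨b * q i 0 / (2 * r), b * q i 1 / (2 * r)⟩ else r, ?_, ?_⟩
      · simp only [← Complex.normSq_eq_norm_sq, if_true, hns, Bool.false_eq_true, if_false,
          Complex.normSq_ofReal, ← sq, hr2]
        ring
      · ext k
        fin_cases k
        · simp; field_simp
        · simp; field_simp
        · simp only [if_true, hns, Bool.false_eq_true, if_false, Complex.normSq_ofReal, ← sq, hr2]
          simp
          field_simp
          ring
  choose u hu hqu using key
  exact ⟨fun p => u p.1 p.2, hu, funext fun i => (hqu i).symm⟩

/-- The quotient of the product of three 2-spheres as a quotient of the product of 3-spheres. -/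
noncomputable def sphereQuotientModel {b : ℝ} (hb : 0 < b) : SphereModel b (SphereQuotient b) where
  pos := hb
  toFun y := Quotient.mk _ ⟨hopfMap b y, norm_hopfMap hb y.2⟩
  isQuotientMap := by
    have : CompactSpace (sphereLevel b) :=
      isCompact_iff_compactSpace.1 (isCompact_sphereLevel b hb.le)
    have hcont : Continuous fun y : sphereLevel b =>
        (⟨hopfMap b y, norm_hopfMap hb y.2⟩ : sphereCube b) :=
      ((contDiff_hopfMap b).continuous.comp continuous_subtype_val).subtype_mk _
    have hsurj : Function.Surjective fun y : sphereLevel b =>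
        (⟨hopfMap b y, norm_hopfMap hb y.2⟩ : sphereCube b) := by
      rintro ⟨q, hq⟩
      obtain ⟨y, hy, rfl⟩ := exists_hopfMap_eq hb hq
      exact ⟨⟨y, hy⟩, rfl⟩
    exact isQuotientMap_quotient_mk'.comp (IsQuotientMap.of_surjective_continuous hsurj hcont)
  eq_iff y y' := by
    have hmem : ∀ h : Fin 3 → ℤ,
        (fun p => goldenWeight (h p.1) p.2 * y.1 p) ∈ sphereLevel b := fun h i => by
      simpa only [norm_mul, Circle.norm_coe, one_mul] using y.2 i
    rw [Quotient.eq]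
    constructor
    · rintro ⟨t, ⟨h, rfl⟩, ht⟩
      have key := fun i => (hopfMap_eq_iff hb (hmem h) y'.2 i).1 <| by
        rw [hopfMap_goldenWeight]; exact (ht i).symm
      choose s hs using key
      exact ⟨s, h, fun i γ => by rw [hs i γ, mul_assoc]⟩
    · rintro ⟨s, h, hs⟩
      refine ⟨_, ⟨h, rfl⟩, fun i => ?_⟩
      have := (hopfMap_eq_iff hb (hmem h) y'.2 i).2 ⟨s i, fun γ => by rw [hs i γ, mul_assoc]⟩
      rw [hopfMap_goldenWeight] at this
      exact this.symm

theorem isInduced_sphereQuotientModel {b : ℝ} (hb : 0 < b) :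
    (sphereQuotientModel hb).quasifold.IsInduced (sphereForm b) :=
  (sphereQuotientModel hb).isInduced (contDiff_hopfMap b)
    (fun _ hy => ⟨norm_hopfMap hb hy, (sphereQuotientModel hb).ext_apply hy⟩)
    (fun _ hq => exists_hopfMap_eq hb hq)
    fun y hy u v hu hv => by
      rw [fderiv_hopfMap, fderiv_hopfMap, sphereForm_hopfMap hb hy hu hv]

/-! ### The reduced space of a rhombohedron -/

/-- The vectors `X` are the inward unit normal vectors `± n i` of the facets of the rhombohedron
with vertex `p`, edges `e` and heights `b²`, numbered by `idx`, and `c` are the corresponding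
coefficients. -/
structure IsBoxPresentation (b : ℝ) (p : E3) (n : Fin 3 → E3) (X : Fin 6 → E3) (c : Fin 6 → ℝ)
    (idx : Fin 6 ≃ Fin 3 × Bool) : Prop where
  normal_eq : ∀ j, X j = poleSign (idx j).2 • n (idx j).1
  coeff_eq : ∀ j, c j = if (idx j).2 then inner ℝ p (n (idx j).1)
    else -(inner ℝ p (n (idx j).1) + b ^ 2)

section Delzant

variable {b : ℝ} {p : E3} {e n : Fin 3 → E3} {X : Fin 6 → E3} {c : Fin 6 → ℝ}
  {idx : Fin 6 ≃ Fin 3 × Bool}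

lemma sum_equiv_prod_bool (idx : Fin 6 ≃ Fin 3 × Bool) {A : Type*} [AddCommMonoid A]
    (f : Fin 6 → A) :
    ∑ j, f j = ∑ i, (f (idx.symm (i, true)) + f (idx.symm (i, false))) := by
  rw [← Equiv.sum_comp idx.symm f, Fintype.sum_prod_type]
  simp only [Fintype.sum_bool]

lemma IsBoxPresentation.delzantMap_eq (hX : IsBoxPresentation b p n X c idx) (x : Fin 6 → ℝ) :
    delzantMap X x = ∑ i, (x (idx.symm (i, true)) - x (idx.symm (i, false))) • n i := by
  rw [delzantMap, Fintype.linearCombination_apply, sum_equiv_prod_bool idx]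
  refine Finset.sum_congr rfl fun i _ => ?_
  rw [hX.normal_eq, hX.normal_eq, Equiv.apply_symm_apply, Equiv.apply_symm_apply]
  simp only [poleSign, if_true, Bool.false_eq_true, if_false]
  module

lemma GoldenBox.inner_delzantMap (hbox : GoldenBox b e n) (hX : IsBoxPresentation b p n X c idx)
    (x : Fin 6 → ℝ) (i : Fin 3) : inner ℝ (e i) (delzantMap X x) =
      b ^ 2 * (x (idx.symm (i, true)) - x (idx.symm (i, false))) := by
  rw [hX.delzantMap_eq, inner_sum]
  simp [real_inner_smul_right, hbox.inner_eq]
  ring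

lemma sum_level_eq (hX : IsBoxPresentation b p n X c idx) (z : Fin 6 → ℂ) (x : Fin 6 → ℝ) :
    ∑ j, (‖z j‖ ^ 2 + c j) * x j = ∑ i,
      ((‖z (idx.symm (i, true))‖ ^ 2 + inner ℝ p (n i)) * x (idx.symm (i, true)) +
      (‖z (idx.symm (i, false))‖ ^ 2 - inner ℝ p (n i) - b ^ 2) * x (idx.symm (i, false))) := by
  rw [sum_equiv_prod_bool idx]
  refine Finset.sum_congr rfl fun i _ => ?_
  rw [hX.coeff_eq, hX.coeff_eq, Equiv.apply_symm_apply, Equiv.apply_symm_apply]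
  simp only [if_true, Bool.false_eq_true, if_false]
  ring

/-- The zero level set is a product of three 3-spheres. -/
lemma mem_delzantLevel_iff (hb : 0 < b) (hbox : GoldenBox b e n)
    (hX : IsBoxPresentation b p n X c idx) (z : Fin 6 → ℂ) :
    z ∈ delzantLevel X c ↔ z ∘ idx.symm ∈ sphereLevel b := by
  constructor
  · intro hz i
    have h1 := hz (fun j => if (idx j).1 = i then 1 else 0) <| by
      rw [hX.delzantMap_eq]
      simp
    rw [sum_level_eq hX] at h1
    simp only [Equiv.apply_symm_apply, mul_ite, mul_one, mul_zero] at h1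
    rw [Finset.sum_eq_single i (fun j _ hj => by simp [hj]) (by simp)] at h1
    simp only [if_true] at h1
    simp only [Function.comp_apply]
    linarith
  · intro hz x hx
    rw [sum_level_eq hX]
    refine Finset.sum_eq_zero fun i _ => ?_
    have h1 := hbox.inner_delzantMap hX x i
    rw [hx, inner_zero_right, eq_comm, mul_eq_zero] at h1
    have h2 : x (idx.symm (i, true)) = x (idx.symm (i, false)) :=
      sub_eq_zero.1 (h1.resolve_left (by positivity))
    have h3 := hz i
    simp only [Function.comp_apply] at h3
    rw [h2]
    linear_combination (x (idx.symm (i, false))) * h3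

/-- On the level set, the orbits of `N` are the orbits of the diagonal circles and the discrete
golden group. -/
lemma exists_mem_delzantGroup_iff (hb : 0 < b) (hbox : GoldenBox b e n)
    (hX : IsBoxPresentation b p n X c idx) (z w : Fin 6 → ℂ) :
    (∃ t ∈ delzantGroup quasilatticeQ X, w = torusAct t z) ↔
      GoldenOrbit (z ∘ idx.symm) (w ∘ idx.symm) := by
  constructor
  · rintro ⟨_, ⟨x, hx, rfl⟩, rfl⟩
    choose k l hkl using (hbox.mem_iff _).1 hx
    refine ⟨fun i => Circle.exp (2 * Real.pi * x (idx.symm (i, false))), l, fun i γ => ?_⟩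
    have h1 : x (idx.symm (i, true)) = k i + φ * l i + x (idx.symm (i, false)) := by
      have := (hbox.inner_delzantMap hX x i).symm.trans (hkl i)
      linarith [mul_left_cancel₀ (by positivity) this]
    cases γ
    · simp [torusAct, torusExp, goldenWeight]
    · simp only [Function.comp_apply, torusAct, torusExp, goldenWeight, if_true, goldenPhase]
      rw [h1, ← Circle.coe_mul, ← Circle.exp_add, add_assoc, exp_two_pi_int]
      congr 3
      ring
  · rintro ⟨s, h, hs⟩
    have harg : ∀ i, Circle.exp (2 * Real.pi * ((s i : ℂ).arg / (2 * Real.pi))) = s i := fun i => by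
      rw [mul_div_cancel₀ _ (by positivity)]
      exact Circle.exp_arg _
    let x : Fin 6 → ℝ := fun j => (s (idx j).1 : ℂ).arg / (2 * Real.pi) +
      if (idx j).2 then φ * h (idx j).1 else 0
    refine ⟨torusExp x, ⟨x, ?_, rfl⟩, ?_⟩
    · refine (hbox.mem_iff _).2 fun i => ⟨0, h i, ?_⟩
      rw [hbox.inner_delzantMap hX]
      simp [x]
    · funext j
      have := hs (idx j).1 (idx j).2
      simp only [Function.comp_apply, Prod.mk.eta, Equiv.symm_apply_apply] at this
      rw [this, torusAct]
      congr 1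
      simp only [torusExp, x, mul_add, Circle.exp_add, Circle.coe_mul, harg]
      congr 1
      cases (idx j).2 <;> simp [goldenWeight, goldenPhase]

/-- Renumbering the coordinates. -/
noncomputable def reindex (idx : Fin 6 ≃ Fin 3 × Bool) : (Fin 3 × Bool → ℂ) →L[ℝ] (Fin 6 → ℂ) :=
  ContinuousLinearMap.pi fun j => ContinuousLinearMap.proj (idx j)

lemma reindex_apply (idx : Fin 6 ≃ Fin 3 × Bool) (y : Fin 3 × Bool → ℂ) :
    reindex idx y = y ∘ idx := rfl

lemma reindex_comp_symm (idx : Fin 6 ≃ Fin 3 × Bool) (y : Fin 3 × Bool → ℂ) :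
    reindex idx y ∘ idx.symm = y := by
  funext q; simp [reindex_apply]

/-- The reduced space of a rhombohedron as a quotient of the product of 3-spheres. -/
noncomputable def delzantModel (hb : 0 < b) (hbox : GoldenBox b e n)
    (hX : IsBoxPresentation b p n X c idx) : SphereModel b (DelzantSpace quasilatticeQ X c) where
  pos := hb
  toFun y := Quotient.mk _ ⟨reindex idx y,
    (mem_delzantLevel_iff hb hbox hX _).2 (by rw [reindex_comp_symm]; exact y.2)⟩
  isQuotientMap := by
    have hmem : ∀ y : sphereLevel b, reindex idx y ∈ delzantLevel X c := fun y =>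
      (mem_delzantLevel_iff hb hbox hX _).2 (by rw [reindex_comp_symm]; exact y.2)
    let f : sphereLevel b ≃ₜ delzantLevel X c :=
      { toFun := fun y => ⟨reindex idx y, hmem y⟩
        invFun := fun z => ⟨z.1 ∘ idx.symm, (mem_delzantLevel_iff hb hbox hX _).1 z.2⟩
        left_inv := fun y => Subtype.ext (reindex_comp_symm idx _)
        right_inv := fun z => Subtype.ext (by funext j; simp [reindex_apply])
        continuous_toFun := ((reindex idx).continuous.comp continuous_subtype_val).subtype_mk _
        continuous_invFun := by
          refine Continuous.subtype_mk (continuous_pi fun q => ?_) _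
          exact (continuous_apply _).comp continuous_subtype_val }
    exact isQuotientMap_quotient_mk'.comp f.isQuotientMap
  eq_iff y y' := by
    rw [Quotient.eq]
    refine (exists_mem_delzantGroup_iff hb hbox hX _ _).trans ?_
    rw [reindex_comp_symm, reindex_comp_symm]

variable (hb : 0 < b) (hbox : GoldenBox b e n) (hX : IsBoxPresentation b p n X c idx)

lemma delzantModel_ext (z : delzantLevel X c) :
    (delzantModel hb hbox hX).ext (z.1 ∘ idx.symm) = Quotient.mk _ z := by
  rw [(delzantModel hb hbox hX).ext_apply ((mem_delzantLevel_iff hb hbox hX _).1 z.2)]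
  refine congrArg (Quotient.mk _) (Subtype.ext ?_)
  funext j
  simp [reindex_apply]

theorem isInduced_delzantModel :
    (delzantModel hb hbox hX).quasifold.IsInduced standardForm := by
  have hmem : ∀ y ∈ sphereLevel b, reindex idx y ∈ delzantLevel X c := fun y hy =>
    (mem_delzantLevel_iff hb hbox hX _).2 (by rw [reindex_comp_symm]; exact hy)
  refine (delzantModel hb hbox hX).isInduced (reindex idx).contDiff
    (fun y hy => ⟨hmem y hy, (delzantModel hb hbox hX).ext_apply hy⟩) (fun z hz => ?_)
    fun y _ u v _ _ => ?_
  · exact ⟨z ∘ idx.symm, (mem_delzantLevel_iff hb hbox hX z).1 hz,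
      by funext j; simp [reindex_apply]⟩
  · rw [ContinuousLinearMap.fderiv, standardForm, ← Equiv.sum_comp idx]
    rfl

/-- The action and the moment mapping of the model are those induced by the action of `T^6` and
by `J`. -/
theorem delzantModel_hamiltonianAction :
    (∀ (x : Fin 6 → ℝ) (z w : delzantLevel X c), (w : Fin 6 → ℂ) = torusAct (torusExp x) z →
      ((delzantModel hb hbox hX).hamiltonianAction p hbox).act
        (QuotientAddGroup.mk (delzantMap X x)) (Quotient.mk _ z) = Quotient.mk _ w) ∧
    ∀ (z : delzantLevel X c) (j : Fin 6),
      inner ℝ (((delzantModel hb hbox hX).hamiltonianAction p hbox).moment (Quotient.mk _ z))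
        (X j) = ‖(z : Fin 6 → ℂ) j‖ ^ 2 + c j := by
  have hb2 : b ^ 2 ≠ 0 := by positivity
  have hlev := fun z : delzantLevel X c => (mem_delzantLevel_iff hb hbox hX z.1).1 z.2
  constructor
  · intro x z w hw
    rw [← delzantModel_ext hb hbox hX z, ← delzantModel_ext hb hbox hX w,
      SphereModel.hamiltonianAction_act _ p hbox _ (hlev z),
      SphereModel.ext_eq_iff _ (turn_mem (hlev z)) (hlev w)]
    refine ⟨fun i => Circle.exp (2 * Real.pi * x (idx.symm (i, false))), 0, fun i γ => ?_⟩
    rw [hw]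
    cases γ
    · simp [torusAct, torusExp, goldenWeight, turn]
    · simp only [Function.comp_apply, torusAct, torusExp, goldenWeight, if_true, turn, boxPhase,
        hbox.inner_delzantMap hX, mul_div_cancel_left₀ _ hb2, Pi.zero_apply, goldenPhase_zero,
        Circle.coe_one, mul_one]
      rw [← mul_assoc, ← Circle.coe_mul, ← Circle.exp_add]
      congr 3
      ring
  · intro z j
    have hz := hlev z (idx j).1
    rw [← delzantModel_ext hb hbox hX z, SphereModel.hamiltonianAction_moment _ p hbox (hlev z),
      boxMoment, hX.normal_eq, hX.coeff_eq, real_inner_smul_right, inner_add_left, sum_inner]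
    simp only [real_inner_smul_left, hbox.inner_eq, mul_ite, mul_zero, Finset.sum_ite_eq',
      Finset.mem_univ, if_true, div_mul_cancel₀ _ hb2, Function.comp_apply] at hz ⊢
    have hj : idx.symm ((idx j).1, (idx j).2) = j := idx.symm_apply_apply j
    cases hγ : (idx j).2 <;> rw [hγ] at hj
    · rw [hj] at hz
      simp only [poleSign, Bool.false_eq_true, if_false]
      linarith
    · rw [hj]
      simp only [poleSign, if_true]
      ring

end Delzant

/-! ### Presentations of a rhombohedron by unit normal vectors -/

section Presentation

variable {b : ℝ} {p : E3} {e n : Fin 3 → E3} {X : Fin 6 → E3} {c : Fin 6 → ℝ}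

lemma linearIndependent_of_dual (h : ∀ i j, inner ℝ (e i) (n j) = if i = j then b ^ 2 else 0)
    (hb : 0 < b) : LinearIndependent ℝ e := by
  rw [Fintype.linearIndependent_iff]
  intro g hg i
  have h1 := congrArg (fun v => inner ℝ v (n i)) hg
  simp only [sum_inner, real_inner_smul_left, h, inner_zero_left, mul_ite, mul_zero,
    Finset.sum_ite_eq', Finset.mem_univ, if_true] at h1
  exact (mul_eq_zero.1 h1).resolve_right (by positivity)

/-- The coordinates in the basis `e` are given by the dual basis `n i / b²`. -/
lemma eq_sum_of_dual (h : ∀ i j, inner ℝ (e i) (n j) = if i = j then b ^ 2 else 0) (hb : 0 < b)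
    (v : E3) : v = ∑ i, (inner ℝ v (n i) / b ^ 2) • e i := by
  let B := basisOfLinearIndependentOfCardEqFinrank (linearIndependent_of_dual h hb) (by simp)
  have hB : ∑ i, B.repr v i • e i = v := by
    simpa [B] using B.sum_repr v
  have h1 : ∀ i, inner ℝ v (n i) / b ^ 2 = B.repr v i := by
    intro i
    have h2 := congrArg (fun v => inner ℝ v (n i)) hB
    simp only [sum_inner, real_inner_smul_left, h, mul_ite, mul_zero,
      Finset.sum_ite_eq', Finset.mem_univ, if_true] at h2
    rw [← h2, mul_div_cancel_right₀ _ (by positivity)]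
  simp only [h1, hB]

lemma GoldenBox.inner_vertex_add (hbox : GoldenBox b e n) (t : Fin 3 → ℝ) (i : Fin 3) :
    inner ℝ (p + ∑ k, t k • e k) (n i) = inner ℝ p (n i) + t i * b ^ 2 := by
  rw [inner_add_left, sum_inner]
  simp [real_inner_smul_left, hbox.inner_eq]

lemma mem_rhombohedron {μ : E3} : μ ∈ rhombohedron p e ↔
    ∃ t : Fin 3 → ℝ, (∀ i, 0 ≤ t i ∧ t i ≤ 1) ∧ μ = p + ∑ i, t i • e i := by
  constructor
  · rintro ⟨_, ⟨t, ⟨h0, h1⟩, rfl⟩, rfl⟩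
    exact ⟨t, fun i => ⟨h0 i, h1 i⟩, rfl⟩
  · rintro ⟨t, ht, rfl⟩
    exact ⟨_, ⟨t, ⟨fun i => (ht i).1, fun i => (ht i).2⟩, rfl⟩, rfl⟩

lemma GoldenBox.mem_rhombohedron_iff (hbox : GoldenBox b e n) (hb : 0 < b) {μ : E3} :
    μ ∈ rhombohedron p e ↔
      ∀ i, inner ℝ p (n i) ≤ inner ℝ μ (n i) ∧ inner ℝ μ (n i) ≤ inner ℝ p (n i) + b ^ 2 := by
  have hb2 : 0 < b ^ 2 := by positivity
  rw [mem_rhombohedron]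
  constructor
  · rintro ⟨t, ht, rfl⟩ i
    rw [hbox.inner_vertex_add]
    constructor <;> nlinarith [ht i]
  · intro h
    refine ⟨fun i => inner ℝ (μ - p) (n i) / b ^ 2, fun i => ⟨?_, ?_⟩, ?_⟩
    · refine div_nonneg ?_ hb2.le
      rw [inner_sub_left]
      linarith [h i]
    · refine (div_le_one hb2).2 ?_
      rw [inner_sub_left]
      linarith [h i]
    · rw [← eq_sum_of_dual hbox.inner_eq hb, add_sub_cancel]

theorem GoldenBox.exists_isUnitPresentation (hbox : GoldenBox b e n) (hb : 0 < b) (p : E3) :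
    ∃ X c, IsUnitPresentation (rhombohedron p e) X c := by
  let idx : Fin 6 ≃ Fin 3 × Bool := Fintype.equivOfCardEq (by simp)
  refine ⟨fun j => poleSign (idx j).2 • n (idx j).1, fun j => if (idx j).2 then
    inner ℝ p (n (idx j).1) else -(inner ℝ p (n (idx j).1) + b ^ 2), fun j => ?_, ?_⟩
  · rw [norm_smul, hbox.norm_normal]
    cases (idx j).2 <;> simp [poleSign]
  · ext μ
    rw [hbox.mem_rhombohedron_iff hb]
    constructor
    · intro h j
      have hj := h (idx j).1
      change (if (idx j).2 then inner ℝ p (n (idx j).1) else -(inner ℝ p (n (idx j).1) + b ^ 2)) ≤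
        inner ℝ μ (poleSign (idx j).2 • n (idx j).1)
      rw [real_inner_smul_right]
      generalize (idx j).1 = i at hj ⊢
      cases (idx j).2
      · simp only [poleSign, Bool.false_eq_true, if_false]; linarith
      · simp only [poleSign, if_true]; linarith
    · intro h i
      have h1 := h (idx.symm (i, true))
      have h2 := h (idx.symm (i, false))
      simp only [Equiv.apply_symm_apply, poleSign, if_true, Bool.false_eq_true, if_false,
        real_inner_smul_right] at h1 h2
      constructor <;> linarith

/-- The facet `(i, γ)` of the rhombohedron is supported by one of the half-spaces of any
presentation: one of them has to be sharp at the centre of the facet. -/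
lemma GoldenBox.exists_facet (hbox : GoldenBox b e n) (hb : 0 < b)
    (hX : IsUnitPresentation (rhombohedron p e) X c) (q : Fin 3 × Bool) :
    ∃ j, X j = poleSign q.2 • n q.1 ∧
      c j = if q.2 then inner ℝ p (n q.1) else -(inner ℝ p (n q.1) + b ^ 2) := by
  obtain ⟨i, γ⟩ := q
  have hb2 : 0 < b ^ 2 := by positivity
  have hmem : ∀ t : Fin 3 → ℝ, p + ∑ k, t k • e k ∈ rhombohedron p e ↔
      ∀ k, 0 ≤ t k ∧ t k ≤ 1 := by
    intro t
    rw [hbox.mem_rhombohedron_iff hb]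
    refine forall_congr' fun k => ?_
    rw [hbox.inner_vertex_add]
    constructor
    · rintro ⟨h1, h2⟩
      constructor <;> nlinarith
    · rintro ⟨h1, h2⟩
      constructor <;> nlinarith
  have hpres : ∀ μ, μ ∈ rhombohedron p e ↔ ∀ j, c j ≤ inner ℝ μ (X j) := fun μ => by
    rw [hX.2]; rfl
  -- the parameters of the centre of the facet
  let t₀ : Fin 3 → ℝ := fun k => if k = i then (if γ then 0 else 1) else 1 / 2
  let x := p + ∑ k, t₀ k • e k
  have hupd : ∀ (k : Fin 3) (s : ℝ), x + s • e k = p + ∑ l, (t₀ l + if l = k then s else 0) • e l := by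
    intro k s
    simp only [x, add_smul, Finset.sum_add_distrib, ite_smul, zero_smul, Finset.sum_ite_eq',
      Finset.mem_univ, if_true, add_assoc]
  have ht₀ : ∀ k, 0 ≤ t₀ k ∧ t₀ k ≤ 1 := by
    intro k
    simp only [t₀]
    split_ifs <;> norm_num
  have hx : ∀ j, c j ≤ inner ℝ x (X j) := (hpres x).1 ((hmem t₀).2 ht₀)
  obtain ⟨j, hj⟩ : ∃ j, inner ℝ x (X j) = c j := by
    by_contra! hne
    have hev : ∀ᶠ s : ℝ in 𝓝[>] 0, ∀ j, c j < inner ℝ (x + (-(poleSign γ) * s) • e i) (X j) := by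
      refine Filter.eventually_all.2 fun j => ?_
      have hcont : Continuous fun s : ℝ => inner ℝ (x + (-(poleSign γ) * s) • e i) (X j) := by
        fun_prop
      refine (hcont.tendsto 0).mono_left nhdsWithin_le_nhds |>.eventually_const_lt ?_
      simpa using lt_of_le_of_ne (hx j) (hne j).symm
    obtain ⟨s, hs, hs0⟩ := (hev.and self_mem_nhdsWithin).exists
    have h1 := (hpres _).2 fun j => (hs j).le
    rw [hupd, hmem] at h1
    have h2 := h1 i
    have hs0' : 0 < s := hs0
    simp only [t₀, if_true] at h2
    cases γ
    · simp only [poleSign, Bool.false_eq_true, if_false] at h2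
      linarith [h2.2]
    · simp only [poleSign, if_true] at h2
      linarith [h2.1]
  have hdir : ∀ (k : Fin 3) (s : ℝ), (∀ l, 0 ≤ t₀ l + (if l = k then s else 0) ∧
      t₀ l + (if l = k then s else 0) ≤ 1) → 0 ≤ s * inner ℝ (e k) (X j) := by
    intro k s h
    have h1 := (hpres _).1 ((hmem _).2 h) j
    rw [← hupd, inner_add_left, real_inner_smul_left, hj] at h1
    linarith
  have horth : ∀ k, k ≠ i → inner ℝ (e k) (X j) = 0 := by
    intro k hk
    have h1 := hdir k (1 / 2) fun l => by
      simp only [t₀]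
      split_ifs <;> norm_num
      simp_all
    have h2 := hdir k (-1 / 2) fun l => by
      simp only [t₀]
      split_ifs <;> norm_num
      simp_all
    linarith
  have hsign : 0 ≤ poleSign γ * inner ℝ (e i) (X j) := by
    refine hdir i (poleSign γ) fun l => ?_
    simp only [t₀]
    cases γ <;> simp only [poleSign] <;> split_ifs <;> norm_num at *
  -- so `X j` is a multiple of `n i`
  have hXj : X j = (inner ℝ (e i) (X j) / b ^ 2) • n i := by
    refine ext_inner_left ℝ fun v => ?_
    rw [eq_sum_of_dual hbox.inner_eq hb v, sum_inner, sum_inner]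
    refine Finset.sum_congr rfl fun k _ => ?_
    rw [real_inner_smul_left, real_inner_smul_left, real_inner_smul_right, hbox.inner_eq]
    by_cases hk : k = i
    · subst hk
      rw [if_pos rfl, div_mul_cancel₀ _ hb2.ne']
    · rw [if_neg hk, horth k hk, mul_zero, mul_zero, mul_zero]
  have hnorm := hX.1 j
  rw [hXj, norm_smul, hbox.norm_normal, mul_one, Real.norm_eq_abs] at hnorm
  have hcoef : inner ℝ (e i) (X j) / b ^ 2 = poleSign γ := by
    rcases (abs_eq zero_le_one).1 hnorm with h | h <;>
      rw [div_eq_iff hb2.ne'] at h <;> rw [div_eq_iff hb2.ne'] <;> rw [h] at hsign ⊢ <;>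
      cases γ <;> simp [poleSign] at hsign ⊢ <;> linarith
  rw [hcoef] at hXj
  refine ⟨j, hXj, ?_⟩
  rw [← hj, hXj, real_inner_smul_right, hbox.inner_vertex_add]
  cases γ <;> simp [poleSign, t₀]

/-- Up to numbering, a presentation of a rhombohedron by six unit normal vectors is unique. -/
theorem GoldenBox.exists_isBoxPresentation (hbox : GoldenBox b e n) (hb : 0 < b)
    (hX : IsUnitPresentation (rhombohedron p e) X c) :
    ∃ idx, IsBoxPresentation b p n X c idx := by
  choose J hJX hJc using hbox.exists_facet hb hX
  have hinj : Function.Injective J := by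
    intro q q' h
    have h1 : poleSign q.2 • n q.1 = poleSign q'.2 • n q'.1 := by rw [← hJX, ← hJX, h]
    have h2 := congrArg (inner ℝ (e q.1)) h1
    rw [real_inner_smul_right, real_inner_smul_right, hbox.inner_eq, hbox.inner_eq, if_pos rfl] at h2
    have hb2 : 0 < b ^ 2 := by positivity
    obtain ⟨i, γ⟩ := q
    obtain ⟨i', γ'⟩ := q'
    by_cases hi : i = i'
    · subst hi
      cases γ <;> cases γ' <;> simp [poleSign] at h2 ⊢ <;> nlinarith
    · rw [if_neg hi] at h2
      cases γ <;> simp [poleSign] at h2 <;> nlinarith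
  have hbij : Function.Bijective J :=
    (Fintype.bijective_iff_injective_and_card J).2 ⟨hinj, by simp⟩
  refine ⟨(Equiv.ofBijective J hbij).symm, fun j => ?_, fun j => ?_⟩
  · obtain ⟨q, rfl⟩ := hbij.2 j
    rw [Equiv.ofBijective_symm_apply_apply, hJX]
  · obtain ⟨q, rfl⟩ := hbij.2 j
    rw [Equiv.ofBijective_symm_apply_apply, hJc]

lemma GoldenBox.normal_mem (hbox : GoldenBox b e n) (i : Fin 3) : n i ∈ quasilatticeQ := by
  rw [hbox.mem_iff]
  intro j
  rw [hbox.inner_eq]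
  refine ⟨if j = i then 1 else 0, 0, ?_⟩
  split_ifs <;> simp

/-- The Delzant construction, applied to a rhombohedron with a golden box structure, gives the
quasifold of any sphere model of the same radius. -/
theorem GoldenBox.delzantGives (hbox : GoldenBox b e n) {M : Type} [TopologicalSpace M]
    (ρ : SphereModel b M) (p : E3) : DelzantGives (rhombohedron p e) ρ.quasifold := by
  have hb := ρ.pos
  refine ⟨hbox.exists_isUnitPresentation hb p, fun X c hX => ?_⟩
  obtain ⟨idx, hidx⟩ := hbox.exists_isBoxPresentation hb hX
  let D := delzantModel hb hbox hidx
  obtain ⟨hact, hmom⟩ := delzantModel_hamiltonianAction hb hbox hidx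
  refine ⟨fun j => ?_, D.compactSpace, D.connectedSpace, D.quasifold,
    isInduced_delzantModel hb hbox hidx, D.symplectomorphic ρ, D.hamiltonianAction p hbox, hact,
    hmom, D.effective p hbox, D.range_moment p hbox⟩
  rw [hidx.normal_eq]
  have := hbox.normal_mem (idx j).1
  cases (idx j).2
  · simpa [poleSign] using this
  · simpa [poleSign] using this

end Presentation

/-! ### The quasilattice and golden boxes -/

/-- The ring `ℤ[φ]`. -/
def goldenInt : Subring ℝ where
  carrier := {x | ∃ k l : ℤ, x = k + φ * l}
  zero_mem' := ⟨0, 0, by simp⟩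
  one_mem' := ⟨1, 0, by simp⟩
  add_mem' := by
    rintro _ _ ⟨k, l, rfl⟩ ⟨k', l', rfl⟩
    exact ⟨k + k', l + l', by push_cast; ring⟩
  neg_mem' := by
    rintro _ ⟨k, l, rfl⟩
    exact ⟨-k, -l, by push_cast; ring⟩
  mul_mem' := by
    rintro _ _ ⟨k, l, rfl⟩ ⟨k', l', rfl⟩
    refine ⟨k * k' + l * l', k * l' + l * k' + l * l', ?_⟩
    push_cast
    linear_combination (l * l' : ℝ) * Real.goldenRatio_sq

lemma mem_goldenInt {x : ℝ} : x ∈ goldenInt ↔ ∃ k l : ℤ, x = k + φ * l := Iff.rfl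

lemma goldenRatio_mem_goldenInt : φ ∈ goldenInt := ⟨0, 1, by simp⟩

/-- The signs of the inner products of the vectors `V_i`. -/
def signV : Fin 6 → Fin 6 → ℤ :=
  ![![0, 1, 1, 1, -1, 1], ![1, 0, 1, 1, 1, -1], ![1, 1, 0, -1, 1, 1],
    ![1, 1, -1, 0, -1, -1], ![-1, 1, 1, -1, 0, -1], ![1, -1, 1, -1, -1, 0]]

/-- The vectors `V_i` span six equiangular lines. -/
lemma inner_vecV (i j : Fin 6) :
    inner ℝ (vecV i) (vecV j) = if i = j then 3 - φ else signV i j * (φ - 1) := by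
  have h := Real.goldenRatio_sq
  fin_cases i <;> fin_cases j <;>
    simp only [vecV, signV, PiLp.inner_apply, Fin.sum_univ_three] <;> simp <;>
    generalize φ = g at h ⊢ <;> linarith

lemma signV_eq {i j : Fin 6} (h : i ≠ j) : signV i j = 1 ∨ signV i j = -1 := by
  revert i j; decide

lemma inner_vecV_vecU_mem (k j : Fin 6) : inner ℝ (vecV k) (vecU j) ∈ goldenInt := by
  have h := Real.goldenRatio_sq
  rw [mem_goldenInt]
  fin_cases k <;> fin_cases j <;>
    simp only [vecV, vecU, PiLp.inner_apply, Fin.sum_univ_three] <;> simp <;>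
    generalize φ = g at h ⊢ <;>
    first
    | exact ⟨0, 0, by push_cast; linarith⟩
    | exact ⟨1, 0, by push_cast; linarith⟩
    | exact ⟨-1, 0, by push_cast; linarith⟩
    | exact ⟨-1, 1, by push_cast; linarith⟩

/-- `Q` is the dual, over `ℤ[φ]`, of the module spanned by the vectors `V_k`. -/
lemma mem_quasilatticeQ_iff (ξ : E3) :
    ξ ∈ quasilatticeQ ↔ ∀ k, inner ℝ (vecV k) ξ ∈ goldenInt := by
  have h := Real.goldenRatio_sq
  constructor
  · intro hξ k
    refine AddSubgroup.closure_induction (p := fun ξ _ => inner ℝ (vecV k) ξ ∈ goldenInt)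
      ?_ ?_ ?_ ?_ hξ
    · rintro _ ⟨j, rfl⟩
      exact inner_vecV_vecU_mem k j
    · rw [inner_zero_right]; exact zero_mem _
    · intro x y _ _ hx hy
      rw [inner_add_right]; exact add_mem hx hy
    · intro x _ hx
      rw [inner_neg_right]; exact neg_mem hx
  · intro hξ
    have hU : ∀ j, vecU j ∈ quasilatticeQ := fun j => AddSubgroup.subset_closure ⟨j, rfl⟩
    -- `U_6`, `U_4`, `U_5` is the basis dual to `V_1`, `V_2`, `V_3`
    have hexp : ξ = (inner ℝ (vecV 0) ξ : ℝ) • vecU 5 + (inner ℝ (vecV 1) ξ : ℝ) • vecU 3 +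
        (inner ℝ (vecV 2) ξ : ℝ) • vecU 4 := by
      ext i
      fin_cases i <;> simp [vecV, vecU, PiLp.inner_apply, Fin.sum_univ_three] <;>
        generalize φ = g at h ⊢
      · linear_combination (-(ξ 0 + ξ 2) / 2) * h
      · linear_combination (-(ξ 0 + ξ 1) / 2) * h
      · linear_combination (-(ξ 1 + ξ 2) / 2) * h
    have h5 : φ • vecU 5 = vecU 0 - vecU 3 - vecU 4 + vecU 5 := by
      ext i
      fin_cases i <;> simp [vecU] <;> generalize φ = g at h ⊢ <;> linarith
    have h3 : φ • vecU 3 = vecU 1 - vecU 4 - vecU 5 + vecU 3 := by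
      ext i
      fin_cases i <;> simp [vecU] <;> generalize φ = g at h ⊢ <;> linarith
    have h4 : φ • vecU 4 = vecU 2 - vecU 5 - vecU 3 + vecU 4 := by
      ext i
      fin_cases i <;> simp [vecU] <;> generalize φ = g at h ⊢ <;> linarith
    have hmul : ∀ {v : E3} {x : ℝ}, v ∈ quasilatticeQ → φ • v ∈ quasilatticeQ → x ∈ goldenInt →
        x • v ∈ quasilatticeQ := by
      rintro v _ hv hφ ⟨k, l, rfl⟩
      have : ((k : ℝ) + φ * l) • v = k • v + l • (φ • v) := by
        rw [← Int.cast_smul_eq_zsmul ℝ k, ← Int.cast_smul_eq_zsmul ℝ l]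
        module
      rw [this]
      exact add_mem (zsmul_mem hv k) (zsmul_mem hφ l)
    rw [hexp]
    refine add_mem (add_mem (hmul (hU 5) ?_ (hξ 0)) (hmul (hU 3) ?_ (hξ 1))) (hmul (hU 4) ?_ (hξ 2))
    · rw [h5]; exact add_mem (sub_mem (sub_mem (hU 0) (hU 3)) (hU 4)) (hU 5)
    · rw [h3]; exact add_mem (sub_mem (sub_mem (hU 1) (hU 4)) (hU 5)) (hU 3)
    · rw [h4]; exact add_mem (sub_mem (sub_mem (hU 2) (hU 5)) (hU 3)) (hU 4)

/-! ### Rhombohedra with icosahedral edges -/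

/-- The twelve vectors `± V_k`, the vertices of an icosahedron. -/
def IsIcosahedral (v : E3) : Prop := ∃ k, v = vecV k ∨ v = -vecV k

/-- Three vectors of length `σ` whose pairwise inner products are those of two of the `± V_k`: the
edge vectors of a golden rhombohedron, oblate or prolate. -/
structure IsGoldenFrame (e : Fin 3 → E3) : Prop where
  inner_self : ∀ i, inner ℝ (e i) (e i) = 3 - φ
  inner_eq : ∀ i j, i ≠ j → inner ℝ (e i) (e j) = φ - 1 ∨ inner ℝ (e i) (e j) = -(φ - 1)

lemma IsIcosahedral.neg {v : E3} (hv : IsIcosahedral v) : IsIcosahedral (-v) := by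
  obtain ⟨k, h | h⟩ := hv
  · exact ⟨k, .inr (by rw [h])⟩
  · exact ⟨k, .inl (by rw [h, neg_neg])⟩

lemma IsIcosahedral.inner_self {v : E3} (hv : IsIcosahedral v) : inner ℝ v v = 3 - φ := by
  obtain ⟨k, rfl | rfl⟩ := hv <;> simp only [inner_neg_neg, inner_vecV, if_true]

/-- An icosahedral vector is one of the edge vectors, up to sign, or makes the golden angle with
all of them. -/
lemma IsIcosahedral.inner_vecV {v : E3} (hv : IsIcosahedral v) (k : Fin 6) :
    (vecV k = v ∨ vecV k = -v) ∨
      ∃ t : ℤ, (t = 1 ∨ t = -1) ∧ inner ℝ (vecV k) v = t * (φ - 1) := by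
  obtain ⟨l, hl⟩ := hv
  by_cases hkl : k = l
  · subst hkl
    left
    rcases hl with rfl | rfl
    · exact .inl rfl
    · exact .inr (neg_neg _).symm
  · right
    rcases hl with rfl | rfl
    · exact ⟨signV k l, signV_eq hkl, by rw [_root_.inner_vecV, if_neg hkl]⟩
    · refine ⟨-signV k l, ?_, by rw [inner_neg_right, _root_.inner_vecV, if_neg hkl]; push_cast; ring⟩
      rcases signV_eq hkl with h | h <;> simp [h]

/-- If the height is a unit of `ℤ[φ]` and the normals pair with all `V_k` to elements of `ℤ[φ]`, then
`e` spans the same module over `ℤ[φ]` as the `V_k`, and `Q` is its dual. -/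
lemma GoldenBox.of_dual {b : ℝ} {e n : Fin 3 → E3} (hb : 0 < b) (he : ∀ i, IsIcosahedral (e i))
    (hnorm : ∀ i, inner ℝ (n i) (n i) = 1)
    (hdual : ∀ i j, inner ℝ (e i) (n j) = if i = j then b ^ 2 else 0)
    (hV : ∀ k i, inner ℝ (vecV k) (n i) ∈ goldenInt)
    (hinv : (b ^ 2)⁻¹ ∈ goldenInt) : GoldenBox b e n where
  norm_normal i := by
    have := hnorm i
    rw [real_inner_self_eq_norm_sq] at this
    exact (pow_eq_one_iff_of_nonneg (norm_nonneg _) two_ne_zero).1 this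
  inner_eq := hdual
  mem_iff ξ := by
    have hb0 : b ^ 2 ≠ 0 := by positivity
    rw [mem_quasilatticeQ_iff]
    constructor
    · intro h i
      have h1 : inner ℝ (e i) ξ ∈ goldenInt := by
        obtain ⟨k, hk | hk⟩ := he i
        · rw [hk]; exact h k
        · rw [hk, inner_neg_left]; exact neg_mem (h k)
      obtain ⟨k, l, hkl⟩ := mem_goldenInt.1 (mul_mem hinv h1)
      exact ⟨k, l, by rw [← hkl, mul_inv_cancel_left₀ hb0]⟩
    · intro h k
      rw [eq_sum_of_dual hdual hb (vecV k), sum_inner]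
      refine sum_mem fun i _ => ?_
      obtain ⟨l, m, hlm⟩ := h i
      rw [real_inner_smul_left, hlm, div_mul_eq_mul_div, mul_comm (b ^ 2), ← mul_assoc,
        mul_div_cancel_right₀ _ hb0]
      exact mul_mem (hV k i) ⟨l, m, rfl⟩

section Boxes

variable {e : Fin 3 → E3}

lemma exists_two_mul_eq {t : Fin 3 → ℤ} (ht : ∀ i, t i = 1 ∨ t i = -1) (i : Fin 3) :
    ∃ m, t i + (t 0 + t 1 + t 2) = 2 * m := by
  have h0 := ht 0
  have h1 := ht 1
  have h2 := ht 2
  refine ⟨(t i + (t 0 + t 1 + t 2)) / 2, ?_⟩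
  fin_cases i <;> simp only [Fin.zero_eta, Fin.mk_one, Fin.reduceFinMk] <;> omega

/-- The vectors `α e_i + β (e_1 + e_2 + e_3)` pair with the `V_k` to elements of `ℤ[φ]` if they do
so with the `e_j` and for all sign patterns. -/
lemma inner_vecV_mem_goldenInt (he : ∀ i, IsIcosahedral (e i)) {α β b : ℝ}
    (hb2 : b ^ 2 ∈ goldenInt)
    (hdual : ∀ i j, inner ℝ (e i) (α • e j + β • (e 0 + e 1 + e 2)) = if i = j then b ^ 2 else 0)
    (hsign : ∀ (t s : ℤ), (∃ m, t + s = 2 * m) → (φ - 1) * (α * t + β * s) ∈ goldenInt)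
    (k : Fin 6) (i : Fin 3) :
    inner ℝ (vecV k) (α • e i + β • (e 0 + e 1 + e 2)) ∈ goldenInt := by
  by_cases h : ∃ j, vecV k = e j ∨ vecV k = -e j
  · obtain ⟨j, hj⟩ := h
    have h1 : inner ℝ (e j) (α • e i + β • (e 0 + e 1 + e 2)) ∈ goldenInt := by
      rw [hdual]
      split_ifs
      · exact hb2
      · exact zero_mem _
    rcases hj with hj | hj <;> rw [hj]
    · exact h1
    · rw [inner_neg_left]; exact neg_mem h1
  · have h1 := fun j => ((he j).inner_vecV k).resolve_left fun h' => h ⟨j, h'⟩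
    choose t ht hin using h1
    have h2 := hsign (t i) (t 0 + t 1 + t 2) (exists_two_mul_eq ht i)
    have h3 : inner ℝ (vecV k) (α • e i + β • (e 0 + e 1 + e 2)) =
        (φ - 1) * (α * (t i : ℤ) + β * (t 0 + t 1 + t 2 : ℤ)) := by
      simp only [inner_add_right, real_inner_smul_right, hin]
      push_cast
      ring
    rw [h3]
    exact h2

lemma inner_dual_eq (he : ∀ i, IsIcosahedral (e i)) {g α β B : ℝ}
    (hg : ∀ i j, i ≠ j → inner ℝ (e i) (e j) = g)
    (h1 : α * (3 - φ) + β * (3 - φ + 2 * g) = B) (h2 : α * g + β * (3 - φ + 2 * g) = 0)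
    (i j : Fin 3) :
    inner ℝ (e i) (α • e j + β • (e 0 + e 1 + e 2)) = if i = j then B else 0 := by
  have hsum : inner ℝ (e i) (e 0 + e 1 + e 2) = 3 - φ + 2 * g := by
    rw [inner_add_right, inner_add_right]
    have h01 := hg 0 1 (by decide)
    have h02 := hg 0 2 (by decide)
    have h12 := hg 1 2 (by decide)
    fin_cases i <;> simp only [Fin.zero_eta, Fin.mk_one, Fin.reduceFinMk, (he _).inner_self]
    · rw [h01, h02]; ring
    · rw [real_inner_comm, h01, h12]; ring
    · rw [real_inner_comm, h02, real_inner_comm, h12]; ring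
  rw [inner_add_right, real_inner_smul_right, real_inner_smul_right, hsum]
  split_ifs with h
  · subst h; rw [(he _).inner_self, h1]
  · rw [hg i j h, h2]

lemma inner_self_dual {α β B : ℝ}
    (hdual : ∀ i j, inner ℝ (e i) (α • e j + β • (e 0 + e 1 + e 2)) = if i = j then B else 0)
    (i : Fin 3) :
    inner ℝ (α • e i + β • (e 0 + e 1 + e 2)) (α • e i + β • (e 0 + e 1 + e 2)) = (α + β) * B := by
  rw [inner_add_left, real_inner_smul_left, real_inner_smul_left, inner_add_left, inner_add_left,
    hdual, hdual, hdual, hdual]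
  fin_cases i <;> simp <;> ring

/-- Prolate rhombohedra with icosahedral edges have height `1`. -/
theorem exists_goldenBox_prolate (he : ∀ i, IsIcosahedral (e i))
    (hg : ∀ i j, i ≠ j → inner ℝ (e i) (e j) = φ - 1) : ∃ n, GoldenBox 1 e n := by
  have h := Real.goldenRatio_sq
  have hdual := inner_dual_eq (α := (φ + 1) / 2) (β := -(φ - 1) / 2) (B := 1 ^ 2) he hg
    (by generalize φ = g at h ⊢; linarith) (by generalize φ = g at h ⊢; linarith)
  refine ⟨_, GoldenBox.of_dual one_pos he (fun i => ?_) hdual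
    (inner_vecV_mem_goldenInt he ?_ hdual ?_) ?_⟩
  · rw [inner_self_dual hdual]; ring
  · rw [one_pow]; exact one_mem _
  · rintro t s ⟨m, hm⟩
    refine ⟨-s, m, ?_⟩
    have hm' : (t : ℝ) = 2 * m - s := by exact_mod_cast eq_sub_of_add_eq hm
    rw [hm']
    push_cast
    generalize φ = g at h ⊢
    linear_combination (m - s : ℝ) * h
  · rw [one_pow, inv_one]; exact one_mem _

lemma one_div_sqrt_goldenRatio_sq : (1 / √φ) ^ 2 = φ - 1 := by
  rw [div_pow, Real.sq_sqrt Real.goldenRatio_pos.le, one_pow, div_eq_iff Real.goldenRatio_ne_zero]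
  linarith [Real.goldenRatio_sq]

/-- Oblate rhombohedra with icosahedral edges have height `1/φ`. -/
theorem exists_goldenBox_oblate (he : ∀ i, IsIcosahedral (e i))
    (hg : ∀ i j, i ≠ j → inner ℝ (e i) (e j) = -(φ - 1)) : ∃ n, GoldenBox (1 / √φ) e n := by
  have h := Real.goldenRatio_sq
  have hpos : 0 < 1 / √φ := one_div_pos.2 (Real.sqrt_pos.2 Real.goldenRatio_pos)
  have hb := one_div_sqrt_goldenRatio_sq
  have hdual := inner_dual_eq (α := (φ - 1) / 2) (β := (φ + 1) / 2) (B := (1 / √φ) ^ 2) he hg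
    (by rw [hb]; generalize φ = g at h ⊢; linarith) (by generalize φ = g at h ⊢; linarith)
  refine ⟨_, GoldenBox.of_dual hpos he (fun i => ?_) hdual
    (inner_vecV_mem_goldenInt he ?_ hdual ?_) ?_⟩
  · rw [inner_self_dual hdual, hb]; generalize φ = g at h ⊢; linarith
  · rw [hb]; exact sub_mem goldenRatio_mem_goldenInt (one_mem _)
  · rintro t s ⟨m, hm⟩
    refine ⟨t, m - t, ?_⟩
    have hm' : (s : ℝ) = 2 * m - t := by
      have : s = 2 * m - t := by omega
      exact_mod_cast this
    rw [hm']
    push_cast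
    generalize φ = g at h ⊢
    linear_combination (m : ℝ) * h
  · have : ((1 / √φ) ^ 2)⁻¹ = φ := by
      rw [hb]
      refine inv_eq_of_mul_eq_one_left ?_
      linarith
    rw [this]; exact goldenRatio_mem_goldenInt

lemma edgeLength_sq : edgeLength ^ 2 = 3 - φ := by
  have h := Real.goldenRatio_sq
  have h0 := Real.goldenRatio_ne_zero
  rw [edgeLength, Real.sq_sqrt (by positivity)]
  have : 1 / φ ^ 2 = 2 - φ := by
    rw [div_eq_iff (pow_ne_zero _ h0)]
    generalize φ = g at h ⊢
    linear_combination (g - 1) * h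
  rw [this]
  ring

/-- The ratio of the diagonals determines the angle. -/
lemma inner_eq_of_diagonals {u v : E3} (hu : ‖u‖ = edgeLength) (hv : ‖v‖ = edgeLength)
    (h : ‖u + v‖ = φ * ‖u - v‖) : inner ℝ u v = φ - 1 := by
  have hg := Real.goldenRatio_sq
  have h1 := congrArg (· ^ 2) h
  simp only [mul_pow, norm_add_sq_real, norm_sub_sq_real, hu, hv, edgeLength_sq] at h1
  have hpos := Real.goldenRatio_pos
  generalize φ = g at *
  have h2 : (g + 2) * (inner ℝ u v - (g - 1)) = 0 := by
    linear_combination h1 / 2 + (1 - g - inner ℝ u v) * hg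
  linarith [(mul_eq_zero.1 h2).resolve_left (by positivity)]

end Boxes

/-! ### Faces of a rhombohedron and their edges -/

/-- Linearly independent vectors are determined, up to sign and order, by the support function
`m ↦ ∑ |m (e i)|` of the zonotope that they span. -/
theorem eq_or_eq_neg_of_sum_abs_eq {e f : Fin 3 → E3} (he : LinearIndependent ℝ e)
    (hf : LinearIndependent ℝ f) {J K : Finset (Fin 3)}
    (h : ∀ m : E3 →ₗ[ℝ] ℝ, ∑ i ∈ J, |m (e i)| = ∑ k ∈ K, |m (f k)|) :
    ∀ k ∈ K, ∃ i ∈ J, f k = e i ∨ f k = -e i := by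
  let B := basisOfLinearIndependentOfCardEqFinrank he (by simp)
  have hB : ∀ i, B i = e i := fun i => by simp [B]
  have hcoord : ∀ i j, B.coord i (e j) = if i = j then 1 else 0 := by
    intro i j
    rw [← hB, Module.Basis.coord_apply, Module.Basis.repr_self, Finsupp.single_apply]
    simp only [eq_comm]
  have hsum : ∀ k, f k = ∑ i, B.coord i (f k) • e i := by
    intro k
    conv_lhs => rw [← B.sum_repr (f k)]
    simp only [hB, Module.Basis.coord_apply]
  have H1 : ∀ i, ∑ k ∈ K, |B.coord i (f k)| = if i ∈ J then 1 else 0 := by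
    intro i
    rw [← h]
    simp only [hcoord, apply_ite abs, abs_one, abs_zero, Finset.sum_ite_eq]
  -- the functionals `coord i ± coord j` have norms that add up, on `e` and hence on `f`
  have H2 : ∀ (s : ℝ), |s| = 1 → ∀ i j, i ≠ j → ∀ k ∈ K,
      |B.coord i (f k)| + |B.coord j (f k)| = |B.coord i (f k) + s * B.coord j (f k)| := by
    intro s hs i j hij k hk
    have h1 : ∑ k ∈ K, |B.coord i (f k) + s * B.coord j (f k)| =
        ∑ k ∈ K, (|B.coord i (f k)| + |B.coord j (f k)|) := by
      rw [Finset.sum_add_distrib, H1, H1]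
      have h2 := h (B.coord i + s • B.coord j)
      simp only [LinearMap.add_apply, LinearMap.smul_apply, smul_eq_mul, hcoord] at h2
      rw [← h2]
      have h3 : ∀ x, |(if i = x then (1 : ℝ) else 0) + s * (if j = x then 1 else 0)| =
          (if i = x then 1 else 0) + (if j = x then 1 else 0) := by
        intro x
        by_cases hi : i = x
        · have hj : j ≠ x := fun hj => hij (hi.trans hj.symm)
          simp [hi, hj]
        · by_cases hj : j = x <;> simp [hi, hj, hs]
      simp only [h3, Finset.sum_add_distrib, Finset.sum_ite_eq]
    refine ((Finset.sum_eq_sum_iff_of_le fun k _ => ?_).1 h1 k hk).symm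
    calc _ ≤ |B.coord i (f k)| + |s * B.coord j (f k)| := abs_add_le _ _
      _ = _ := by rw [abs_mul, hs, one_mul]
  have H3 : ∀ i j, i ≠ j → ∀ k ∈ K, B.coord i (f k) ≠ 0 → B.coord j (f k) = 0 := by
    intro i j hij k hk hi
    have h1 := congrArg (· ^ 2) (H2 1 abs_one i j hij k hk)
    have h2 := congrArg (· ^ 2) (H2 (-1) (by simp) i j hij k hk)
    simp only [add_sq, sq_abs] at h1 h2
    have h3 : B.coord i (f k) * B.coord j (f k) = 0 := by linarith
    exact (mul_eq_zero.1 h3).resolve_left hi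
  intro k hk
  have hex : ∃ i, B.coord i (f k) ≠ 0 := by
    by_contra! h0
    refine hf.ne_zero k ?_
    rw [hsum k]
    simp [h0]
  obtain ⟨i, hi⟩ := hex
  have hmul : ∀ k ∈ K, B.coord i (f k) ≠ 0 → f k = B.coord i (f k) • e i := by
    intro k hk hi
    conv_lhs => rw [hsum k]
    refine Finset.sum_eq_single i (fun j _ hj => ?_) (fun h => absurd (Finset.mem_univ i) h)
    rw [H3 i j hj.symm k hk hi, zero_smul]
  have hne : ∀ k' ∈ K, k' ≠ k → |B.coord i (f k')| = 0 := by
    intro k' hk' hkk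
    by_contra h0
    have h1 := hmul k hk hi
    have h2 := hmul k' hk' (fun h => h0 (by rw [h, abs_zero]))
    generalize hc : B.coord i (f k) = c at *
    generalize hc' : B.coord i (f k') = c' at *
    have h3 := Fintype.linearIndependent_iff.1 hf (Pi.single k c' - Pi.single k' c) (by
      simp only [Pi.sub_apply, sub_smul, Finset.sum_sub_distrib, Pi.single_apply, ite_smul,
        zero_smul, Finset.sum_ite_eq', Finset.mem_univ, if_true]
      rw [h1, h2, smul_smul, smul_smul, mul_comm, sub_self]) k'
    simp [hkk] at h3
    exact hi h3
  have h1 := H1 i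
  rw [Finset.sum_eq_single k hne (fun h => absurd hk h)] at h1
  have hJ : i ∈ J := by
    by_contra hJ
    rw [if_neg hJ] at h1
    exact hi (abs_eq_zero.1 h1)
  rw [if_pos hJ] at h1
  refine ⟨i, hJ, ?_⟩
  rw [hmul k hk hi]
  rcases eq_or_eq_neg_of_abs_eq h1 with h | h <;> rw [h] <;> simp

/-- A nonempty exposed face of a rhombohedron is a translate of the parallelepiped spanned by some
of the edges, those on which the exposing functional vanishes. The width of the face in the direction
of `m` is the sum of the `|m (e i)|` over these edges, and it has no points with other nonintegral
coordinates. -/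
theorem exists_width_of_isExposed {p : E3} {e : Fin 3 → E3} {F : Set E3} (hF : F.Nonempty)
    (h : IsExposed ℝ (rhombohedron p e) F) :
    ∃ J : Finset (Fin 3),
      (∀ m : E3 →ₗ[ℝ] ℝ,
        IsGreatest {r | ∃ y ∈ F, ∃ z ∈ F, r = m (y - z)} (∑ i ∈ J, |m (e i)|)) ∧
      ∀ t : Fin 3 → ℝ, (∀ i, 0 ≤ t i ∧ t i ≤ 1) → p + ∑ i, t i • e i ∈ F →
        ∀ i, 0 < t i → t i < 1 → i ∈ J := by
  obtain ⟨l, hl⟩ := h hF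
  have hmem : ∀ t : Fin 3 → ℝ, (∀ i, 0 ≤ t i ∧ t i ≤ 1) → (p + ∑ i, t i • e i ∈ F ↔
      ∀ s : Fin 3 → ℝ, (∀ i, 0 ≤ s i ∧ s i ≤ 1) → ∑ i, s i * l (e i) ≤ ∑ i, t i * l (e i)) := by
    intro t ht
    rw [hl]
    have hlin : ∀ s : Fin 3 → ℝ, l (p + ∑ i, s i • e i) = l p + ∑ i, s i * l (e i) := by
      intro s
      simp only [map_add, map_sum, map_smul, smul_eq_mul]
    constructor
    · rintro ⟨-, h⟩ s hs
      have := h _ (mem_rhombohedron.2 ⟨s, hs, rfl⟩)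
      rw [hlin, hlin] at this
      linarith
    · intro h
      refine ⟨mem_rhombohedron.2 ⟨t, ht, rfl⟩, fun y hy => ?_⟩
      obtain ⟨s, hs, rfl⟩ := mem_rhombohedron.1 hy
      rw [hlin, hlin]
      linarith [h s hs]
  have hkey : ∀ t : Fin 3 → ℝ, (∀ i, 0 ≤ t i ∧ t i ≤ 1) → p + ∑ i, t i • e i ∈ F →
      ∀ i, l (e i) ≠ 0 → t i = if 0 < l (e i) then 1 else 0 := by
    intro t ht htF i hi
    have hopt : ∀ c : ℝ, 0 ≤ c → c ≤ 1 → (c - t i) * l (e i) ≤ 0 := by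
      intro c hc0 hc1
      have h1 := (hmem t ht).1 htF (Function.update t i c) (fun j => by
        by_cases hj : j = i
        · subst hj; simp [hc0, hc1]
        · simp [hj, ht j])
      have h2 : ∑ j, Function.update t i c j * l (e j) - ∑ j, t j * l (e j) =
          (c - t i) * l (e i) := by
        rw [← Finset.sum_sub_distrib]
        rw [Finset.sum_eq_single i (fun j _ hj => by simp [hj])
          (fun h => absurd (Finset.mem_univ i) h), Function.update_self]
        ring
      linarith
    split_ifs with hpos
    · have := hopt 1 zero_le_one le_rfl
      have := (ht i).2
      nlinarith
    · have hneg : l (e i) < 0 := lt_of_le_of_ne (not_lt.1 hpos) hi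
      have := hopt 0 le_rfl zero_le_one
      have := (ht i).1
      nlinarith
  have hcoord : ∀ y ∈ F, ∃ t : Fin 3 → ℝ, (∀ i, 0 ≤ t i ∧ t i ≤ 1) ∧ y = p + ∑ i, t i • e i := by
    intro y hy
    rw [hl] at hy
    exact mem_rhombohedron.1 hy.1
  refine ⟨Finset.univ.filter fun i => l (e i) = 0, fun m => ⟨?_, ?_⟩, ?_⟩
  · obtain ⟨x, hx⟩ := hF
    obtain ⟨t, ht, rfl⟩ := hcoord x hx
    have hface : ∀ s : Fin 3 → ℝ, (∀ i, 0 ≤ s i ∧ s i ≤ 1) →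
        (∀ i, l (e i) ≠ 0 → s i = t i) → p + ∑ i, s i • e i ∈ F := by
      intro s hs hst
      rw [hmem s hs]
      intro r hr
      refine ((hmem t ht).1 hx r hr).trans_eq (Finset.sum_congr rfl fun i _ => ?_)
      by_cases hi : l (e i) = 0
      · rw [hi, mul_zero, mul_zero]
      · rw [hst i hi]
    have h01 : ∀ (P : Prop) [Decidable P], (0 : ℝ) ≤ (if P then 1 else 0) ∧
        (if P then 1 else 0 : ℝ) ≤ 1 := by
      intro P _
      split_ifs <;> norm_num
    refine ⟨_, hface (fun i => if l (e i) = 0 then (if 0 ≤ m (e i) then 1 else 0) else t i) ?_ ?_,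
      _, hface (fun i => if l (e i) = 0 then (if m (e i) < 0 then 1 else 0) else t i) ?_ ?_, ?_⟩
    · intro i
      by_cases hi : l (e i) = 0
      · simp only [if_pos hi]; exact h01 _
      · simp only [if_neg hi]; exact ht i
    · intro i hi
      exact if_neg hi
    · intro i
      by_cases hi : l (e i) = 0
      · simp only [if_pos hi]; exact h01 _
      · simp only [if_neg hi]; exact ht i
    · intro i hi
      exact if_neg hi
    · rw [Finset.sum_filter, add_sub_add_left_eq_sub, ← Finset.sum_sub_distrib, map_sum]
      refine Finset.sum_congr rfl fun i _ => ?_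
      rw [← sub_smul, map_smul, smul_eq_mul]
      by_cases hi : l (e i) = 0
      · simp only [if_pos hi]
        by_cases hm : 0 ≤ m (e i)
        · rw [if_pos hm, if_neg (not_lt.2 hm), abs_of_nonneg hm]; ring
        · rw [if_neg hm, if_pos (not_le.1 hm), abs_of_neg (not_le.1 hm)]; ring
      · simp only [if_neg hi, sub_self, zero_mul]
  · rintro _ ⟨y, hy, z, hz, rfl⟩
    obtain ⟨s, hs, rfl⟩ := hcoord y hy
    obtain ⟨t, ht, rfl⟩ := hcoord z hz
    rw [Finset.sum_filter, add_sub_add_left_eq_sub, ← Finset.sum_sub_distrib, map_sum]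
    refine Finset.sum_le_sum fun i _ => ?_
    rw [← sub_smul, map_smul, smul_eq_mul]
    split_ifs with hi
    · refine (le_abs_self _).trans ?_
      rw [abs_mul]
      refine mul_le_of_le_one_left (abs_nonneg _) (abs_le.2 ?_)
      constructor <;> linarith [hs i, ht i]
    · rw [hkey s hs hy i hi, hkey t ht hz i hi, sub_self, zero_mul]
  · intro t ht htF i h0 h1
    rw [Finset.mem_filter]
    refine ⟨Finset.mem_univ _, ?_⟩
    by_contra hi
    have := hkey t ht htF i hi
    split_ifs at this <;> linarith

/-- Two rhombohedra that are the same set have the same width functions. -/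
lemma sum_abs_eq_of_rhombohedron_eq {p q : E3} {e f : Fin 3 → E3}
    (h : rhombohedron p e = rhombohedron q f) (m : E3 →ₗ[ℝ] ℝ) :
    ∑ i, |m (e i)| = ∑ i, |m (f i)| := by
  have key : ∀ (p : E3) (e : Fin 3 → E3), IsGreatest {r | ∃ y ∈ rhombohedron p e,
      ∃ z ∈ rhombohedron p e, r = m (y - z)} (∑ i, |m (e i)|) := by
    intro p e
    have hhalf : ∀ i : Fin 3, (0 : ℝ) ≤ (fun _ => 1 / 2 : Fin 3 → ℝ) i ∧
        (fun _ => 1 / 2 : Fin 3 → ℝ) i ≤ 1 := fun i => by norm_num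
    have hc := (mem_rhombohedron (p := p) (e := e)).2 ⟨_, hhalf, rfl⟩
    obtain ⟨J, hJ, ht⟩ := exists_width_of_isExposed ⟨_, hc⟩ (IsExposed.refl (𝕜 := ℝ) _)
    have : J = Finset.univ :=
      Finset.eq_univ_iff_forall.2 fun i => ht _ hhalf hc i (by norm_num) (by norm_num)
    rw [← this]
    exact hJ m
  have h1 := key p e
  rw [h] at h1
  exact h1.unique (key q f)

/-! ### Golden frames with icosahedral edges -/

lemma goldenRatio_lt_five_thirds : φ < 5 / 3 := by
  have h := Real.goldenRatio_sq
  by_contra! h'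
  nlinarith

lemma IsGoldenFrame.abs_inner {e : Fin 3 → E3} (he : IsGoldenFrame e) {i j : Fin 3} (h : i ≠ j) :
    |inner ℝ (e i) (e j)| = φ - 1 := by
  have h1 : 0 ≤ φ - 1 := sub_nonneg.2 Real.one_lt_goldenRatio.le
  rcases he.inner_eq i j h with h | h <;> rw [h]
  · exact abs_of_nonneg h1
  · rw [abs_neg, abs_of_nonneg h1]

/-- The Gram matrix of a golden frame is diagonally dominant. -/
lemma IsGoldenFrame.linearIndependent {e : Fin 3 → E3} (he : IsGoldenFrame e) :
    LinearIndependent ℝ e := by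
  rw [Fintype.linearIndependent_iff]
  intro g hg
  have key : ∀ i j k : Fin 3, i ≠ j → i ≠ k →
      g i • e i + g j • e j + g k • e k = 0 →
      (3 - φ) * |g i| ≤ (φ - 1) * (|g j| + |g k|) := by
    intro i j k hij hik h
    have h1 := congrArg (inner ℝ (e i)) h
    simp only [inner_add_right, real_inner_smul_right, inner_zero_right, he.inner_self] at h1
    have h2 : (3 - φ) * g i = -(g j * inner ℝ (e i) (e j) + g k * inner ℝ (e i) (e k)) := by
      linarith
    have h3 : 0 ≤ 3 - φ := by linarith [goldenRatio_lt_five_thirds]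
    calc (3 - φ) * |g i| = |(3 - φ) * g i| := by rw [abs_mul, abs_of_nonneg h3]
      _ ≤ |g j * inner ℝ (e i) (e j)| + |g k * inner ℝ (e i) (e k)| := by
        rw [h2, abs_neg]; exact abs_add_le _ _
      _ = _ := by rw [abs_mul, abs_mul, he.abs_inner hij, he.abs_inner hik]; ring
  rw [Fin.sum_univ_three] at hg
  have k0 := key 0 1 2 (by decide) (by decide) hg
  have k1 := key 1 0 2 (by decide) (by decide) (by rw [← hg]; abel)
  have k2 := key 2 0 1 (by decide) (by decide) (by rw [← hg]; abel)
  have h5 := goldenRatio_lt_five_thirds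
  have h0 := abs_nonneg (g 0)
  have h1 := abs_nonneg (g 1)
  have h2 := abs_nonneg (g 2)
  have hs : |g 0| + |g 1| + |g 2| ≤ 0 := by
    by_contra! hs
    have := mul_pos (by linarith : 0 < 5 - 3 * φ) hs
    nlinarith
  intro i
  fin_cases i <;> simp only [Fin.zero_eta, Fin.mk_one, Fin.reduceFinMk] <;> rw [← abs_eq_zero] <;>
    linarith

lemma vecV_linearIndependent_pair {a b : Fin 6} (hab : a ≠ b) {α β : ℝ}
    (ha : inner ℝ (vecV a) (α • vecV a + β • vecV b) = 0)
    (hb : inner ℝ (vecV b) (α • vecV a + β • vecV b) = 0) : α = 0 ∧ β = 0 := by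
  simp only [inner_add_right, real_inner_smul_right, inner_vecV, if_true, if_neg hab,
    if_neg hab.symm] at ha hb
  have h1 : (signV a b : ℝ) ^ 2 = 1 := by rcases signV_eq hab with h | h <;> simp [h]
  have h2 : ∀ a b, signV b a = signV a b := by decide
  rw [h2 a b] at hb
  generalize (signV a b : ℝ) = s at *
  have h5 := goldenRatio_lt_five_thirds
  have h6 := Real.one_lt_goldenRatio
  have hd : 0 < (3 - φ) ^ 2 - (φ - 1) ^ 2 := by nlinarith
  generalize φ = g at *
  constructor
  · have : α * ((3 - g) ^ 2 - (g - 1) ^ 2) = 0 := by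
      linear_combination (3 - g) * ha - s * (g - 1) * hb + α * (g - 1) ^ 2 * h1
    exact (mul_eq_zero.1 this).resolve_right hd.ne'
  · have : β * ((3 - g) ^ 2 - (g - 1) ^ 2) = 0 := by
      linear_combination (3 - g) * hb - s * (g - 1) * ha + β * (g - 1) ^ 2 * h1
    exact (mul_eq_zero.1 this).resolve_right hd.ne'

/-- The orthogonal complement of `V_a` and `V_b` is a line. -/
lemma eq_smul_of_inner_vecV_eq_zero {a b : Fin 6} (hab : a ≠ b) {n v : E3} (hn : n ≠ 0)
    (hna : inner ℝ (vecV a) n = 0) (hnb : inner ℝ (vecV b) n = 0)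
    (hva : inner ℝ (vecV a) v = 0) (hvb : inner ℝ (vecV b) v = 0) : ∃ c : ℝ, v = c • n := by
  have hpair : ∀ α β γ : ℝ, ∀ u, inner ℝ (vecV a) u = 0 → inner ℝ (vecV b) u = 0 →
      u = α • vecV a + β • vecV b + γ • n → α = 0 ∧ β = 0 := by
    intro α β γ u ha hb hu
    rw [hu, inner_add_right, real_inner_smul_right, hna, mul_zero, add_zero] at ha
    rw [hu, inner_add_right, real_inner_smul_right, hnb, mul_zero, add_zero] at hb
    exact vecV_linearIndependent_pair hab ha hb
  have hli : LinearIndependent ℝ ![vecV a, vecV b, n] := by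
    rw [Fintype.linearIndependent_iff]
    intro g hg
    simp only [Fin.sum_univ_three, Matrix.cons_val] at hg
    obtain ⟨h0, h1⟩ := hpair (g 0) (g 1) (g 2) 0 (inner_zero_right _) (inner_zero_right _) hg.symm
    rw [h0, h1, zero_smul, zero_smul, zero_add, zero_add] at hg
    have h2 := (smul_eq_zero.1 hg).resolve_right hn
    intro i
    fin_cases i
    exacts [h0, h1, h2]
  let B := basisOfLinearIndependentOfCardEqFinrank hli (by simp)
  have hv : v = B.repr v 0 • vecV a + B.repr v 1 • vecV b + B.repr v 2 • n := by
    conv_lhs => rw [← B.sum_repr v]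
    simp [B, Fin.sum_univ_three]
  obtain ⟨h0, h1⟩ := hpair _ _ _ v hva hvb hv
  refine ⟨B.repr v 2, ?_⟩
  rwa [h0, h1, zero_smul, zero_smul, zero_add, zero_add] at hv

/-- For any two of the six lines there are two others whose signs with the given two have a
prescribed product. -/
lemma exists_signV (a b : Fin 6) (hab : a ≠ b) (s t : ℤ) (hs : s = 1 ∨ s = -1)
    (ht : t = 1 ∨ t = -1) : ∃ d d', a ≠ d ∧ b ≠ d ∧ a ≠ d' ∧ b ≠ d' ∧ d ≠ d' ∧
      s * signV a d * signV b d = t ∧ s * signV a d' * signV b d' = t := by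
  rcases hs with rfl | rfl <;> rcases ht with rfl | rfl <;> revert a b <;> decide

/-- There are two vectors of length `σ` with given inner products `± (φ - 1)` with `V_a` and `V_b`,
and both are vertices of the icosahedron. -/
lemma isIcosahedral_of_inner_vecV {a b : Fin 6} (hab : a ≠ b) {w : E3}
    (hw : inner ℝ w w = 3 - φ) {s t : ℤ} (hs : s = 1 ∨ s = -1) (ht : t = 1 ∨ t = -1)
    (hwa : inner ℝ (vecV a) w = s * (φ - 1)) (hwb : inner ℝ (vecV b) w = t * (φ - 1)) :
    IsIcosahedral w := by
  obtain ⟨d, d', had, hbd, had', hbd', hdd, h1, h2⟩ := exists_signV a b hab s t hs ht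
  have key : ∀ d, a ≠ d → b ≠ d → s * signV a d * signV b d = t →
      ∃ r : ℝ, (r = 1 ∨ r = -1) ∧ inner ℝ (vecV a) (r • vecV d) = s * (φ - 1) ∧
        inner ℝ (vecV b) (r • vecV d) = t * (φ - 1) := by
    intro d had hbd h
    have hsq : (signV a d : ℝ) ^ 2 = 1 := by rcases signV_eq had with h | h <;> simp [h]
    have hsd : (s * signV a d : ℝ) ^ 2 = 1 := by
      rw [mul_pow, hsq]; rcases hs with rfl | rfl <;> norm_num
    have h' : (s * signV a d * signV b d : ℝ) = t := by exact_mod_cast h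
    refine ⟨s * signV a d, sq_eq_sq_iff_eq_or_eq_neg.1 (hsd.trans (one_pow 2).symm), ?_, ?_⟩
    · rw [real_inner_smul_right, inner_vecV, if_neg had]
      linear_combination (s * (φ - 1) : ℝ) * hsq
    · rw [real_inner_smul_right, inner_vecV, if_neg hbd]
      linear_combination (φ - 1) * h'
  obtain ⟨r, hr, hra, hrb⟩ := key d had hbd h1
  obtain ⟨r', hr', hra', hrb'⟩ := key d' had' hbd' h2
  have hico : ∀ (r : ℝ) d, (r = 1 ∨ r = -1) → IsIcosahedral (r • vecV d) := by
    rintro r d (rfl | rfl)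
    · exact ⟨d, .inl (one_smul _ _)⟩
    · exact ⟨d, .inr (by rw [neg_smul, one_smul])⟩
  have hu := hico r d hr
  have hu' := hico r' d' hr'
  have hne : r • vecV d - r' • vecV d' ≠ 0 := by
    intro h
    have h3 := congrArg (inner ℝ (vecV d)) (sub_eq_zero.1 h)
    rw [real_inner_smul_right, real_inner_smul_right, inner_vecV, inner_vecV, if_pos rfl,
      if_neg hdd] at h3
    have h5 := goldenRatio_lt_five_thirds
    have h6 := Real.one_lt_goldenRatio
    rcases signV_eq hdd with h4 | h4 <;> rcases hr with rfl | rfl <;> rcases hr' with rfl | rfl <;>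
      rw [h4] at h3 <;> push_cast at h3 <;> generalize φ = g at * <;> linarith
  generalize r • vecV d = u at *
  generalize r' • vecV d' = u' at *
  obtain ⟨c, hc⟩ := eq_smul_of_inner_vecV_eq_zero hab (v := w - u) hne
    (by rw [inner_sub_right, hra, hra', sub_self]) (by rw [inner_sub_right, hrb, hrb', sub_self])
    (by rw [inner_sub_right, hwa, hra, sub_self]) (by rw [inner_sub_right, hwb, hrb, sub_self])
  have hw' : w = u + c • (u - u') := by rw [← hc, add_sub_cancel]
  have hn : 0 < inner ℝ (u - u') (u - u') := real_inner_self_pos.2 hne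
  have h3 : inner ℝ (u - u') (u - u') = 2 * (3 - φ) - 2 * inner ℝ u u' := by
    rw [inner_sub_left, inner_sub_right, inner_sub_right, hu.inner_self, hu'.inner_self,
      real_inner_comm u u']
    ring
  rw [hw', inner_add_left, inner_add_right, inner_add_right, real_inner_smul_left,
    real_inner_smul_left, real_inner_smul_right, real_inner_smul_right,
    real_inner_comm u (u - u'), inner_sub_right u u u', hu.inner_self] at hw
  have h4 : c * (c + 1) * inner ℝ (u - u') (u - u') = 0 := by
    linear_combination hw + c * h3
  rcases mul_eq_zero.1 ((mul_eq_zero.1 h4).resolve_right hn.ne') with h0 | h0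
  · rwa [hw', h0, zero_smul, add_zero]
  · rwa [hw', eq_neg_of_add_eq_zero_left h0, neg_smul, one_smul, neg_sub, add_sub_cancel]

/-- A golden frame is icosahedral as soon as two of its vectors are. -/
theorem IsGoldenFrame.isIcosahedral_of_two {e : Fin 3 → E3} (he : IsGoldenFrame e) {i j : Fin 3}
    (hij : i ≠ j) (hi : IsIcosahedral (e i)) (hj : IsIcosahedral (e j)) (k : Fin 3) :
    IsIcosahedral (e k) := by
  by_cases hki : k = i
  · rwa [hki]
  by_cases hkj : k = j
  · rwa [hkj]
  have hsign : ∀ i, k ≠ i → ∀ a, (e i = vecV a ∨ e i = -vecV a) →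
      ∃ s : ℤ, (s = 1 ∨ s = -1) ∧ inner ℝ (vecV a) (e k) = s * (φ - 1) := by
    intro i hki a ha
    have h1 := he.inner_eq i k (Ne.symm hki)
    rcases ha with ha | ha <;> rw [ha] at h1
    · rcases h1 with h1 | h1
      · exact ⟨1, .inl rfl, by rw [h1]; push_cast; ring⟩
      · exact ⟨-1, .inr rfl, by rw [h1]; push_cast; ring⟩
    · rw [inner_neg_left] at h1
      rcases h1 with h1 | h1
      · exact ⟨-1, .inr rfl, by push_cast; linarith⟩
      · exact ⟨1, .inl rfl, by push_cast; linarith⟩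
  obtain ⟨a, ha⟩ := hi
  obtain ⟨b, hb⟩ := hj
  obtain ⟨s, hs, hsa⟩ := hsign i hki a ha
  obtain ⟨t, ht, htb⟩ := hsign j hkj b hb
  have hab : a ≠ b := by
    rintro rfl
    have h1 := he.abs_inner hij
    have h2 : |inner ℝ (e i) (e j)| = 3 - φ := by
      have h3 : |inner ℝ (vecV a) (vecV a)| = 3 - φ := by
        rw [inner_vecV, if_pos rfl]
        exact abs_of_nonneg (by linarith [goldenRatio_lt_five_thirds])
      rcases ha with ha | ha <;> rcases hb with hb | hb <;> rw [ha, hb] <;>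
        simpa only [inner_neg_left, inner_neg_right, abs_neg] using h3
    linarith [goldenRatio_lt_five_thirds]
  exact isIcosahedral_of_inner_vecV hab (he.inner_self k) hs ht hsa htb

/-! ### Golden rhombohedra in an aligned Ammann tiling -/

lemma isGoldenFrame_of_oblate {e : Fin 3 → E3} (h : ∀ i, ‖e i‖ = edgeLength)
    (h' : ∀ i j, i ≠ j → ‖e i - e j‖ = φ * ‖e i + e j‖) :
    IsGoldenFrame e ∧ ∀ i j, i ≠ j → inner ℝ (e i) (e j) = -(φ - 1) := by
  have key : ∀ i j, i ≠ j → inner ℝ (e i) (e j) = -(φ - 1) := by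
    intro i j hij
    have := inner_eq_of_diagonals (h i) (v := -e j) (by rw [norm_neg, h])
      (by rw [← sub_eq_add_neg, sub_neg_eq_add, h' i j hij])
    rw [inner_neg_right] at this
    linarith
  exact ⟨⟨fun i => by rw [real_inner_self_eq_norm_sq, h, edgeLength_sq],
    fun i j hij => .inr (key i j hij)⟩, key⟩

lemma isGoldenFrame_of_prolate {e : Fin 3 → E3} (h : ∀ i, ‖e i‖ = edgeLength)
    (h' : ∀ i j, i ≠ j → ‖e i + e j‖ = φ * ‖e i - e j‖) :
    IsGoldenFrame e ∧ ∀ i j, i ≠ j → inner ℝ (e i) (e j) = φ - 1 := by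
  have key : ∀ i j, i ≠ j → inner ℝ (e i) (e j) = φ - 1 := fun i j hij =>
    inner_eq_of_diagonals (h i) (h j) (h' i j hij)
  exact ⟨⟨fun i => by rw [real_inner_self_eq_norm_sq, h, edgeLength_sq],
    fun i j hij => .inl (key i j hij)⟩, key⟩

lemma IsAmmannTiling.exists_frame {T : Set (Set E3)} (hT : IsAmmannTiling edgeLength T)
    {Δ : Set E3} (hΔ : Δ ∈ T) : ∃ p e, Δ = rhombohedron p e ∧ IsGoldenFrame e := by
  rcases hT.tiles Δ hΔ with ⟨p, e, h, h1, h2⟩ | ⟨p, e, h, h1, h2⟩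
  · exact ⟨p, e, h, (isGoldenFrame_of_oblate h1 h2).1⟩
  · exact ⟨p, e, h, (isGoldenFrame_of_prolate h1 h2).1⟩

/-- Golden rhombohedra with edges parallel to the `V_k`. -/
def IsIcosahedralTile (Δ : Set E3) : Prop :=
  ∃ p e, Δ = rhombohedron p e ∧ IsGoldenFrame e ∧ ∀ i, IsIcosahedral (e i)

/-- The edges of a rhombohedron are determined by the set. -/
lemma IsIcosahedralTile.isIcosahedral {p : E3} {e : Fin 3 → E3}
    (h : IsIcosahedralTile (rhombohedron p e)) (he : IsGoldenFrame e) (i : Fin 3) :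
    IsIcosahedral (e i) := by
  obtain ⟨q, f, hqf, hf, hico⟩ := h
  obtain ⟨j, -, h | h⟩ := eq_or_eq_neg_of_sum_abs_eq hf.linearIndependent he.linearIndependent
    (J := Finset.univ) (K := Finset.univ)
    (fun m => (sum_abs_eq_of_rhombohedron_eq hqf m).symm) i (Finset.mem_univ i)
  · rw [h]; exact hico j
  · rw [h]; exact (hico j).neg

/-- A tile with a facet parallel to two of the `V_k` is icosahedral. -/
theorem IsAmmannTiling.isIcosahedralTile_of_facet {T : Set (Set E3)}
    (hT : IsAmmannTiling edgeLength T) {p : E3} {k : Fin 6} {ε : ℝ} {w : E3}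
    (hε : ε = 1 ∨ ε = -1) (h : rhombohedron p ![vecV 0, ε • vecV k, w] ∈ T) :
    IsIcosahedralTile (rhombohedron p ![vecV 0, ε • vecV k, w]) := by
  obtain ⟨q, e, hqe, he⟩ := hT.exists_frame h
  have hsum := sum_abs_eq_of_rhombohedron_eq hqe
  have hli : LinearIndependent ℝ ![vecV 0, ε • vecV k, w] := by
    refine linearIndependent_of_top_le_span_of_card_eq_finrank ?_ (by simp)
    by_contra hspan
    obtain ⟨m, hm0, hm⟩ := Submodule.exists_le_ker_of_lt_top _ (lt_top_iff_ne_top.2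
      fun h => hspan h.ge)
    have h1 := hsum m
    rw [Finset.sum_eq_zero fun i _ => abs_eq_zero.2
      (LinearMap.mem_ker.1 (hm (Submodule.subset_span (mem_range_self i)))), eq_comm,
      Finset.sum_eq_zero_iff_of_nonneg fun i _ => abs_nonneg _] at h1
    let B := basisOfLinearIndependentOfCardEqFinrank he.linearIndependent (by simp)
    refine hm0 (B.ext fun i => ?_)
    simpa [B] using h1 i (Finset.mem_univ i)
  have hmatch := eq_or_eq_neg_of_sum_abs_eq he.linearIndependent hli (J := Finset.univ)
    (K := Finset.univ) fun m => (hsum m).symm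
  obtain ⟨i, -, hi⟩ := hmatch 0 (Finset.mem_univ 0)
  obtain ⟨j, -, hj⟩ := hmatch 1 (Finset.mem_univ 1)
  simp only [Matrix.cons_val_zero, Matrix.cons_val_one] at hi hj
  have hico : ∀ {v u : E3}, IsIcosahedral v → v = u ∨ v = -u → IsIcosahedral u := by
    rintro v u hv (rfl | rfl)
    · exact hv
    · simpa using hv.neg
  have hei := hico ⟨0, .inl rfl⟩ hi
  have hk' : IsIcosahedral (ε • vecV k) := by
    rcases hε with rfl | rfl
    · exact ⟨k, .inl (one_smul _ _)⟩
    · exact ⟨k, .inr (by rw [neg_smul, one_smul])⟩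
  have hej := hico hk' hj
  have hij : i ≠ j := by
    rintro rfl
    have h1 : ∃ c : ℝ, vecV 0 = c • (ε • vecV k) := by
      rcases hi with hi | hi <;> rcases hj with hj | hj <;> rw [hi, hj]
      · exact ⟨1, (one_smul _ _).symm⟩
      · exact ⟨-1, by simp⟩
      · exact ⟨-1, by simp⟩
      · exact ⟨1, (one_smul _ _).symm⟩
    obtain ⟨c, hc⟩ := h1
    have h2 := Fintype.linearIndependent_iff.1 hli ![1, -c, 0] (by
      simp [Fin.sum_univ_three, ← hc]) 0
    simp at h2
  exact ⟨q, e, hqe, he, he.isIcosahedral_of_two hij hei hej⟩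

/-- Icosahedral tiles pass this property on to all tiles that they meet in a set other than a vertex
or a part of an edge. -/
theorem IsIcosahedralTile.of_mem {Δ : Set E3} (hΔ : IsIcosahedralTile Δ) {p : E3} {e : Fin 3 → E3}
    (he : IsGoldenFrame e) (h : IsExposed ℝ Δ (Δ ∩ rhombohedron p e))
    (h' : IsExposed ℝ (rhombohedron p e) (Δ ∩ rhombohedron p e)) {t : Fin 3 → ℝ}
    (ht : ∀ i, 0 ≤ t i ∧ t i ≤ 1) (hmem : p + ∑ i, t i • e i ∈ Δ) {i j : Fin 3} (hij : i ≠ j)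
    (hi : 0 < t i ∧ t i < 1) (hj : 0 < t j ∧ t j < 1) : IsIcosahedralTile (rhombohedron p e) := by
  obtain ⟨q, f, rfl, hf, hico⟩ := hΔ
  have hx : p + ∑ i, t i • e i ∈ rhombohedron q f ∩ rhombohedron p e :=
    ⟨hmem, mem_rhombohedron.2 ⟨t, ht, rfl⟩⟩
  obtain ⟨J, hJ, -⟩ := exists_width_of_isExposed ⟨_, hx⟩ h
  obtain ⟨K, hK, hKt⟩ := exists_width_of_isExposed ⟨_, hx⟩ h'
  have hmatch : ∀ k ∈ K, IsIcosahedral (e k) := by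
    intro k hk
    obtain ⟨l, -, h | h⟩ := eq_or_eq_neg_of_sum_abs_eq hf.linearIndependent he.linearIndependent
      (fun m => (hJ m).unique (hK m)) k hk
    · rw [h]; exact hico l
    · rw [h]; exact (hico l).neg
  exact ⟨p, e, rfl, he, he.isIcosahedral_of_two hij (hmatch i (hKt t ht hx i hi.1 hi.2))
    (hmatch j (hKt t ht hx j hj.1 hj.2))⟩

lemma dense_notMem_planes {ι : Type*} [Countable ι] (a u v : ι → E3) :
    Dense {x | ∀ i, x - a i ∉ Submodule.span ℝ {u i, v i}} := by
  refine MeasureTheory.Measure.dense_of_ae (μ := MeasureTheory.volume)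
    (MeasureTheory.ae_all_iff.2 fun i => ?_)
  have htop : Submodule.span ℝ {u i, v i} ≠ ⊤ := by
    intro h
    have h1 := finrank_span_finset_le_card (R := ℝ) ({u i, v i} : Finset E3)
    rw [Set.finrank, Finset.coe_pair, h, finrank_top, finrank_euclideanSpace_fin] at h1
    have := h1.trans Finset.card_le_two
    omega
  have h0 := MeasureTheory.Measure.addHaar_submodule MeasureTheory.volume _ htop
  rw [← MeasureTheory.measure_preimage_add_right _ (-a i)] at h0
  rw [MeasureTheory.ae_iff]
  simp only [not_not, sub_eq_add_neg]
  exact h0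

lemma IsGoldenFrame.interior_nonempty {e : Fin 3 → E3} (he : IsGoldenFrame e) (p : E3) :
    (interior (rhombohedron p e)).Nonempty := by
  let B := basisOfLinearIndependentOfCardEqFinrank he.linearIndependent (by simp)
  have h := B.parallelepiped.interior_nonempty
  rw [Module.Basis.coe_parallelepiped, coe_basisOfLinearIndependentOfCardEqFinrank] at h
  have h1 := h.image (Homeomorph.addLeft p)
  rwa [(Homeomorph.addLeft p).image_interior] at h1

lemma isCompact_rhombohedron (p : E3) (e : Fin 3 → E3) : IsCompact (rhombohedron p e) := by
  refine IsCompact.image ?_ (by fun_prop)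
  exact isCompact_Icc.image (by fun_prop)

lemma IsAmmannTiling.countable {σ : ℝ} {T : Set (Set E3)} (hT : IsAmmannTiling σ T) :
    T.Countable := by
  refine (countable_iUnion fun n : ℕ => (hT.locallyFinite n).countable).mono fun Δ hΔ => ?_
  have hne : Δ.Nonempty := by
    rcases hT.tiles Δ hΔ with ⟨p, e, rfl, -⟩ | ⟨p, e, rfl, -⟩ <;>
      exact ⟨p, mem_rhombohedron.2 ⟨0, fun i => ⟨le_rfl, zero_le_one⟩, by simp⟩⟩
  obtain ⟨x, hx⟩ := hne
  obtain ⟨n, hn⟩ := exists_nat_ge ‖x‖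
  exact mem_iUnion.2 ⟨n, hΔ, x, hx, mem_closedBall_zero_iff.2 hn⟩

/-- A segment between generic points misses countably many given lines. -/
lemma exists_segment_disjoint_lines {ι : Type*} [Countable ι] (a v : ι → E3) {U U' : Set E3}
    (hU : IsOpen U) (hU' : IsOpen U') (hne : U.Nonempty) (hne' : U'.Nonempty) :
    ∃ p ∈ U, ∃ q ∈ U', ∀ x ∈ segment ℝ p q, ∀ i, ∀ s : ℝ, x ≠ a i + s • v i := by
  obtain ⟨p, hp, hpU⟩ := (dense_notMem_planes a v v).inter_open_nonempty U hU hne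
  obtain ⟨q, hq, hqU⟩ := (dense_notMem_planes (fun _ => p) (fun i => a i - p) v).inter_open_nonempty
    U' hU' hne'
  refine ⟨p, hp, q, hq, fun x hx i s hxs => ?_⟩
  rw [segment_eq_image'] at hx
  obtain ⟨r, -, rfl⟩ := hx
  dsimp only at hxs
  by_cases hr : r = 0
  · refine hpU i (Submodule.mem_span_pair.2 ⟨s, 0, ?_⟩)
    rw [hr, zero_smul, add_zero] at hxs
    rw [hxs]
    module
  · refine hqU i (Submodule.mem_span_pair.2 ⟨r⁻¹, r⁻¹ * s, ?_⟩)
    rw [mul_smul, ← smul_add, inv_smul_eq_iff₀ hr, ← sub_eq_iff_eq_add'.2 hxs]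
    module

/-- A point of a rhombohedron with at most one coordinate in `(0, 1)` lies on the line through an
edge. -/
lemma exists_pair_or_mem_line (p : E3) (e : Fin 3 → E3) {t : Fin 3 → ℝ}
    (ht : ∀ i, 0 ≤ t i ∧ t i ≤ 1) :
    (∃ i j, i ≠ j ∧ (0 < t i ∧ t i < 1) ∧ (0 < t j ∧ t j < 1)) ∨
      ∃ (i : Fin 3) (ε : Fin 3 → Bool) (s : ℝ),
        p + ∑ i, t i • e i = (p + ∑ j, (if ε j then 1 else 0 : ℝ) • e j) + s • e i := by
  by_cases h : ∃ i j, i ≠ j ∧ (0 < t i ∧ t i < 1) ∧ (0 < t j ∧ t j < 1)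
  · exact .inl h
  right
  have hex : ∃ i, ∀ j, j ≠ i → t j = 0 ∨ t j = 1 := by
    by_cases h0 : ∃ i, 0 < t i ∧ t i < 1
    · obtain ⟨i, hi⟩ := h0
      refine ⟨i, fun j hj => ?_⟩
      by_contra! hj'
      exact h ⟨i, j, hj.symm, hi, lt_of_le_of_ne (ht j).1 hj'.1.symm, lt_of_le_of_ne (ht j).2 hj'.2⟩
    · refine ⟨0, fun j _ => ?_⟩
      by_contra! hj'
      exact h0 ⟨j, lt_of_le_of_ne (ht j).1 hj'.1.symm, lt_of_le_of_ne (ht j).2 hj'.2⟩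
  obtain ⟨i, hi⟩ := hex
  classical
  let ε : Fin 3 → Bool := fun j => decide (t j = 1)
  refine ⟨i, ε, t i - (if ε i then 1 else 0), ?_⟩
  rw [add_assoc]
  congr 1
  rw [← sub_eq_iff_eq_add', ← Finset.sum_sub_distrib, Finset.sum_eq_single i]
  · rw [sub_smul]
  · intro j _ hj
    rcases hi j hj with h | h <;> simp [ε, h]
  · exact fun h => absurd (Finset.mem_univ i) h

/-- All tiles of an aligned Ammann tiling have edges parallel to the `V_k`. A generic segment from
a tile with this property to one without it would pass from the ones to the others at a point off
all edges. -/
theorem IsAmmannTiling.isIcosahedralTile {T : Set (Set E3)} (hT : IsAmmannTiling edgeLength T)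
    {Δ₀ : Set E3} (h₀ : Δ₀ ∈ T) (hico : IsIcosahedralTile Δ₀) {Δ₁ : Set E3} (h₁ : Δ₁ ∈ T) :
    IsIcosahedralTile Δ₁ := by
  by_contra hbad
  have := hT.countable.to_subtype
  choose v e hve he using fun Δ : T => hT.exists_frame Δ.2
  have hint : ∀ Δ ∈ T, (interior Δ).Nonempty := by
    intro Δ hΔ
    have := (he ⟨Δ, hΔ⟩).interior_nonempty (v ⟨Δ, hΔ⟩)
    rwa [← hve ⟨Δ, hΔ⟩] at this
  have hclosed : ∀ Δ ∈ T, IsClosed Δ := by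
    intro Δ hΔ
    have := (isCompact_rhombohedron (v ⟨Δ, hΔ⟩) (e ⟨Δ, hΔ⟩)).isClosed
    rwa [← hve ⟨Δ, hΔ⟩] at this
  obtain ⟨p, hp, q, hq, hpq⟩ := exists_segment_disjoint_lines
    (fun i : T × (Fin 3 → Bool) × Fin 3 => v i.1 + ∑ j, (if i.2.1 j then 1 else 0 : ℝ) • e i.1 j)
    (fun i => e i.1 i.2.2) isOpen_interior isOpen_interior (hint Δ₀ h₀) (hint Δ₁ h₁)
  have hp' := interior_subset hp
  have hq' := interior_subset hq
  obtain ⟨r, hr⟩ : ∃ r : ℝ, segment ℝ p q ⊆ Metric.closedBall 0 r :=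
    ⟨max ‖p‖ ‖q‖, (convex_closedBall _ _).segment_subset
      (mem_closedBall_zero_iff.2 (le_max_left _ _)) (mem_closedBall_zero_iff.2 (le_max_right _ _))⟩
  have hfin := hT.locallyFinite r
  let A := ⋃₀ {Δ ∈ {Δ ∈ T | (Δ ∩ Metric.closedBall 0 r).Nonempty} | IsIcosahedralTile Δ}
  let B := ⋃₀ {Δ ∈ {Δ ∈ T | (Δ ∩ Metric.closedBall 0 r).Nonempty} | ¬IsIcosahedralTile Δ}
  have hA : IsClosed A := by
    rw [show A = ⋃ Δ ∈ _, Δ from sUnion_eq_biUnion]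
    exact (hfin.subset (sep_subset _ _)).isClosed_biUnion fun Δ hΔ => hclosed Δ hΔ.1.1
  have hB : IsClosed B := by
    rw [show B = ⋃ Δ ∈ _, Δ from sUnion_eq_biUnion]
    exact (hfin.subset (sep_subset _ _)).isClosed_biUnion fun Δ hΔ => hclosed Δ hΔ.1.1
  have hAB : segment ℝ p q ⊆ A ∪ B := by
    intro x hx
    have hx' : x ∈ ⋃₀ T := by rw [hT.cover]; trivial
    obtain ⟨Δ, hΔ, hxΔ⟩ := hx'
    by_cases hgood : IsIcosahedralTile Δ
    · exact .inl ⟨Δ, ⟨⟨hΔ, x, hxΔ, hr hx⟩, hgood⟩, hxΔ⟩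
    · exact .inr ⟨Δ, ⟨⟨hΔ, x, hxΔ, hr hx⟩, hgood⟩, hxΔ⟩
  have hpS := left_mem_segment ℝ p q
  have hqS := right_mem_segment ℝ p q
  obtain ⟨x, hxS, ⟨Δ, hΔ, hxΔ⟩, ⟨Δ', hΔ', hxΔ'⟩⟩ :=
    isPreconnected_closed_iff.1 (convex_segment p q).isPreconnected A B hA hB hAB
      ⟨p, hpS, Δ₀, ⟨⟨h₀, p, hp', hr hpS⟩, hico⟩, hp'⟩
      ⟨q, hqS, Δ₁, ⟨⟨h₁, q, hq', hr hqS⟩, hbad⟩, hq'⟩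
  have hne : Δ ≠ Δ' := by
    rintro rfl
    exact hΔ'.2 hΔ.2
  obtain ⟨hF, hF'⟩ := hT.faceToFace Δ hΔ.1.1 Δ' hΔ'.1.1 hne
  refine hΔ'.2 ?_
  let τ : T := ⟨Δ', hΔ'.1.1⟩
  have hτ : Δ' = rhombohedron (v τ) (e τ) := hve τ
  rw [hτ] at hxΔ' hF hF' ⊢
  obtain ⟨t, ht, rfl⟩ := mem_rhombohedron.1 hxΔ'
  rcases exists_pair_or_mem_line (v τ) (e τ) ht with ⟨i, j, hij, hi, hj⟩ | ⟨i, ε, s, hline⟩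
  · exact hΔ.2.of_mem (he τ) hF hF' ht hxΔ hij hi hj
  · exact absurd hline (hpq _ hxS (τ, ε, i) s)

theorem IsAmmannTiling.isIcosahedralTile_of_isAligned {T : Set (Set E3)}
    (hT : IsAmmannTiling edgeLength T) (hT' : IsAligned T) {Δ : Set E3} (hΔ : Δ ∈ T) :
    IsIcosahedralTile Δ := by
  obtain ⟨k, ε, w, -, hε, hmem⟩ := hT'
  exact hT.isIcosahedralTile hmem (hT.isIcosahedralTile_of_facet hε hmem) hΔ

lemma isIcosahedral_vecV (k : Fin 6) : IsIcosahedral (vecV k) := ⟨k, .inl rfl⟩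

/-! ### The symplectic quasifolds of golden rhombohedra -/

theorem theorem2 :
    ∃ (Mb : SymplecticQuasifold (Fin 3 → ℂ) (SphereQuotient (1 / √φ)))
      (Mr : SymplecticQuasifold (Fin 3 → ℂ) (SphereQuotient 1)),
      (Mb.IsInduced (sphereForm (1 / √φ)) ∧
        CompactSpace (SphereQuotient (1 / √φ)) ∧ ConnectedSpace (SphereQuotient (1 / √φ)) ∧
        ∃ H : HamiltonianAction quasilatticeQ Mb, H.Effective ∧
          range H.moment = rhombohedron 0 ![vecV 3, vecV 4, vecV 5]) ∧
      (Mr.IsInduced (sphereForm 1) ∧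
        CompactSpace (SphereQuotient 1) ∧ ConnectedSpace (SphereQuotient 1) ∧
        ∃ H : HamiltonianAction quasilatticeQ Mr, H.Effective ∧
          range H.moment = rhombohedron 0 ![vecV 0, vecV 1, vecV 2]) ∧
      ∀ T : Set (Set E3), IsAmmannTiling edgeLength T → IsAligned T →
        (∀ Δ ∈ T, IsOblate edgeLength Δ → DelzantGives Δ Mb) ∧
        (∀ Δ ∈ T, IsProlate edgeLength Δ → DelzantGives Δ Mr) := by

  have hpos : 0 < 1 / √φ := one_div_pos.2 (Real.sqrt_pos.2 Real.goldenRatio_pos)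
  obtain ⟨nb, hb⟩ := exists_goldenBox_oblate (e := ![vecV 3, vecV 4, vecV 5])
    (by
      intro i
      fin_cases i
      exacts [isIcosahedral_vecV 3, isIcosahedral_vecV 4, isIcosahedral_vecV 5])
    (by
      intro i j hij
      fin_cases i <;> fin_cases j <;> first | exact absurd rfl hij | skip
      all_goals
        simp only [Fin.zero_eta, Fin.mk_one, Fin.reduceFinMk, Matrix.cons_val, inner_vecV]
        simp [signV])
  obtain ⟨nr, hr⟩ := exists_goldenBox_prolate (e := ![vecV 0, vecV 1, vecV 2])
    (by
      intro i
      fin_cases i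
      exacts [isIcosahedral_vecV 0, isIcosahedral_vecV 1, isIcosahedral_vecV 2])
    (by
      intro i j hij
      fin_cases i <;> fin_cases j <;> first | exact absurd rfl hij | skip
      all_goals
        simp only [Fin.zero_eta, Fin.mk_one, Fin.reduceFinMk, Matrix.cons_val, inner_vecV]
        simp [signV])
  refine ⟨(sphereQuotientModel hpos).quasifold, (sphereQuotientModel one_pos).quasifold,
    ⟨isInduced_sphereQuotientModel hpos, (sphereQuotientModel hpos).compactSpace,
      (sphereQuotientModel hpos).connectedSpace,
      (sphereQuotientModel hpos).hamiltonianAction 0 hb, (sphereQuotientModel hpos).effective 0 hb,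
      (sphereQuotientModel hpos).range_moment 0 hb⟩,
    ⟨isInduced_sphereQuotientModel one_pos, (sphereQuotientModel one_pos).compactSpace,
      (sphereQuotientModel one_pos).connectedSpace,
      (sphereQuotientModel one_pos).hamiltonianAction 0 hr,
      (sphereQuotientModel one_pos).effective 0 hr,
      (sphereQuotientModel one_pos).range_moment 0 hr⟩,
    fun T hT hT' => ⟨fun Δ hΔ hobl => ?_, fun Δ hΔ hpro => ?_⟩⟩
  · obtain ⟨p, e, rfl, h1, h2⟩ := hobl
    obtain ⟨hframe, hinner⟩ := isGoldenFrame_of_oblate h1 h2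
    have hico := (hT.isIcosahedralTile_of_isAligned hT' hΔ).isIcosahedral hframe
    obtain ⟨n, hn⟩ := exists_goldenBox_oblate hico hinner
    exact hn.delzantGives (sphereQuotientModel hpos) p
  · obtain ⟨p, e, rfl, h1, h2⟩ := hpro
    obtain ⟨hframe, hinner⟩ := isGoldenFrame_of_prolate h1 h2
    have hico := (hT.isIcosahedralTile_of_isAligned hT' hΔ).isIcosahedral hframe
    obtain ⟨n, hn⟩ := exists_goldenBox_prolate hico hinner
    exact hn.delzantGives (sphereQuotientModel one_pos) p
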